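/- Let $n\ge 2$ and let $\Gamma$ be a connected simple graph with vertex set $[n]=\{1,\dots,n\}$. \emph{Splines.} Let $S_n$ act on $\mathbb C[t_1,\dots,t_n]$ by $t_i\mapsto t_{w(i)}$. Let $\mathcal M_\Gamma$ be the ring of all $\rho\colon S_n\to\mathbb C[t_1,\dots,t_n]$ such that $\rho(w)-\rho(w(i,j))\in\langle t_{w(i)}-t_{w(j)}\rangle$ for all $w\in S_n$ and all edges $(i,j)$ of $\Gamma$ (with pointwise operations), graded by polynomial degree, with the dot action $(w\cdot\rho)(v)=w\,\rho(w^{-1}v)$ of $S_n$. Let $\bar t_i,\bar x_i\in\mathcal M_\Gamma$ be $\bar t_i(w)=t_i$ and $\bar x_i(w)=t_{w(i)}$. The quotients $\mathcal M_\Gamma/\langle\bar t_1,\dots,\bar t_n\rangle$ and $\mathcal M_\Gamma/\langle\bar x_1,\dots,\bar x_n\rangle$ are graded $S_n$-representations; let $L_{\Gamma,1}$ and $R_{\Gamma,1}$ be the Frobenius characters of their degree-one pieces, where the Frobenius character of a representation with character $\chi$ is $\frac1{n!}\sum_{w\in S_n}\chi(w)\,p_{\mathrm{cyc}(w)}$,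 with $p_\mu$ the power sum symmetric function and $\mathrm{cyc}(w)$ the cycle type of $w$. Let $h_\mu$ and $s_\mu$ denote the complete homogeneous and the Schur symmetric functions. \emph{Graph data.} A graph is $2$-connected if it is connected and stays connected after the removal of any one vertex (so a single edge is $2$-connected); a block of $\Gamma$ is a maximal $2$-connected subgraph; a cut vertex is a vertex $j$ such that $\Gamma-j$ is disconnected, and then $c(j)+1$ denotes the number of connected components of $\Gamma-j$. The block-cut tree has as vertices the cut vertices and the blocks of $\Gamma$, a cut vertex being joined to each block that contains it. Let $\mathrm{LB}_\Gamma$ be the set of blocks that are leaves (vertices of degree one) of the block-cut tree, and $\mathrm{IB}_\Gamma$ the set of all other blocks (so $\mathrm{LB}_\Gamma=\emptyset$ and $\mathrm{IB}_\Gamma=\{\Gamma\}$ if $\Gamma$ is $2$-connected). Let $\mathrm{IC}_\Gamma$ be the set of edges of $\Gamma$ whose two end points form the vertex set of a block in $\mathrm{IB}_\Gamma$ (the internal cut edges). For $e\in\mathrm{IC}_\Gamma$ let $G_e$ be any connected component of $([n],E(\Gamma)\setminus\{e\})$, and let $\lambda_e$ be the partition of $n$ with parts $n-|G_e|$ and $|G_e|$.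 \emph{Claim.} Every $e\in\mathrm{IC}_\Gamma$ is a cut edge of $\Gamma$, the integer $n-1-\sum_{j}c(j)$, summed over the cut vertices $j$ of $\Gamma$, is non-negative, and $$L_{\Gamma,1}=\sum_{e\in\mathrm{IC}_\Gamma}h_{\lambda_e}+\bigl(|\mathrm{LB}_\Gamma|+|\{B\in\mathrm{IB}_\Gamma: |B|>2\}|-1\bigr)h_{n-1,1}+\Bigl(n-1-\sum_{j}c(j)\Bigr)h_n,$$ $$R_{\Gamma,1}=\sum_{e\in\mathrm{IC}_\Gamma}\bigl(h_{\lambda_e}-s_n\bigr)+\bigl(|\mathrm{LB}_\Gamma|+|\{B\in\mathrm{IB}_\Gamma: |B|>2\}|\bigr)s_{n-1,1}.$$ Moreover $L_{\Gamma,1}$ is $h$-positive, i.e. a linear combination of the $h_\mu$ ($\mu$ a partition of $n$) with non-negative integer coefficients. -/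

import Mathlib

open Equiv MvPolynomial

noncomputable section

namespace CayleySpline

/-! ### Splines on the Cayley graph of the symmetric group attached to a graph on `Fin n` -/

section Splines

variable {n : ℕ}

/-- The ring of splines: families `ρ : S_n → ℂ[t]` such that
`ρ(w) - ρ(w (i j))` lies in the ideal `⟨t_{w(i)} - t_{w(j)}⟩` for every edge `(i, j)`. -/
def splines (Γ : SimpleGraph (Fin n)) :
    Subalgebra ℂ (Perm (Fin n) → MvPolynomial (Fin n) ℂ) where
  carrier := {ρ | ∀ (w : Perm (Fin n)) (i j : Fin n), Γ.Adj i j →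
    ρ w - ρ (w * swap i j) ∈
      Ideal.span ({X (w i) - X (w j)} : Set (MvPolynomial (Fin n) ℂ))}
  mul_mem' := by
    intro a b ha hb w i j h
    have e : (a * b) w - (a * b) (w * swap i j) =
        a w * (b w - b (w * swap i j)) + b (w * swap i j) * (a w - a (w * swap i j)) := by
      simp only [Pi.mul_apply]; ring
    rw [e]
    exact Ideal.add_mem _ (Ideal.mul_mem_left _ _ (hb w i j h))
      (Ideal.mul_mem_left _ _ (ha w i j h))
  add_mem' := by
    intro a b ha hb w i j h
    have e : (a + b) w - (a + b) (w * swap i j) =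
        (a w - a (w * swap i j)) + (b w - b (w * swap i j)) := by
      simp only [Pi.add_apply]; ring
    rw [e]
    exact Ideal.add_mem _ (ha w i j h) (hb w i j h)
  algebraMap_mem' := by
    intro c w i j _
    simp

/-- The constant spline `w ↦ t_i`. -/
def tSpline (Γ : SimpleGraph (Fin n)) (i : Fin n) : splines Γ :=
  ⟨fun _ => X i, fun w i j _ => by simp⟩

/-- The spline `w ↦ t_{w(i)}`. -/
def xSpline (Γ : SimpleGraph (Fin n)) (i : Fin n) : splines Γ :=
  ⟨fun w => X (w i), fun w a b _ => by
    simp only [Perm.mul_apply, swap_apply_def]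
    split_ifs with h1 h2
    · subst h1
      exact Ideal.mem_span_singleton_self _
    · subst h2
      exact Ideal.mem_span_singleton'.2 ⟨-1, by ring⟩
    · simp⟩

theorem dot_mem (Γ : SimpleGraph (Fin n)) (w : Perm (Fin n))
    {ρ : Perm (Fin n) → MvPolynomial (Fin n) ℂ} (hρ : ρ ∈ splines Γ) :
    (fun v => rename w (ρ (w⁻¹ * v))) ∈ splines Γ := by
  intro v i j h
  have := Ideal.mem_map_of_mem (rename w : MvPolynomial (Fin n) ℂ →ₐ[ℂ] _) (hρ (w⁻¹ * v) i j h)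
  rw [Ideal.map_span] at this
  simpa [mul_assoc] using this

/-- The dot action `(w · ρ)(v) = w (ρ(w⁻¹ v))` of `S_n` on splines, where `S_n` acts on
polynomials by `t_i ↦ t_{w(i)}`. -/
def dotAction (Γ : SimpleGraph (Fin n)) : Representation ℂ (Perm (Fin n)) (splines Γ) where
  toFun w :=
    { toFun := fun ρ => ⟨fun v => rename w (ρ.1 (w⁻¹ * v)), dot_mem Γ w ρ.2⟩
      map_add' := fun a b => by ext1; funext v; simp
      map_smul' := fun c a => by ext1; funext v; simp }
  map_one' := by
    ext1 a; ext1; funext v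
    simp
  map_mul' w u := by
    ext1 a; ext1; funext v
    simp [rename_rename, mul_assoc, Perm.coe_mul]

/-- The homogeneous splines of degree `d`. -/
def homogeneousSplines (Γ : SimpleGraph (Fin n)) (d : ℕ) : Submodule ℂ (splines Γ) where
  carrier := {ρ | ∀ w, (ρ.1 w).IsHomogeneous d}
  add_mem' ha hb w := (ha w).add (hb w)
  zero_mem' _ := isHomogeneous_zero _ _ _
  smul_mem' c a ha w := by
    have := (isHomogeneous_C (Fin n) c).mul (ha w)
    rw [zero_add, ← smul_eq_C_mul] at this
    exact this

/-- The ideal `⟨t̄_1, …, t̄_n⟩` of the ring of splines. -/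
def leftIdeal (Γ : SimpleGraph (Fin n)) : Ideal (splines Γ) :=
  Ideal.span (Set.range (tSpline Γ))

/-- The ideal `⟨x̄_1, …, x̄_n⟩` of the ring of splines. -/
def rightIdeal (Γ : SimpleGraph (Fin n)) : Ideal (splines Γ) :=
  Ideal.span (Set.range (xSpline Γ))

theorem dotAction_mul (Γ : SimpleGraph (Fin n)) (w : Perm (Fin n)) (a b : splines Γ) :
    dotAction Γ w (a * b) = dotAction Γ w a * dotAction Γ w b := by
  ext1; funext v; simp [dotAction]

theorem span_stable (Γ : SimpleGraph (Fin n)) (w : Perm (Fin n)) (s : Set (splines Γ))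
    (hs : ∀ a ∈ s, dotAction Γ w a ∈ s) :
    (Ideal.span s).restrictScalars ℂ ≤
      ((Ideal.span s).restrictScalars ℂ).comap (dotAction Γ w) := by
  intro a ha
  change dotAction Γ w a ∈ Ideal.span s
  change a ∈ Ideal.span s at ha
  induction ha using Submodule.span_induction with
  | mem x hx => exact Ideal.subset_span (hs x hx)
  | zero => simp
  | add x y _ _ hx hy => rw [map_add]; exact Ideal.add_mem _ hx hy
  | smul r x _ hx =>
    rw [smul_eq_mul, dotAction_mul]; exact Ideal.mul_mem_left _ _ hx

theorem leftIdeal_stable (Γ : SimpleGraph (Fin n)) (w : Perm (Fin n)) :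
    (leftIdeal Γ).restrictScalars ℂ ≤
      ((leftIdeal Γ).restrictScalars ℂ).comap (dotAction Γ w) := by
  refine span_stable Γ w _ ?_
  rintro _ ⟨i, rfl⟩
  refine ⟨w i, ?_⟩
  ext1; funext v; simp [dotAction, tSpline]

theorem rightIdeal_stable (Γ : SimpleGraph (Fin n)) (w : Perm (Fin n)) :
    (rightIdeal Γ).restrictScalars ℂ ≤
      ((rightIdeal Γ).restrictScalars ℂ).comap (dotAction Γ w) := by
  refine span_stable Γ w _ ?_
  rintro _ ⟨i, rfl⟩
  refine ⟨i, ?_⟩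
  ext1; funext v; simp [dotAction, xSpline]

theorem homogeneous_stable (Γ : SimpleGraph (Fin n)) (d : ℕ) (w : Perm (Fin n)) :
    homogeneousSplines Γ d ≤ (homogeneousSplines Γ d).comap (dotAction Γ w) :=
  fun _ ha v => (ha (w⁻¹ * v)).rename_isHomogeneous

theorem map_stable (Γ : SimpleGraph (Fin n)) (d : ℕ) (I : Submodule ℂ (splines Γ))
    (hI : ∀ w, I ≤ I.comap (dotAction Γ w)) (w : Perm (Fin n)) :
    (homogeneousSplines Γ d).map I.mkQ ≤
      ((homogeneousSplines Γ d).map I.mkQ).comap ((dotAction Γ).quotient I hI w) := by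
  rintro _ ⟨a, ha, rfl⟩
  exact ⟨dotAction Γ w a, homogeneous_stable Γ d w ha, rfl⟩

/-- The degree `d` piece of the left quotient `splines Γ ⧸ ⟨t̄_1, …, t̄_n⟩`. -/
abbrev LeftPiece (Γ : SimpleGraph (Fin n)) (d : ℕ) :
    Submodule ℂ (splines Γ ⧸ (leftIdeal Γ).restrictScalars ℂ) :=
  (homogeneousSplines Γ d).map ((leftIdeal Γ).restrictScalars ℂ).mkQ

/-- The degree `d` piece of the right quotient `splines Γ ⧸ ⟨x̄_1, …, x̄_n⟩`. -/
abbrev RightPiece (Γ : SimpleGraph (Fin n)) (d : ℕ) :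
    Submodule ℂ (splines Γ ⧸ (rightIdeal Γ).restrictScalars ℂ) :=
  (homogeneousSplines Γ d).map ((rightIdeal Γ).restrictScalars ℂ).mkQ

/-- The representation of `S_n` on the degree `d` piece of the left quotient. -/
def leftRep (Γ : SimpleGraph (Fin n)) (d : ℕ) :
    Representation ℂ (Perm (Fin n)) (LeftPiece Γ d) :=
  ((dotAction Γ).quotient _ (leftIdeal_stable Γ)).subrepresentation _
    (map_stable Γ d _ (leftIdeal_stable Γ))

/-- The representation of `S_n` on the degree `d` piece of the right quotient. -/
def rightRep (Γ : SimpleGraph (Fin n)) (d : ℕ) :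
    Representation ℂ (Perm (Fin n)) (RightPiece Γ d) :=
  ((dotAction Γ).quotient _ (rightIdeal_stable Γ)).subrepresentation _
    (map_stable Γ d _ (rightIdeal_stable Γ))

/-- The graded pieces are finite dimensional, so traces on them are meaningful. -/
instance finite_homogeneousSplines (Γ : SimpleGraph (Fin n)) (d : ℕ) :
    Module.Finite ℂ (homogeneousSplines Γ d) := by
  have : Module.Finite ℂ (homogeneousSubmodule (Fin n) ℂ d) :=
    Module.Finite.iff_fg.2 (homogeneousSubmodule_fg (Fin n) ℂ d)
  let f : homogeneousSplines Γ d →ₗ[ℂ] (Perm (Fin n) → homogeneousSubmodule (Fin n) ℂ d) :=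
    { toFun := fun a w => ⟨a.1.1 w, a.2 w⟩
      map_add' := fun _ _ => rfl
      map_smul' := fun _ _ => rfl }
  refine Module.Finite.of_injective f fun a b h => ?_
  ext1; ext1; funext w
  exact congrArg Subtype.val (congrFun h w)

end Splines

/-! ### Symmetric functions

Symmetric functions are regarded as elements of the ring of formal power series in the
variables `x_0, x_1, x_2, …` with complex coefficients. -/

/-- The complete homogeneous symmetric function `h_k`: the sum of all monomials of degree `k`. -/
def completeHomogeneous (k : ℕ) : MvPowerSeries ℕ ℂ :=
  fun m => if m.degree = k then 1 else 0

/-- The complete homogeneous symmetric function `h_μ = ∏ h_{μ_i}`. -/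
def hSym {n : ℕ} (μ : n.Partition) : MvPowerSeries ℕ ℂ :=
  (μ.parts.map completeHomogeneous).prod

open Classical in
/-- The power sum `p_k = ∑ x_i ^ k` (for `k ≥ 1`). -/
def powerSum (k : ℕ) : MvPowerSeries ℕ ℂ :=
  fun m => if ∃ i, m = Finsupp.single i k then 1 else 0

/-- The Young diagram whose row lengths are the parts of `μ`. -/
def diagram {n : ℕ} (μ : n.Partition) : YoungDiagram :=
  YoungDiagram.ofRowLens (μ.parts.sort (· ≥ ·)) (Multiset.pairwise_sort _ _).sortedGE

/-- The Schur function `s_μ`: the coefficient of `x^m` is the number of semistandard Young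
tableaux of shape `μ` in which each `i` occurs exactly `m i` times. -/
def schur {n : ℕ} (μ : n.Partition) : MvPowerSeries ℕ ℂ :=
  fun m => (Nat.card {T : SemistandardYoungTableau (diagram μ) //
    ∀ i : ℕ, ((diagram μ).cells.filter fun c => T c.1 c.2 = i).card = m i} : ℂ)

/-- The Frobenius characteristic `(1 / n!) ∑_w χ(w) p_{cyc(w)}` of a representation of `S_n`,
where `cyc(w)` is the cycle type of `w`, fixed points included. -/
def frobenius {n : ℕ} {V : Type*} [AddCommGroup V] [Module ℂ V]
    (ρ : Representation ℂ (Perm (Fin n)) V) : MvPowerSeries ℕ ℂ :=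
  ((n.factorial : ℂ)⁻¹) • ∑ w : Perm (Fin n),
    ρ.character w • (w.partition.parts.map powerSum).prod

/-- The degree `d` piece of the Frobenius character of the left quotient. -/
def leftChar {n : ℕ} (Γ : SimpleGraph (Fin n)) (d : ℕ) : MvPowerSeries ℕ ℂ :=
  frobenius (leftRep Γ d)

/-- The degree `d` piece of the Frobenius character of the right quotient. -/
def rightChar {n : ℕ} (Γ : SimpleGraph (Fin n)) (d : ℕ) : MvPowerSeries ℕ ℂ :=
  frobenius (rightRep Γ d)

/-- The partition `(n - a, a)` of `n`, reordered and with a zero part dropped if necessary. -/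
def twoPart (n a : ℕ) (ha : a ≤ n) : n.Partition :=
  Nat.Partition.ofSums n {n - a, a} (by simp; omega)

/-! ### Cut vertices, blocks and the block-cut tree -/

section Graph

variable {V : Type*}

/-- `G` is `k`-connected if removing fewer than `k` vertices never disconnects it. -/
def IsVertexConnected (G : SimpleGraph V) (k : ℕ) : Prop :=
  ∀ A : Set V, A.encard < k → (G.induce Aᶜ).Preconnected

/-- `v` is a cut vertex if `G - v` is disconnected. -/
def IsCutVertex (G : SimpleGraph V) (v : V) : Prop :=
  ¬ (G.induce {v}ᶜ).Preconnected

/-- A block is a maximal 2-connected subgraph. -/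
def IsBlock {G : SimpleGraph V} (B : G.Subgraph) : Prop :=
  Maximal (fun H : G.Subgraph => IsVertexConnected H.coe 2) B

/-- The block-cut tree: its vertices are the cut vertices and the blocks of `G`, and a cut vertex
is joined to the blocks that contain it. -/
def blockCutTree (G : SimpleGraph V) :
    SimpleGraph ({v : V // IsCutVertex G v} ⊕ {B : G.Subgraph // IsBlock B}) where
  Adj
    | .inl v, .inr B => v.1 ∈ B.1.verts
    | .inr B, .inl v => v.1 ∈ B.1.verts
    | _, _ => False
  symm := ⟨by rintro (v | B) (v' | B') hh <;> exact hh⟩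
  loopless := ⟨by rintro (v | B) hh <;> exact hh⟩

/-- The leaf blocks: blocks that are leaves (vertices of degree one) of the block-cut tree. -/
def leafBlocks (G : SimpleGraph V) : Set G.Subgraph :=
  {B | ∃ hB : IsBlock B, ((blockCutTree G).neighborSet (.inr ⟨B, hB⟩)).encard = 1}

/-- The internal blocks: blocks that are not leaves of the block-cut tree. -/
def internalBlocks (G : SimpleGraph V) : Set G.Subgraph :=
  {B | IsBlock B ∧ B ∉ leafBlocks G}

open Classical in
/-- The internal cut edges: edges whose two end points form the vertex set of an internal block. -/
def internalCutEdges [Fintype V] (G : SimpleGraph V) : Finset (Sym2 V) :=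
  {e | e ∈ G.edgeSet ∧ ∃ B ∈ internalBlocks G, B.verts = (e : Set V)}

open Classical in
/-- The cut vertices of `G`. -/
def cutVertices [Fintype V] (G : SimpleGraph V) : Finset V :=
  {v | IsCutVertex G v}

/-- One less than the number of connected components of `G - v`. -/
def cutNumber (G : SimpleGraph V) (v : V) : ℕ :=
  Nat.card (G.induce {v}ᶜ).ConnectedComponent - 1

/-- `|LB| + #{B ∈ IB : |B| > 2}`, the number of blocks that are leaf blocks or are internal
with more than two vertices. -/
def blockCount (G : SimpleGraph V) : ℕ :=
  (leafBlocks G).ncard + {B ∈ internalBlocks G | 2 < B.verts.ncard}.ncard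

end Graph

/-- The partition `(n - |C|, |C|)` of `n` given by a connected component `C` of a graph
on `Fin n`. -/
def componentPartition {n : ℕ} {G : SimpleGraph (Fin n)} (C : G.ConnectedComponent) :
    n.Partition :=
  twoPart n C.supp.ncard (by simpa using Set.ncard_le_card C.supp)

end CayleySpline

end

/-!
A spline of degree one is `w ↦ ∑ p, b p w • t_{w(p)}` for scalars `b p w`, and the spline condition
says that `b p` is invariant under right translation by the edges avoiding `p` and that `∑ p, b p`
is constant. Cutting `Γ` at the vertices of a block `B` attaches every vertex to a vertex of `B`,
and `b` is, up to a constant family, the sum over the blocks of its parts in the direction of `B`.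

The part in the direction of `B` is a function on the `a`-element subsets of `[n]` up to constants.
If `B` has more than two vertices, then `a = 1`: the differences of `b p` along transpositions form
a cocycle which depends on single values of `w` only. If `B` is an edge, then `a` is the number of
vertices on one side of it. Hence the degree one splines have the character
`n - #blocks + ∑_B (character of the a_B-subsets)`, and passing to the two quotients subtracts
the character of the points, respectively `n` times the trivial one. The Frobenius characteristic
of the representation on `a`-subsets is `h_a h_{n-a}` by a Burnside count of words, and
double counting the incidences of blocks and vertices gives `∑ c(j) = #blocks - 1`.

For `h`-positivity, the subtracted `h_1 h_{n-1}` is the contribution of some block: walking away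
from a block through one of its vertices shrinks the branch at that vertex until it has one element.
-/

noncomputable section

namespace CayleySpline

/-! ### Blocks of a graph -/

section Blocks

variable {V : Type*} {G : SimpleGraph V} {p x y z v i j : V}

/-- `x` and `y` are joined by a walk avoiding `p`, that is, they are vertices of the same component
of `G - p`. -/
def ReachableAvoiding (G : SimpleGraph V) (p x y : V) : Prop :=
  ∃ w : G.Walk x y, p ∉ w.support

theorem ReachableAvoiding.refl (h : p ≠ x) : ReachableAvoiding G p x x :=
  ⟨.nil, by simpa using h⟩

theorem ReachableAvoiding.symm : ReachableAvoiding G p x y → ReachableAvoiding G p y x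
  | ⟨w, hw⟩ => ⟨w.reverse, by simpa using hw⟩

theorem ReachableAvoiding.trans :
    ReachableAvoiding G p x y → ReachableAvoiding G p y z → ReachableAvoiding G p x z
  | ⟨w, hw⟩, ⟨w', hw'⟩ => ⟨w.append w', by simp [SimpleGraph.Walk.mem_support_append_iff, hw, hw']⟩

theorem ReachableAvoiding.ne_left : ReachableAvoiding G p x y → p ≠ x
  | ⟨w, hw⟩, h => hw (h ▸ w.start_mem_support)

theorem ReachableAvoiding.ne_right (h : ReachableAvoiding G p x y) : p ≠ y :=
  h.symm.ne_left

theorem reachableAvoiding_of_adj (h : G.Adj x y) (hx : p ≠ x) (hy : p ≠ y) :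
    ReachableAvoiding G p x y :=
  ⟨h.toWalk, by simp [hx, hy]⟩

theorem reachableAvoiding_of_reachable {V' : Type*} {G' : SimpleGraph V'} (f : G' →g G) {a b : V'}
    (hp : ∀ c, f c ≠ p) : G'.Reachable a b → ReachableAvoiding G p (f a) (f b)
  | ⟨w⟩ => ⟨w.map f, by simpa [SimpleGraph.Walk.support_map] using fun c _ => hp c⟩

theorem ReachableAvoiding.map {V' : Type*} {G' : SimpleGraph V'} (f : G' →g G)
    (hf : Function.Injective f) {a b c : V'} :
    ReachableAvoiding G' c a b → ReachableAvoiding G (f c) (f a) (f b)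
  | ⟨w, hw⟩ => ⟨w.map f, by
      rw [SimpleGraph.Walk.support_map]
      exact (List.mem_map_of_injective hf).not.2 hw⟩

theorem reachable_induce_compl_iff (hx : x ∈ ({p}ᶜ : Set V)) (hy : y ∈ ({p}ᶜ : Set V)) :
    (G.induce {p}ᶜ).Reachable ⟨x, hx⟩ ⟨y, hy⟩ ↔ ReachableAvoiding G p x y := by
  refine ⟨reachableAvoiding_of_reachable (SimpleGraph.Embedding.induce _).toHom fun c => c.2, ?_⟩
  rintro ⟨w, hw⟩
  exact ⟨w.induce {p}ᶜ fun c hc => ne_of_mem_of_not_mem hc hw⟩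

theorem reachableAvoiding_of_mem_support_isPath {w : G.Walk x y} (hw : w.IsPath)
    (hv : v ∈ w.support) (hp : p ≠ v) : ReachableAvoiding G p x v ∨ ReachableAvoiding G p v y := by
  obtain ⟨q, r, rfl⟩ := w.mem_support_iff_exists_append.1 hv
  by_contra! h
  have hq : p ∈ q.support := by_contra fun hq => h.1 ⟨q, hq⟩
  have hr : p ∈ r.support := by_contra fun hr => h.2 ⟨r, hr⟩
  exact hw.ne_of_mem_support_of_append hp hq hr rfl

/-- `x` and `y` can be joined in `G`, and still after the removal of any one further vertex. -/
structure Biconnected (G : SimpleGraph V) (x y : V) : Prop where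
  reachable : G.Reachable x y
  avoiding : ∀ p, p ≠ x → p ≠ y → ReachableAvoiding G p x y

theorem Biconnected.refl (x : V) : Biconnected G x x :=
  ⟨.refl x, fun _ h _ => .refl h⟩

theorem biconnected_of_adj (h : G.Adj x y) : Biconnected G x y :=
  ⟨h.reachable, fun _ hx hy => reachableAvoiding_of_adj h hx hy⟩

theorem Biconnected.map {V' : Type*} {G' : SimpleGraph V'} (f : G' →g G)
    (hf : Function.Injective f) {a b : V'} (h : Biconnected G' a b) :
    Biconnected G (f a) (f b) := by
  refine ⟨h.reachable.map f, fun p hpa hpb => ?_⟩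
  by_cases hp : ∃ c, f c = p
  · obtain ⟨c, rfl⟩ := hp
    exact (h.avoiding c (ne_of_apply_ne f hpa) (ne_of_apply_ne f hpb)).map f hf
  · exact reachableAvoiding_of_reachable f (not_exists.1 hp) h.reachable

theorem Biconnected.of_mem_support_isPath {w : G.Walk x y} (hw : w.IsPath) (hv : v ∈ w.support)
    (hx : Biconnected G x i) (hy : Biconnected G y i) : Biconnected G v i := by
  classical
  refine ⟨(w.dropUntil v hv).reachable.trans hy.reachable, fun p hpv hpi => ?_⟩
  rcases reachableAvoiding_of_mem_support_isPath hw hv hpv with h | h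
  · exact h.symm.trans (hx.avoiding p h.ne_left hpi)
  · exact h.trans (hy.avoiding p h.ne_right hpi)

theorem Biconnected.induce {S : Set V} (hS : ∀ w : G.Walk x y, w.IsPath → ∀ v ∈ w.support, v ∈ S)
    (hx : x ∈ S) (hy : y ∈ S) (h : Biconnected G x y) :
    Biconnected (G.induce S) ⟨x, hx⟩ ⟨y, hy⟩ := by
  classical
  constructor
  · obtain ⟨w, hw⟩ := h.reachable.exists_isPath
    exact ⟨w.induce S (hS w hw)⟩
  · rintro ⟨p, hp⟩ hpx hpy
    obtain ⟨w, hw⟩ := h.avoiding p (fun h => hpx (Subtype.ext h)) (fun h => hpy (Subtype.ext h))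
    refine ⟨w.bypass.induce S (hS _ w.bypass_isPath), ?_⟩
    rw [SimpleGraph.Walk.support_induce, List.mem_attachWith]
    exact fun h => hw (w.support_bypass_subset_support h)

theorem isVertexConnected_two_iff : IsVertexConnected G 2 ↔ ∀ x y, Biconnected G x y := by
  constructor
  · refine fun h x y => ⟨?_, fun p hpx hpy => ?_⟩
    · exact (h ∅ (by simp) ⟨x, by simp⟩ ⟨y, by simp⟩).map (SimpleGraph.Embedding.induce _).toHom
    · exact (reachable_induce_compl_iff hpx.symm hpy.symm).1 (h {p} (by norm_num) _ _)
  · rintro h A hA ⟨x, hx⟩ ⟨y, hy⟩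
    have hA' : A.Subsingleton :=
      Set.encard_le_one_iff_subsingleton.1
        (Order.le_of_lt_add_one (by simpa [one_add_one_eq_two] using hA))
    rcases hA'.eq_empty_or_singleton with rfl | ⟨p, rfl⟩
    · obtain ⟨w⟩ := (h x y).reachable
      exact ⟨w.induce _ (by simp)⟩
    · exact (reachable_induce_compl_iff hx hy).2
        ((h x y).avoiding p (fun h => hx h.symm) (fun h => hy h.symm))

/-- The vertex set of the block containing the edge `i j`. -/
def edgeBlockVerts (G : SimpleGraph V) (i j : V) : Set V :=
  {v | Biconnected G v i ∧ Biconnected G v j}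

theorem left_mem_edgeBlockVerts (h : G.Adj i j) : i ∈ edgeBlockVerts G i j :=
  ⟨.refl i, biconnected_of_adj h⟩

theorem right_mem_edgeBlockVerts (h : G.Adj i j) : j ∈ edgeBlockVerts G i j :=
  ⟨biconnected_of_adj h.symm, .refl j⟩

theorem biconnected_of_mem_edgeBlockVerts (hij : i ≠ j) (hx : x ∈ edgeBlockVerts G i j)
    (hy : y ∈ edgeBlockVerts G i j) : Biconnected G x y := by
  refine ⟨hx.1.reachable.trans hy.1.reachable.symm, fun p hpx hpy => ?_⟩
  by_cases hpi : p = i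
  · have hpj : p ≠ j := hpi ▸ hij
    exact (hx.2.avoiding p hpx hpj).trans (hy.2.avoiding p hpy hpj).symm
  · exact (hx.1.avoiding p hpx hpi).trans (hy.1.avoiding p hpy hpi).symm

theorem mem_edgeBlockVerts_of_isPath {w : G.Walk x y} (hw : w.IsPath)
    (hx : x ∈ edgeBlockVerts G i j) (hy : y ∈ edgeBlockVerts G i j) (hv : v ∈ w.support) :
    v ∈ edgeBlockVerts G i j :=
  ⟨.of_mem_support_isPath hw hv hx.1 hy.1, .of_mem_support_isPath hw hv hx.2 hy.2⟩

/-- The block containing the edge `i j`. -/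
def edgeBlock (G : SimpleGraph V) (i j : V) : G.Subgraph :=
  (⊤ : G.Subgraph).induce (edgeBlockVerts G i j)

theorem edgeBlock_adj : (edgeBlock G i j).Adj x y ↔
    x ∈ edgeBlockVerts G i j ∧ y ∈ edgeBlockVerts G i j ∧ G.Adj x y := by
  simp [edgeBlock]

theorem isVertexConnected_edgeBlock (hij : i ≠ j) : IsVertexConnected (edgeBlock G i j).coe 2 := by
  have h : IsVertexConnected (G.induce (edgeBlockVerts G i j)) 2 :=
    isVertexConnected_two_iff.2 fun x y =>
      (biconnected_of_mem_edgeBlockVerts hij x.2 y.2).induce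
        (fun _ hw _ => mem_edgeBlockVerts_of_isPath hw x.2 y.2) x.2 y.2
  rwa [SimpleGraph.induce_eq_coe_induce_top] at h

theorem biconnected_of_mem_verts {H : G.Subgraph} (hH : IsVertexConnected H.coe 2)
    (hx : x ∈ H.verts) (hy : y ∈ H.verts) : Biconnected G x y :=
  (isVertexConnected_two_iff.1 hH ⟨x, hx⟩ ⟨y, hy⟩).map H.hom H.hom_injective

theorem le_edgeBlock {H : G.Subgraph} (hH : IsVertexConnected H.coe 2)
    (hi : i ∈ H.verts) (hj : j ∈ H.verts) : H ≤ edgeBlock G i j := by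
  have hverts : H.verts ⊆ edgeBlockVerts G i j := fun v hv =>
    ⟨biconnected_of_mem_verts hH hv hi, biconnected_of_mem_verts hH hv hj⟩
  exact ⟨hverts, fun x y hxy => edgeBlock_adj.2
    ⟨hverts (H.edge_vert hxy), hverts (H.edge_vert hxy.symm), hxy.adj_sub⟩⟩

theorem isBlock_edgeBlock (hij : G.Adj i j) : IsBlock (edgeBlock G i j) :=
  ⟨isVertexConnected_edgeBlock hij.ne, fun _ hH hle =>
    le_edgeBlock hH (hle.1 (left_mem_edgeBlockVerts hij)) (hle.1 (right_mem_edgeBlockVerts hij))⟩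

/-- The type of blocks of `G`. -/
abbrev Block (G : SimpleGraph V) : Type _ :=
  {B : G.Subgraph // IsBlock B}

namespace IsBlock

variable {B B' : G.Subgraph}

theorem biconnected (hB : IsBlock B) (hx : x ∈ B.verts) (hy : y ∈ B.verts) : Biconnected G x y :=
  biconnected_of_mem_verts hB.1 hx hy

theorem eq_edgeBlock (hB : IsBlock B) (hij : i ≠ j) (hi : i ∈ B.verts) (hj : j ∈ B.verts) :
    B = edgeBlock G i j :=
  hB.eq_of_le (isVertexConnected_edgeBlock hij) (le_edgeBlock hB.1 hi hj)

theorem adj_iff (hB : IsBlock B) : B.Adj x y ↔ x ∈ B.verts ∧ y ∈ B.verts ∧ G.Adj x y := by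
  refine ⟨fun h => ⟨B.edge_vert h, B.edge_vert h.symm, h.adj_sub⟩, fun ⟨hx, hy, h⟩ => ?_⟩
  rw [hB.eq_edgeBlock h.ne hx hy, edgeBlock_adj]
  exact ⟨left_mem_edgeBlockVerts h, right_mem_edgeBlockVerts h, h⟩

theorem mem_of_isPath (hB : IsBlock B) {w : G.Walk x y} (hw : w.IsPath) (hx : x ∈ B.verts)
    (hy : y ∈ B.verts) (hv : v ∈ w.support) : v ∈ B.verts := by
  by_cases hxy : x = y
  · subst hxy
    rw [SimpleGraph.Walk.nil_iff_support_eq.1 (SimpleGraph.Walk.isPath_iff_nil.1 hw),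
      List.mem_singleton] at hv
    exact hv ▸ hx
  · have hB' := hB.eq_edgeBlock hxy hx hy
    rw [hB'] at hx hy ⊢
    exact mem_edgeBlockVerts_of_isPath hw hx hy hv

theorem eq_of_adj (hB : IsBlock B) (hB' : IsBlock B') (h : B.Adj x y) (h' : B'.Adj x y) :
    B = B' := by
  rw [hB.eq_edgeBlock h.ne (B.edge_vert h) (B.edge_vert h.symm),
    hB'.eq_edgeBlock h.ne (B'.edge_vert h') (B'.edge_vert h'.symm)]

theorem nonempty_verts [Nonempty V] (hB : IsBlock B) : B.verts.Nonempty := by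
  obtain ⟨v⟩ := ‹Nonempty V›
  by_contra! hempty
  have hle : B ≤ G.singletonSubgraph v :=
    ⟨by simp [hempty], fun x y h => (hempty.subset (B.edge_vert h)).elim⟩
  have hconn : IsVertexConnected (G.singletonSubgraph v).coe 2 :=
    isVertexConnected_two_iff.2 fun x y => Subtype.ext (x.2.trans y.2.symm) ▸ .refl x
  rw [hB.eq_of_le hconn hle] at hempty
  exact hempty.subset rfl

theorem nontrivial_verts (hB : IsBlock B) (hG : G.Connected) [Nontrivial V] :
    B.verts.Nontrivial := by
  by_contra! hsub
  obtain ⟨i, hi⟩ : ∃ i, B.verts ⊆ {i} := by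
    have := hG.nonempty
    obtain ⟨i, hi⟩ := hB.nonempty_verts
    exact ⟨i, fun v hv => hsub hv hi⟩
  obtain ⟨j, hij⟩ := hG.preconnected.exists_adj_of_nontrivial i
  have hle : B ≤ edgeBlock G i j :=
    ⟨hi.trans (Set.singleton_subset_iff.2 (left_mem_edgeBlockVerts hij)),
      fun x y h => (h.ne (hsub (B.edge_vert h) (B.edge_vert h.symm))).elim⟩
  rw [hB.eq_of_le (isVertexConnected_edgeBlock hij.ne) hle] at hsub
  exact hij.ne (hsub (left_mem_edgeBlockVerts hij) (right_mem_edgeBlockVerts hij))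

theorem exists_adj (hB : IsBlock B) (hG : G.Connected) [Nontrivial V] (hx : x ∈ B.verts) :
    ∃ y ∈ B.verts, G.Adj x y := by
  obtain ⟨y, hy, hxy⟩ := (hB.nontrivial_verts hG).exists_ne x
  obtain ⟨w, hw⟩ := (hB.biconnected hx hy).reachable.exists_isPath
  cases w with
  | nil => exact absurd rfl hxy
  | @cons _ z _ hxz w => exact ⟨z, hB.mem_of_isPath hw hx hy (by simp), hxz⟩

end IsBlock

theorem edgeBlock_eq_iff (hy : G.Adj p y) (hz : G.Adj p z) :
    edgeBlock G p y = edgeBlock G p z ↔ ReachableAvoiding G p y z := by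
  constructor
  · intro h
    have hz' : z ∈ (edgeBlock G p y).verts := h ▸ right_mem_edgeBlockVerts hz
    exact ((isBlock_edgeBlock hy).biconnected (right_mem_edgeBlockVerts hy) hz').avoiding
      p hy.ne hz.ne
  · intro h
    refine (isBlock_edgeBlock hy).eq_edgeBlock hz.ne (left_mem_edgeBlockVerts hy)
      ⟨biconnected_of_adj hz.symm, hz.symm.reachable.trans hy.reachable, fun q hqz hqy => ?_⟩
    by_cases hqp : q = p
    · exact hqp ▸ h.symm
    · exact (reachableAvoiding_of_adj hz.symm hqz hqp).trans (reachableAvoiding_of_adj hy hqp hqy)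

end Blocks

/-! ### Attaching the vertices of a graph to a block -/

section BlockProj

variable {V : Type*} {G : SimpleGraph V} {B : G.Subgraph} {p q x y : V}

theorem exists_reachable_sdiff_spanningCoe (hG : G.Preconnected) (hB : B.verts.Nonempty) (v : V) :
    ∃ p ∈ B.verts, (G \ B.spanningCoe).Reachable v p := by
  obtain ⟨b, hb⟩ := hB
  obtain ⟨w⟩ := hG v b
  induction w with
  | nil => exact ⟨_, hb, .refl _⟩
  | @cons a c _ hac _ ih =>
    by_cases ha : a ∈ B.verts
    · exact ⟨a, ha, .refl _⟩
    · obtain ⟨p, hp, hcp⟩ := ih hb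
      have hac' : (G \ B.spanningCoe).Adj a c := ⟨hac, fun h => ha (B.edge_vert h)⟩
      exact ⟨p, hp, hac'.reachable.trans hcp⟩

open Classical in
/-- The vertex of the block `B` through which `v` is attached to `B`, that is, the first vertex
of `B` on any walk from `v` to `B`. If there is no such walk, it is set to `v`. -/
def blockProj (B : G.Subgraph) (v : V) : V :=
  if h : ∃ p ∈ B.verts, (G \ B.spanningCoe).Reachable v p then h.choose else v

namespace IsBlock

theorem blockProj_spec (hB : IsBlock B) (hG : G.Connected) (v : V) :
    blockProj B v ∈ B.verts ∧ (G \ B.spanningCoe).Reachable v (blockProj B v) := by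
  have := hG.nonempty
  have h := exists_reachable_sdiff_spanningCoe hG.preconnected hB.nonempty_verts v
  rw [blockProj, dif_pos h]
  exact h.choose_spec

theorem blockProj_mem (hB : IsBlock B) (hG : G.Connected) (v : V) : blockProj B v ∈ B.verts :=
  (hB.blockProj_spec hG v).1

theorem eq_of_reachable_sdiff_spanningCoe (hB : IsBlock B) (hp : p ∈ B.verts) (hq : q ∈ B.verts)
    (h : (G \ B.spanningCoe).Reachable p q) : p = q := by
  obtain ⟨w, hw⟩ := h.exists_isPath
  cases w with
  | nil => rfl
  | @cons _ c _ hpc w =>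
    have hle : G \ B.spanningCoe ≤ G := sdiff_le
    have hc : c ∈ B.verts :=
      hB.mem_of_isPath (w := (w.cons hpc).mapLe hle) (hw.mapLe hle) hp hq (by simp)
    exact (hpc.2 (hB.adj_iff.2 ⟨hp, hc, hpc.1⟩)).elim

theorem blockProj_eq_iff (hB : IsBlock B) (hG : G.Connected) :
    blockProj B x = blockProj B y ↔ (G \ B.spanningCoe).Reachable x y := by
  obtain ⟨hxB, hx⟩ := hB.blockProj_spec hG x
  obtain ⟨hyB, hy⟩ := hB.blockProj_spec hG y
  exact ⟨fun h => hx.trans (h ▸ hy.symm),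
    fun h => hB.eq_of_reachable_sdiff_spanningCoe hxB hyB (hx.symm.trans (h.trans hy))⟩

theorem blockProj_eq_self_iff (hB : IsBlock B) (hG : G.Connected) :
    blockProj B x = x ↔ x ∈ B.verts := by
  obtain ⟨hxB, hx⟩ := hB.blockProj_spec hG x
  exact ⟨fun h => h ▸ hxB, fun h => (hB.eq_of_reachable_sdiff_spanningCoe h hxB hx).symm⟩

theorem blockProj_eq_self (hB : IsBlock B) (hG : G.Connected) (hx : x ∈ B.verts) :
    blockProj B x = x :=
  (hB.blockProj_eq_self_iff hG).2 hx

theorem blockProj_eq_of_adj (hB : IsBlock B) (hG : G.Connected) (h : G.Adj x y)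
    (h' : ¬ B.Adj x y) : blockProj B x = blockProj B y :=
  (hB.blockProj_eq_iff hG).2 (SimpleGraph.Adj.reachable ⟨h, h'⟩)

theorem blockProj_eq_iff_of_adj (hB : IsBlock B) (hG : G.Connected) (hxy : G.Adj x y)
    (h : ¬ (B.Adj x y ∧ (p = x ∨ p = y))) : blockProj B x = p ↔ blockProj B y = p := by
  by_cases hBxy : B.Adj x y
  · rw [hB.blockProj_eq_self hG (B.edge_vert hBxy), hB.blockProj_eq_self hG (B.edge_vert hBxy.symm)]
    tauto
  · rw [hB.blockProj_eq_of_adj hG hxy hBxy]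

theorem reachableAvoiding_blockProj (hB : IsBlock B) (hG : G.Connected)
    (hx : blockProj B x ≠ blockProj B q) : ReachableAvoiding G q x (blockProj B x) := by
  classical
  obtain ⟨w⟩ := (hB.blockProj_spec hG x).2
  refine ⟨w.mapLe sdiff_le, fun h => hx ?_⟩
  rw [SimpleGraph.Walk.support_mapLe_eq_support] at h
  exact (hB.blockProj_eq_iff hG).2 (w.takeUntil q h).reachable

theorem reachableAvoiding_of_blockProj_ne (hB : IsBlock B) (hG : G.Connected) (hp : p ∈ B.verts)
    (hx : blockProj B x ≠ p) (hy : blockProj B y ≠ p) : ReachableAvoiding G p x y := by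
  have toBlock : ∀ z, blockProj B z ≠ p → ReachableAvoiding G p z (blockProj B z) := fun z hz =>
    hB.reachableAvoiding_blockProj hG (by rwa [hB.blockProj_eq_self hG hp])
  have inBlock := (hB.biconnected (hB.blockProj_mem hG x) (hB.blockProj_mem hG y)).avoiding
    p hx.symm hy.symm
  exact ((toBlock x hx).trans inBlock).trans (toBlock y hy).symm

theorem blockProj_eq_of_reachableAvoiding (hB : IsBlock B) (hG : G.Connected)
    (h : ReachableAvoiding G p x y) (hx : blockProj B x = p) : blockProj B y = p := by
  obtain ⟨w, hw⟩ := h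
  induction w with
  | nil => exact hx
  | @cons a c _ hac w ih =>
    simp only [SimpleGraph.Walk.support_cons, List.mem_cons, not_or] at hw
    have hac' : ¬ B.Adj a c := fun h =>
      hw.1 (hx.symm.trans (hB.blockProj_eq_self hG (B.edge_vert h)))
    exact ih (by rw [← hB.blockProj_eq_of_adj hG hac hac', hx]) hw.2

end IsBlock

end BlockProj

/-! ### Counting blocks -/

section BlockCount

variable {V : Type*} {G : SimpleGraph V} {B : G.Subgraph} {p r j : V}

theorem IsBlock.isCutVertex_iff [Nontrivial V] (hB : IsBlock B) (hG : G.Connected)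
    (hp : p ∈ B.verts) : IsCutVertex G p ↔ ∃ x, x ≠ p ∧ blockProj B x = p := by
  constructor
  · intro h
    by_contra! hcon
    exact h fun x y => (reachable_induce_compl_iff x.2 y.2).2
      (hB.reachableAvoiding_of_blockProj_ne hG hp (hcon _ x.2) (hcon _ y.2))
  · rintro ⟨x, hxp, hx⟩ h
    obtain ⟨y, hy, hpy⟩ := hB.exists_adj hG hp
    have hxy := (reachable_induce_compl_iff (p := p) hxp hpy.ne').1 (h ⟨x, hxp⟩ ⟨y, hpy.ne'⟩)
    have hyp := hB.blockProj_eq_of_reachableAvoiding hG hxy hx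
    rw [hB.blockProj_eq_self hG hy] at hyp
    exact hpy.ne' hyp

theorem card_eq_of_ker_eq {α β γ : Type*} {f : α → β} {g : α → γ} (hf : f.Surjective)
    (hg : g.Surjective) (h : ∀ x y, f x = f y ↔ g x = g y) : Nat.card β = Nat.card γ := by
  have hker : Setoid.ker f = Setoid.ker g := Setoid.ext h
  rw [← Nat.card_congr (Setoid.quotientKerEquivOfSurjective f hf),
    ← Nat.card_congr (Setoid.quotientKerEquivOfSurjective g hg), hker]

/- Both sides count the neighbours `y` of `p` up to the relation of being joined in `G - p`: the
component of `y` in `G - p` corresponds to the block of the edge `p y`. -/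
theorem card_connectedComponent_induce_compl [Nontrivial V] (hG : G.Connected) (p : V) :
    Nat.card (G.induce {p}ᶜ).ConnectedComponent = Nat.card {B : Block G // p ∈ B.1.verts} := by
  refine card_eq_of_ker_eq (α := {y // G.Adj p y})
    (f := fun y => (G.induce {p}ᶜ).connectedComponentMk ⟨y.1, y.2.ne'⟩)
    (g := fun y => ⟨⟨edgeBlock G p y.1, isBlock_edgeBlock y.2⟩, left_mem_edgeBlockVerts y.2⟩)
    ?_ ?_ ?_
  · intro c
    induction c using SimpleGraph.ConnectedComponent.ind with | _ x =>
    obtain ⟨x, hx⟩ := x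
    obtain ⟨w, hw⟩ := (hG.preconnected p x).exists_isPath
    cases w with
    | nil => exact absurd rfl hx
    | @cons _ c _ hpc w =>
      refine ⟨⟨c, hpc⟩, SimpleGraph.ConnectedComponent.sound ?_⟩
      rw [SimpleGraph.Walk.cons_isPath_iff] at hw
      exact (reachable_induce_compl_iff hpc.ne' hx).2 ⟨w, hw.2⟩
  · rintro ⟨⟨B, hB⟩, hp⟩
    obtain ⟨y, hy, hpy⟩ := hB.exists_adj hG hp
    exact ⟨⟨y, hpy⟩, Subtype.ext (Subtype.ext (hB.eq_edgeBlock hpy.ne hp hy).symm)⟩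
  · rintro ⟨y, hy⟩ ⟨z, hz⟩
    exact SimpleGraph.ConnectedComponent.eq.trans <|
      (reachable_induce_compl_iff hy.ne' hz.ne').trans <|
        (edgeBlock_eq_iff hy hz).symm.trans
          ⟨fun h => Subtype.ext (Subtype.ext h), fun h => congrArg (fun B => B.1.1) h⟩

/- If the block-cut tree is rooted at `r`, this block is the parent of `j`. -/
theorem existsUnique_block_blockProj_ne [Nontrivial V] (hG : G.Connected) (hj : j ≠ r) :
    ∃! B : Block G, j ∈ B.1.verts ∧ blockProj B.1 r ≠ j := by
  obtain ⟨w, hw⟩ := (hG.preconnected j r).exists_isPath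
  cases w with
  | nil => exact absurd rfl hj
  | @cons _ y _ hjy w =>
    rw [SimpleGraph.Walk.cons_isPath_iff] at hw
    have hyr : ReachableAvoiding G j y r := ⟨w, hw.2⟩
    have hB := isBlock_edgeBlock hjy
    refine ⟨⟨edgeBlock G j y, hB⟩, ⟨left_mem_edgeBlockVerts hjy, fun h => ?_⟩, ?_⟩
    · have hyj := hB.blockProj_eq_of_reachableAvoiding hG hyr.symm h
      rw [hB.blockProj_eq_self hG (right_mem_edgeBlockVerts hjy)] at hyj
      exact hjy.ne' hyj
    · rintro ⟨B', hB'⟩ ⟨hjB', hr⟩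
      obtain ⟨z, hz, hjz⟩ := hB'.exists_adj hG hjB'
      have hzj : blockProj B' z ≠ j := by rw [hB'.blockProj_eq_self hG hz]; exact hjz.ne'
      refine Subtype.ext ((hB'.eq_edgeBlock hjz.ne hjB' hz).trans ?_)
      exact (edgeBlock_eq_iff hjz hjy).2
        ((hB'.reachableAvoiding_of_blockProj_ne hG hjB' hzj hr).trans hyr.symm)

instance [Finite V] : Finite (Block G) :=
  have : Finite G.Subgraph := inferInstance
  inferInstance

theorem cutNumber_add_one [Nontrivial V] [Finite V] (hG : G.Connected) (p : V) :
    cutNumber G p + 1 = Nat.card {B : Block G // p ∈ B.1.verts} := by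
  have : Nonempty (G.induce {p}ᶜ).ConnectedComponent := by
    obtain ⟨q, hq⟩ := exists_ne p
    exact ⟨(G.induce {p}ᶜ).connectedComponentMk ⟨q, hq⟩⟩
  rw [← card_connectedComponent_induce_compl hG, cutNumber, Nat.sub_add_cancel Nat.card_pos]

theorem cutNumber_eq_zero [Finite V] (h : ¬ IsCutVertex G p) : cutNumber G p = 0 := by
  have := (not_not.1 h).subsingleton_connectedComponent
  exact Nat.sub_eq_zero_of_le (Finite.card_le_one_iff_subsingleton.2 this)

open Classical in
theorem card_filter_mem_verts_add [Nontrivial V] [Fintype (Block G)] (hG : G.Connected) (r j : V) :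
    Finset.card {B : Block G | j ∈ B.1.verts} + (if j = r then 1 else 0) =
      Finset.card {B : Block G | blockProj B.1 r = j} + 1 := by
  have hmem : ∀ B : Block G, (blockProj B.1 r = j ∧ j ∈ B.1.verts) ↔ blockProj B.1 r = j :=
    fun B => and_iff_left_of_imp fun h => h ▸ B.2.blockProj_mem hG r
  have hsplit := Finset.card_filter_add_card_filter_not
    (s := ({B : Block G | j ∈ B.1.verts} : Finset _)) fun B => blockProj B.1 r = j
  simp only [Finset.filter_filter, and_comm (b := blockProj _ r = j), hmem] at hsplit
  by_cases hj : j = r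
  · subst hj
    have hiff : ∀ B : Block G, blockProj B.1 j = j ↔ j ∈ B.1.verts :=
      fun B => B.2.blockProj_eq_self_iff hG
    simp only [hiff, if_true]
  · have hone := (Fintype.existsUnique_iff_card_one _).1 (existsUnique_block_blockProj_ne hG hj)
    rw [if_neg hj, ← hsplit, hone, add_zero]

variable [Fintype V] [Nontrivial V]

/- Counting the pairs of a block and one of its vertices in two ways: seen from a root `r`, a
block `B` has one vertex `blockProj B r` nearest to `r`, and all other incidences correspond to the
vertices `j ≠ r`. -/
theorem sum_cutNumber_add_one (hG : G.Connected) :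
    ∑ j ∈ cutVertices G, cutNumber G j + 1 = Nat.card (Block G) := by
  classical
  have := Fintype.ofFinite (Block G)
  obtain ⟨r⟩ := hG.nonempty
  have hcut : ∑ j ∈ cutVertices G, cutNumber G j = ∑ j, cutNumber G j :=
    Finset.sum_subset (Finset.subset_univ _) fun j _ hj =>
      cutNumber_eq_zero (by simpa [cutVertices] using hj)
  have hinc : ∀ j, cutNumber G j + (if j = r then 1 else 0) =
      Finset.card {B : Block G | blockProj B.1 r = j} := fun j => by
    have h := card_filter_mem_verts_add hG r j
    rw [← Fintype.card_subtype, ← Nat.card_eq_fintype_card, ← cutNumber_add_one hG] at h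
    lia
  calc ∑ j ∈ cutVertices G, cutNumber G j + 1
      = ∑ j, (cutNumber G j + if j = r then 1 else 0) := by
        rw [hcut, Finset.sum_add_distrib, Finset.sum_ite_eq' Finset.univ,
          if_pos (Finset.mem_univ r)]
    _ = ∑ j, Finset.card {B : Block G | blockProj B.1 r = j} :=
        Finset.sum_congr rfl fun j _ => hinc j
    _ = Nat.card (Block G) := by
        rw [Nat.card_eq_fintype_card, ← Finset.card_univ]
        exact (Finset.card_eq_sum_card_fiberwise fun B _ => Finset.mem_univ _).symm

theorem card_block_lt (hG : G.Connected) : Nat.card (Block G) < Fintype.card V := by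
  classical
  obtain ⟨r⟩ := hG.nonempty
  choose y hy hadj using fun B : Block G => B.2.exists_adj hG (B.2.blockProj_mem hG r)
  have hyr : ∀ B, y B ≠ r := fun B h =>
    (hadj B).ne ((B.2.blockProj_eq_self hG (h ▸ hy B)).trans h.symm)
  have hinj : Function.Injective fun B => (⟨y B, hyr B⟩ : {j // j ≠ r}) := fun B B' h => by
    have h' : y B = y B' := congrArg Subtype.val h
    exact (existsUnique_block_blockProj_ne hG (hyr B)).unique ⟨hy B, (hadj B).ne⟩
      ⟨h' ▸ hy B', h' ▸ (hadj B').ne⟩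
  have hle := Nat.card_le_card_of_injective _ hinj
  rw [Nat.card_eq_fintype_card (α := {j // j ≠ r}), Fintype.card_subtype_compl,
    Fintype.card_subtype_eq] at hle
  have := Fintype.card_pos_iff.2 ⟨r⟩
  lia

end BlockCount

/-! ### Functions on permutations invariant under right translations -/

section RightStab

variable {α β : Type*}

/-- The permutations under whose right translation `f` is invariant. -/
def rightStab (f : Perm α → β) : Subgroup (Perm α) where
  carrier := {σ | ∀ w, f (w * σ) = f w}
  mul_mem' {a b} ha hb w := by rw [← mul_assoc, hb, ha]
  one_mem' w := by rw [mul_one]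
  inv_mem' {a} ha w := by rw [← ha (w * a⁻¹), inv_mul_cancel_right]

theorem rightStab_le_rightStab_comp {γ : Type*} (g : β → γ) (f : Perm α → β) :
    rightStab f ≤ rightStab fun w => g (f w) :=
  fun _ hσ w => congrArg g (hσ w)

theorem eq_of_inv_mul_mem_rightStab {f : Perm α → β} {w w' : Perm α}
    (h : w⁻¹ * w' ∈ rightStab f) : f w = f w' := by
  rw [← h w, mul_inv_cancel_left]

theorem mem_rightStab_sum {ι M : Type*} [AddCommMonoid M] {s : Finset ι} {f : ι → Perm α → M}
    {σ : Perm α} (h : ∀ i ∈ s, σ ∈ rightStab (f i)) : σ ∈ rightStab fun w => ∑ i ∈ s, f i w :=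
  fun w => Finset.sum_congr rfl fun i hi => h i hi w

variable [DecidableEq α] {G : SimpleGraph α} {H : Subgroup (Perm α)} {p x y : α}

theorem mem_of_forall_swap_mem [Finite α] {σ : Perm α} (h : ∀ x, swap x (σ x) ∈ H) : σ ∈ H := by
  have hle : Subgroup.closure {τ : Perm α | τ ∈ H ∧ τ.IsSwap} ≤ H :=
    (Subgroup.closure_le H).2 fun _ hτ => hτ.1
  refine hle ((mem_closure_isSwap fun _ hτ => hτ.2).2 ⟨Set.toFinite _, fun x => ?_⟩)
  by_cases hx : x = σ x
  · rw [← hx]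
    exact MulAction.mem_orbit_self x
  · exact ⟨⟨swap x (σ x), Subgroup.subset_closure ⟨h x, _, _, hx, rfl⟩⟩, swap_apply_left _ _⟩

theorem mem_of_swap_mem_of_fixed [Finite α] {s : Set α} {r : α} {σ : Perm α}
    (hs : ∀ x ∈ s, swap x r ∈ H) (hσ : ∀ x ∉ s, σ x = x) : σ ∈ H := by
  refine mem_of_forall_swap_mem fun x => ?_
  by_cases hx : x ∈ s
  · have hσx : σ x ∈ s := by
      by_contra h
      exact h ((σ.injective (hσ _ h)).symm ▸ hx)
    exact SubmonoidClass.swap_mem_trans H (hs x hx) (swap_comm (σ x) r ▸ hs _ hσx)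
  · rw [hσ x hx, swap_self]
    exact H.one_mem

theorem swap_mem_of_reachable (h : ∀ x y, G.Adj x y → swap x y ∈ H) (hxy : G.Reachable x y) :
    swap x y ∈ H := by
  obtain ⟨w⟩ := hxy
  induction w with
  | nil => rw [swap_self]; exact H.one_mem
  | cons hab _ ih => exact SubmonoidClass.swap_mem_trans H (h _ _ hab) ih

theorem swap_mem_of_reachableAvoiding (h : ∀ x y, G.Adj x y → p ≠ x → p ≠ y → swap x y ∈ H)
    (hxy : ReachableAvoiding G p x y) : swap x y ∈ H := by
  obtain ⟨w, hw⟩ := hxy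
  induction w with
  | nil => rw [swap_self]; exact H.one_mem
  | cons hab w ih =>
    simp only [SimpleGraph.Walk.support_cons, List.mem_cons, not_or] at hw
    refine SubmonoidClass.swap_mem_trans H (h _ _ hab hw.1 ?_) (ih hw.2)
    exact (ne_of_mem_of_not_mem w.start_mem_support hw.2).symm

theorem eq_const_of_connected [Finite α] (hG : G.Connected) {f : Perm α → β}
    (h : ∀ x y, G.Adj x y → swap x y ∈ rightStab f) (w : Perm α) : f w = f 1 := by
  have hw : w ∈ rightStab f :=
    mem_of_forall_swap_mem fun x => swap_mem_of_reachable h (hG.preconnected x (w x))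
  simpa using hw 1

theorem eq_const_of_sum_eq_const [Finite α] {A : Type*} [AddCommGroup A] (hG : G.Connected)
    [Fintype (Block G)] {φ : Block G → Perm α → A}
    (h : ∀ B x y, G.Adj x y → ¬ B.1.Adj x y → swap x y ∈ rightStab (φ B))
    {c : A} (hc : ∀ w, ∑ B, φ B w = c) (B : Block G) (w : Perm α) : φ B w = φ B 1 := by
  classical
  refine eq_const_of_connected hG (fun x y hxy => ?_) w
  by_cases hB : B.1.Adj x y
  · have hφ : φ B = fun w => c - ∑ B' ∈ Finset.univ.erase B, φ B' w := by
      funext w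
      rw [← hc w, ← Finset.add_sum_erase _ _ (Finset.mem_univ B), add_sub_cancel_right]
    rw [hφ]
    refine rightStab_le_rightStab_comp _ _ (mem_rightStab_sum fun B' hB' => h B' x y hxy ?_)
    exact fun h' => Finset.ne_of_mem_erase hB' (Subtype.ext (B'.2.eq_of_adj B.2 h' hB))
  · exact h B x y hxy hB

end RightStab

/-! ### Coefficient tuples and their decomposition along blocks -/

section Tuples

variable {α A : Type*} [DecidableEq α] [Fintype α] [AddCommGroup A] {G : SimpleGraph α}
  {B : G.Subgraph} {b : α → Perm α → A} {p x y : α}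

/-- The coefficient families of linear splines: `b` corresponds to the spline
`w ↦ ∑ p, b p w • X (w p)`. -/
def IsTuple (G : SimpleGraph α) (b : α → Perm α → A) : Prop :=
  (∀ p x y, G.Adj x y → p ≠ x → p ≠ y → swap x y ∈ rightStab (b p)) ∧
    ∀ w, ∑ p, b p w = ∑ p, b p 1

/-- The coefficient families of linear splines which fail to be invariant only along the edges
of `B`. -/
def IsBlockTuple (B : G.Subgraph) (b : α → Perm α → A) : Prop :=
  (∀ p x y, G.Adj x y → ¬ (B.Adj x y ∧ (p = x ∨ p = y)) → swap x y ∈ rightStab (b p)) ∧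
    ∀ w, ∑ p, b p w = ∑ p, b p 1

theorem IsBlockTuple.isTuple (h : IsBlockTuple B b) : IsTuple G b :=
  ⟨fun p x y hxy hx hy => h.1 p x y hxy (by tauto), h.2⟩

theorem IsBlockTuple.eq_const_of_sum_eq_const (hG : G.Connected) [Fintype (Block G)]
    {β : Block G → α → Perm α → A} (hβ : ∀ B, IsBlockTuple B.1 (β B)) {k : α → A}
    (hk : ∀ p w, ∑ B, β B p w = k p) (B : Block G) (p : α) (w : Perm α) : β B p w = β B p 1 :=
  CayleySpline.eq_const_of_sum_eq_const hG (φ := fun B => β B p)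
    (fun B x y hxy hB => (hβ B).1 p x y hxy fun h => hB h.1) (hk p) B w

/-- The part of `∑ q, b q` coming from the component of `G - p` in the direction of `B`. -/
def branchSum (B : G.Subgraph) (b : α → Perm α → A) (p : α) (w : Perm α) : A :=
  ∑ q with blockProj B q ≠ p, b q w

theorem swap_mem_rightStab_branchSum (hG : G.Connected) (hB : IsBlock B) (hb : IsTuple G b)
    (hxy : G.Adj x y) (h : ¬ (B.Adj x y ∧ (p = x ∨ p = y))) :
    swap x y ∈ rightStab (branchSum B b p) := by
  have hiff := hB.blockProj_eq_iff_of_adj hG hxy h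
  by_cases hx : blockProj B x = p
  · refine mem_rightStab_sum fun q hq => ?_
    have hq' : blockProj B q ≠ p := by simpa using hq
    exact hb.1 q x y hxy (by rintro rfl; exact hq' hx) (by rintro rfl; exact hq' (hiff.1 hx))
  · -- `b` has constant sum, so we may sum over the other components of `G - p` instead.
    have hcompl : branchSum B b p = fun w => ∑ q, b q 1 - ∑ q with blockProj B q = p, b q w := by
      funext w
      rw [← hb.2 w, ← Finset.sum_filter_add_sum_filter_not _ fun q => blockProj B q = p,
        add_sub_cancel_left, branchSum]
    rw [hcompl]
    refine rightStab_le_rightStab_comp _ _ (mem_rightStab_sum fun q hq => ?_)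
    have hq' : blockProj B q = p := by simpa using hq
    exact hb.1 q x y hxy (by rintro rfl; exact hx hq') (by rintro rfl; exact hx (hiff.2 hq'))

open Classical in
/-- The component of `b` in the direction of the block `B`. -/
def blockPart (B : G.Subgraph) (b : α → Perm α → A) (p : α) (w : Perm α) : A :=
  if p ∈ B.verts then -branchSum B b p w else 0

theorem sum_blockPart_vertices (hG : G.Connected) (hB : IsBlock B) (w : Perm α) :
    ∑ p, blockPart B b p w = -((B.verts.ncard - 1) • ∑ q, b q w) := by
  classical
  have hcard : ∀ q, Finset.card {p ∈ B.verts.toFinset | blockProj B q ≠ p} = B.verts.ncard - 1 :=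
    fun q => by
      rw [Finset.filter_ne, Finset.card_erase_of_mem (by simpa using hB.blockProj_mem hG q),
        Set.ncard_eq_toFinset_card']
  calc ∑ p, blockPart B b p w
      = -∑ p ∈ B.verts.toFinset, ∑ q with blockProj B q ≠ p, b q w := by
        simp only [blockPart, ← Set.mem_toFinset, Finset.sum_ite_mem, Finset.univ_inter,
          Finset.sum_neg_distrib, branchSum]
    _ = -∑ q, ∑ p ∈ B.verts.toFinset with blockProj B q ≠ p, b q w := by
        simp only [Finset.sum_filter]
        rw [Finset.sum_comm]
    _ = -((B.verts.ncard - 1) • ∑ q, b q w) := by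
        simp only [Finset.sum_const, hcard, Finset.smul_sum]

theorem isBlockTuple_blockPart (hG : G.Connected) (hB : IsBlock B) (hb : IsTuple G b) :
    IsBlockTuple B (blockPart B b) := by
  refine ⟨fun p x y hxy h w => ?_, fun w => ?_⟩
  · simp only [blockPart, swap_mem_rightStab_branchSum hG hB hb hxy h w]
  · rw [sum_blockPart_vertices hG hB, sum_blockPart_vertices hG hB, hb.2 w]

theorem sum_branchSum [Nontrivial α] [Fintype (Block G)] (hG : G.Connected)
    [DecidablePred fun B : Block G => p ∈ B.1.verts] (w : Perm α) :
    ∑ B : Block G with p ∈ B.1.verts, branchSum B.1 b p w = ∑ q ∈ Finset.univ.erase p, b q w := by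
  have hne : ∀ (B : Block G) q, p ∈ B.1.verts → blockProj B.1 q ≠ p → p ≠ q := by
    rintro B q hp hq rfl
    exact hq (B.2.blockProj_eq_self hG hp)
  simp only [branchSum]
  rw [Finset.sum_sigma']
  refine Finset.sum_bij (fun x _ => x.2) ?_ ?_ ?_ fun _ _ => rfl
  · rintro ⟨B, q⟩ h
    simp only [Finset.mem_sigma, Finset.mem_filter, Finset.mem_univ, true_and] at h
    exact Finset.mem_erase.2 ⟨(hne B q h.1 h.2).symm, Finset.mem_univ q⟩
  · rintro ⟨B, q⟩ h ⟨B', q'⟩ h' rfl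
    simp only [Finset.mem_sigma, Finset.mem_filter, Finset.mem_univ, true_and] at h h'
    rw [(existsUnique_block_blockProj_ne hG (hne B q h.1 h.2)).unique h h']
  · intro q hq
    obtain ⟨B, hB, -⟩ := existsUnique_block_blockProj_ne hG (Finset.ne_of_mem_erase hq).symm
    exact ⟨⟨B, q⟩, by simpa using hB, rfl⟩

theorem sum_blockPart [Nontrivial α] [Fintype (Block G)] (hG : G.Connected) (hb : IsTuple G b)
    (p : α) (w : Perm α) : ∑ B : Block G, blockPart B.1 b p w = b p w - ∑ q, b q 1 := by
  classical
  simp only [blockPart]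
  rw [← Finset.sum_filter, Finset.sum_neg_distrib, sum_branchSum hG, ← hb.2 w,
    ← Finset.add_sum_erase _ _ (Finset.mem_univ p)]
  abel

end Tuples

/-! ### Differences along transpositions -/

section SwapDiff

open scoped Pointwise

variable {α A : Type*} {x y z : α}

theorem exists_perm_pair {k l : α} (hxy : x ≠ y) (hkl : k ≠ l) :
    ∃ w : Perm α, w x = k ∧ w y = l := by
  classical
  refine ⟨swap (swap x k y) l * swap x k, ?_, by simp⟩
  rw [Perm.mul_apply, swap_apply_left, swap_apply_of_ne_of_ne _ hkl]
  exact fun h => hxy ((swap x k).injective (by rwa [swap_apply_left]))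

theorem exists_perm_triple {k l m : α} (hxy : x ≠ y) (hxz : x ≠ z) (hyz : y ≠ z)
    (hkl : k ≠ l) (hkm : k ≠ m) (hlm : l ≠ m) :
    ∃ w : Perm α, w x = k ∧ w y = l ∧ w z = m := by
  classical
  obtain ⟨w, hx, hy⟩ := exists_perm_pair hxy hkl
  refine ⟨swap (w z) m * w, ?_, ?_, by simp⟩
  · rw [Perm.mul_apply, swap_apply_of_ne_of_ne _ (hx ▸ hkm), hx]
    exact w.injective.ne hxz
  · rw [Perm.mul_apply, swap_apply_of_ne_of_ne _ (hy ▸ hlm), hy]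
    exact w.injective.ne hyz

theorem exists_mem_ne_ne_of_two_lt_ncard {s : Set α} (hs : 2 < s.ncard) (x y : α) :
    ∃ z ∈ s, z ≠ x ∧ z ≠ y := by
  have hpair : ({x, y} : Set α).ncard ≤ 2 :=
    (Set.ncard_insert_le x {y}).trans (by rw [Set.ncard_singleton])
  obtain ⟨z, hz, hz'⟩ := Set.exists_mem_notMem_of_ncard_lt_ncard (hpair.trans_lt hs)
  simp only [Set.mem_insert_iff, Set.mem_singleton_iff, not_or] at hz'
  exact ⟨z, hz, hz'⟩

theorem exists_potential_of_cocycle [AddCommGroup A] {E : α → α → A}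
    (hanti : ∀ k l, k ≠ l → E l k = -E k l)
    (hcocycle : ∀ k l m, k ≠ l → k ≠ m → l ≠ m → E k m = E k l + E l m) (p : α) :
    ∃ c : α → A, ∀ k l, k ≠ l → E k l = c k - c l := by
  classical
  refine ⟨fun k => if k = p then 0 else E k p, fun k l hkl => ?_⟩
  beta_reduce
  split_ifs with hk hl hl
  · exact absurd (hk.trans hl.symm) hkl
  · rw [hk, hanti _ _ hl, zero_sub]
  · rw [hl, sub_zero]
  · rw [hcocycle k l p hkl hk hl, add_sub_cancel_right]

variable [DecidableEq α]

theorem swap_mem_rightStab_smul {s : Finset α} (h : x ∈ s ↔ y ∈ s) :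
    swap x y ∈ rightStab fun w : Perm α => w • s := fun w => by
  have hs : swap x y • s = s := by
    rw [← Finset.coe_inj, Finset.coe_smul_finset]
    exact swap_mem_stabilizer.2 h
  simp only [mul_smul, hs]

theorem swap_mem_rightStab_sum_apply [AddCommMonoid A] {s : Finset α} (h : x ∈ s ↔ y ∈ s)
    (c : α → A) : swap x y ∈ rightStab fun w : Perm α => ∑ z ∈ s, c (w z) := by
  have h' := rightStab_le_rightStab_comp (fun t : Finset α => ∑ k ∈ t, c k) _
    (swap_mem_rightStab_smul h)
  simpa only [Finset.smul_finset_def, Finset.sum_image (Equiv.injective _).injOn,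
    Perm.smul_def] using h'

variable [AddCommGroup A]

/-- The difference of `f` along the transposition of the positions `x` and `y`. -/
def swapDiff (f : Perm α → A) (w : Perm α) (x y : α) : A := f w - f (w * swap x y)

theorem swapDiff_swap (f : Perm α → A) (w : Perm α) (x y : α) :
    swapDiff f (w * swap x y) x y = -swapDiff f w x y := by
  simp [swapDiff, mul_assoc]

theorem swapDiff_comm (f : Perm α → A) (w : Perm α) (x y : α) :
    swapDiff f w x y = swapDiff f w y x := by
  rw [swapDiff, swapDiff, swap_comm]

theorem swapDiff_mul {f : Perm α → A} (w : Perm α) {σ : Perm α} (hσ : σ ∈ rightStab f) (x y : α) :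
    swapDiff f (w * σ) x y = swapDiff f w (σ x) (σ y) := by
  rw [swapDiff, swapDiff, hσ w, mul_assoc, mul_swap_eq_swap_mul, ← mul_assoc, hσ]

theorem mem_rightStab_swapDiff {f : Perm α → A} {σ : Perm α} (hσ : σ ∈ rightStab f)
    (hx : σ x = x) (hy : σ y = y) : σ ∈ rightStab fun w => swapDiff f w x y := fun w => by
  simp only [swapDiff_mul w hσ, hx, hy]

theorem swapDiff_sum_apply {s : Finset α} (hx : x ∈ s) (hy : y ∉ s) (c : α → A) (w : Perm α) :
    swapDiff (fun w => ∑ z ∈ s, c (w z)) w x y = c (w x) - c (w y) := by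
  have hother : ∀ z ∈ s.erase x, c ((w * swap x y) z) = c (w z) := fun z hz => by
    rw [Perm.mul_apply, swap_apply_of_ne_of_ne (Finset.ne_of_mem_erase hz)]
    exact ne_of_mem_of_not_mem (Finset.mem_of_mem_erase hz) hy
  rw [swapDiff, ← Finset.add_sum_erase s (fun z => c (w z)) hx,
    ← Finset.add_sum_erase s (fun z => c ((w * swap x y) z)) hx, Finset.sum_congr rfl hother,
    add_sub_add_right_eq_sub, Perm.mul_apply, swap_apply_left]

end SwapDiff

/-! ### Coefficient tuples attached to a block -/

section BlockTuples

open scoped Pointwise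

variable {α A : Type*} [DecidableEq α] [Fintype α] [AddCommGroup A] {G : SimpleGraph α}
  {B : G.Subgraph} {b : α → Perm α → A} {p q r x y x' y' : α} {w w' : Perm α}

/-- The vertices attached to `B` through `p`. -/
def branch (B : G.Subgraph) (p : α) : Finset α := {z | blockProj B z = p}

theorem mem_branch : x ∈ branch B p ↔ blockProj B x = p := by simp [branch]

namespace IsBlockTuple

theorem swap_mem (hG : G.Connected) (hB : IsBlock B) (hb : IsBlockTuple B b)
    (h : blockProj B x = p ↔ blockProj B y = p) : swap x y ∈ rightStab (b p) := by
  by_cases hp : p ∈ B.verts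
  · by_cases hx : blockProj B x = p
    · refine swap_mem_of_reachable (G := G \ B.spanningCoe) (fun u v huv => ?_)
        ((hB.blockProj_eq_iff hG).1 (hx.trans (h.1 hx).symm))
      exact hb.1 p u v huv.1 fun h' => huv.2 h'.1
    · exact swap_mem_of_reachableAvoiding (hb.isTuple.1 p)
        (hB.reachableAvoiding_of_blockProj_ne hG hp hx (mt h.2 hx))
  · refine swap_mem_of_reachable (G := G) (fun u v huv => ?_) (hG.preconnected x y)
    refine hb.1 p u v huv ?_
    rintro ⟨h', rfl | rfl⟩
    · exact hp (B.edge_vert h')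
    · exact hp (B.edge_vert h'.symm)

theorem eq_const_of_notMem (hG : G.Connected) (hB : IsBlock B) (hb : IsBlockTuple B b)
    (hp : p ∉ B.verts) (w : Perm α) : b p w = b p 1 := by
  have hproj : ∀ x, blockProj B x ≠ p := fun x hx => hp (hx ▸ hB.blockProj_mem hG x)
  exact eq_const_of_connected hG
    (fun x y _ => hb.swap_mem hG hB (iff_of_false (hproj x) (hproj y))) w

theorem eq_of_smul_branch_eq (hG : G.Connected) (hB : IsBlock B) (hb : IsBlockTuple B b)
    (h : w • branch B p = w' • branch B p) : b p w = b p w' := by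
  refine eq_of_inv_mul_mem_rightStab (mem_of_forall_swap_mem fun z => hb.swap_mem hG hB ?_)
  rw [← mem_branch, ← mem_branch, Perm.mul_apply, ← Perm.smul_def w⁻¹, Finset.inv_smul_mem_iff, h,
    ← Perm.smul_def w', Finset.smul_mem_smul_finset_iff]

theorem swapDiff_eq_neg (hG : G.Connected) (hB : IsBlock B) (hb : IsBlockTuple B b)
    (h : blockProj B x ≠ blockProj B y) (w : Perm α) :
    swapDiff (b (blockProj B x)) w x y = -swapDiff (b (blockProj B y)) w x y := by
  have hsum : ∑ r, swapDiff (b r) w x y = 0 := by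
    simp only [swapDiff, Finset.sum_sub_distrib]
    rw [hb.2 w, hb.2 (w * swap x y), sub_self]
  rw [Fintype.sum_eq_add _ _ h] at hsum
  · exact eq_neg_of_add_eq_zero_left hsum
  · rintro r ⟨hx, hy⟩
    rw [swapDiff, sub_eq_zero]
    exact (hb.swap_mem hG hB (iff_of_false hx.symm hy.symm) w).symm

/- The difference is invariant under all transpositions `(u r)` with `u ≠ x, y`: depending on `u`,
this is seen from its expression through `b (blockProj B x)` or through `b (blockProj B y)`. -/
theorem swapDiff_eq_of_apply_eq (hG : G.Connected) (hB : IsBlock B) (hb : IsBlockTuple B b)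
    (h : blockProj B x ≠ blockProj B y) (hr : r ∈ B.verts) (hrx : r ≠ blockProj B x)
    (hry : r ≠ blockProj B y) (hx : w x = w' x) (hy : w y = w' y) :
    swapDiff (b (blockProj B x)) w x y = swapDiff (b (blockProj B x)) w' x y := by
  have hr' := hB.blockProj_eq_self hG hr
  have hrx' : x ≠ r := by rintro rfl; exact hrx hr'.symm
  have hry' : y ≠ r := by rintro rfl; exact hry hr'.symm
  have hswap : ∀ u ∈ ({x, y}ᶜ : Set α),
      swap u r ∈ rightStab fun w => swapDiff (b (blockProj B x)) w x y := by
    intro u hu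
    simp only [Set.mem_compl_iff, Set.mem_insert_iff, Set.mem_singleton_iff, not_or] at hu
    have hfixx := swap_apply_of_ne_of_ne (Ne.symm hu.1) hrx'
    have hfixy := swap_apply_of_ne_of_ne (Ne.symm hu.2) hry'
    by_cases hux : blockProj B u = blockProj B x
    · simp only [hb.swapDiff_eq_neg hG hB h]
      refine rightStab_le_rightStab_comp _ _ (mem_rightStab_swapDiff ?_ hfixx hfixy)
      exact hb.swap_mem hG hB (iff_of_false (hux ▸ h) (by rwa [hr']))
    · exact mem_rightStab_swapDiff
        (hb.swap_mem hG hB (iff_of_false hux (by rwa [hr']))) hfixx hfixy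
  refine eq_of_inv_mul_mem_rightStab (f := fun w => swapDiff (b (blockProj B x)) w x y)
    (mem_of_swap_mem_of_fixed hswap fun u hu => ?_)
  rw [Set.notMem_compl_iff] at hu
  rw [Perm.mul_apply, Perm.inv_eq_iff_eq]
  rcases hu with rfl | rfl
  exacts [hx.symm, hy.symm]

theorem swapDiff_congr (hG : G.Connected) (hB : IsBlock B) (h3 : 2 < B.verts.ncard)
    (hb : IsBlockTuple B b) (hx : blockProj B x = p) (hx' : blockProj B x' = p)
    (hy : blockProj B y ≠ p) (hy' : blockProj B y' ≠ p) (hwx : w x = w' x') (hwy : w y = w' y') :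
    swapDiff (b p) w x y = swapDiff (b p) w' x' y' := by
  have ne {u v : α} (hu : blockProj B u = p) (hv : blockProj B v ≠ p) : u ≠ v := by
    rintro rfl; exact hv hu
  set τ := swap x x' * swap y y' with hτ
  have hτmem : τ ∈ rightStab (b p) := Subgroup.mul_mem _
    (hb.swap_mem hG hB (iff_of_true hx hx')) (hb.swap_mem hG hB (iff_of_false hy hy'))
  have hτx : τ x' = x := by
    rw [hτ, Perm.mul_apply, swap_apply_of_ne_of_ne (ne hx' hy) (ne hx' hy'), swap_apply_right]
  have hτy : τ y' = y := by
    rw [hτ, Perm.mul_apply, swap_apply_right,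
      swap_apply_of_ne_of_ne (ne hx hy).symm (ne hx' hy).symm]
  have hτdiff := swapDiff_mul w hτmem x' y'
  rw [hτx, hτy] at hτdiff
  obtain ⟨r, hr, hrx, hry⟩ := exists_mem_ne_ne_of_two_lt_ncard h3 (blockProj B x') (blockProj B y')
  subst hx'
  rw [← hτdiff]
  exact hb.swapDiff_eq_of_apply_eq hG hB hy'.symm hr hrx hry
    (by rw [Perm.mul_apply, hτx, hwx]) (by rw [Perm.mul_apply, hτy, hwy])

theorem exists_swapDiff_eq (hG : G.Connected) (hB : IsBlock B) (h3 : 2 < B.verts.ncard)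
    (hb : IsBlockTuple B b) (hp : p ∈ B.verts) :
    ∃ E : α → α → A, ∀ w x y, blockProj B x = p → blockProj B y ≠ p →
      swapDiff (b p) w x y = E (w x) (w y) := by
  obtain ⟨q, hq, hqp⟩ := Set.exists_ne_of_one_lt_ncard (one_lt_two.trans h3) p
  have hp' := hB.blockProj_eq_self hG hp
  have hq' := hB.blockProj_eq_self hG hq
  have hex : ∀ k l, ∃ W : Perm α, k ≠ l → W p = k ∧ W q = l := fun k l => by
    by_cases hkl : k = l
    · exact ⟨1, fun h => absurd hkl h⟩
    · obtain ⟨W, hW⟩ := exists_perm_pair hqp.symm hkl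
      exact ⟨W, fun _ => hW⟩
  choose W hW using hex
  refine ⟨fun k l => swapDiff (b p) (W k l) p q, fun w x y hx hy => ?_⟩
  obtain ⟨hWp, hWq⟩ := hW _ _ (w.injective.ne (show x ≠ y by rintro rfl; exact hy hx))
  exact hb.swapDiff_congr hG hB h3 hx hp' hy (by rwa [hq']) hWp.symm hWq.symm

theorem swapDiff_eq_of_eq_at (hG : G.Connected) (hB : IsBlock B) (h3 : 2 < B.verts.ncard)
    (hb : IsBlockTuple B b) (hp : p ∈ B.verts) {E : α → α → A}
    (hE : ∀ w x y, blockProj B x = p → blockProj B y ≠ p → swapDiff (b p) w x y = E (w x) (w y))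
    (w : Perm α) (hxy : blockProj B x ≠ blockProj B y) :
    swapDiff (b (blockProj B x)) w x y = E (w x) (w y) := by
  by_cases hx : blockProj B x = p
  · rw [hx]
    exact hE w x y hx (hx ▸ hxy.symm)
  have hp' := hB.blockProj_eq_self hG hp
  have hxx := hB.blockProj_eq_self hG (hB.blockProj_mem hG x)
  obtain ⟨w', hw'x, hw'p⟩ := exists_perm_pair hx
    (w.injective.ne (show x ≠ y by rintro rfl; exact hxy rfl))
  have hneg := hb.swapDiff_eq_neg hG hB (x := blockProj B x) (y := p) (by rwa [hxx, hp']) w'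
  rw [hxx, hp', swapDiff_comm (b p), ← swapDiff_swap, hE _ _ _ hp' (by rwa [hxx]),
    Perm.mul_apply, Perm.mul_apply, swap_apply_left, swap_apply_right, hw'x, hw'p] at hneg
  rw [hb.swapDiff_congr hG hB h3 rfl hxx hxy.symm (by rw [hp']; exact Ne.symm hx) hw'x.symm
    hw'p.symm, hneg]

/- For three vertices `p`, `q`, `r` of `B`, the values `b p (w * swap p q * swap p r)` and
`b p (w * swap p r)` agree because `swap q r` is a symmetry of `b p`. -/
theorem swapDiff_cocycle (hG : G.Connected) (hB : IsBlock B) (hb : IsBlockTuple B b)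
    (hpq : p ≠ q) (hpr : p ≠ r) (hqr : q ≠ r) (hq : q ∈ B.verts) (hr : r ∈ B.verts)
    (w : Perm α) : swapDiff (b p) w p r =
      swapDiff (b p) w p q + swapDiff (b p) (w * swap p q) p r := by
  have hmem : swap r q ∈ rightStab (b p) := hb.swap_mem hG hB (iff_of_false
    (by rw [hB.blockProj_eq_self hG hr]; exact hpr.symm)
    (by rw [hB.blockProj_eq_self hG hq]; exact hpq.symm))
  have hswap : b p (w * swap p q * swap p r) = b p (w * swap p r) := by
    rw [← hmem (w * swap p r), mul_assoc, mul_assoc, mul_swap_eq_swap_mul (swap p r),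
      swap_apply_right, swap_apply_of_ne_of_ne hpq.symm hqr]
  rw [swapDiff, swapDiff, swapDiff, hswap, sub_add_sub_cancel]

theorem exists_potential (hG : G.Connected) (hB : IsBlock B) (h3 : 2 < B.verts.ncard)
    (hb : IsBlockTuple B b) : ∃ c : α → A, ∀ w x y, blockProj B x ≠ blockProj B y →
      swapDiff (b (blockProj B x)) w x y = c (w x) - c (w y) := by
  obtain ⟨p, hp⟩ := Set.nonempty_of_ncard_ne_zero (zero_lt_two.trans h3).ne'
  obtain ⟨q, hq, hqp, -⟩ := exists_mem_ne_ne_of_two_lt_ncard h3 p p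
  obtain ⟨r, hr, hrp, hrq⟩ := exists_mem_ne_ne_of_two_lt_ncard h3 p q
  have hp' := hB.blockProj_eq_self hG hp
  have hq' : blockProj B q ≠ p := by rwa [hB.blockProj_eq_self hG hq]
  have hr' : blockProj B r ≠ p := by rwa [hB.blockProj_eq_self hG hr]
  obtain ⟨E, hE⟩ := hb.exists_swapDiff_eq hG hB h3 hp
  have hanti : ∀ k l, k ≠ l → E l k = -E k l := fun k l hkl => by
    obtain ⟨w, rfl, rfl⟩ := exists_perm_pair hqp.symm hkl
    simpa [hE _ _ _ hp' hq'] using swapDiff_swap (b p) w p q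
  have hcocycle : ∀ k l m, k ≠ l → k ≠ m → l ≠ m → E k m = E k l + E l m := by
    intro k l m hkl hkm hlm
    obtain ⟨w, rfl, rfl, rfl⟩ := exists_perm_triple hqp.symm hrp.symm hrq.symm hkl hkm hlm
    simpa [hE _ _ _ hp' hq', hE _ _ _ hp' hr', swap_apply_of_ne_of_ne hrp hrq] using
      hb.swapDiff_cocycle hG hB hqp.symm hrp.symm hrq.symm hq hr w
  obtain ⟨c, hc⟩ := exists_potential_of_cocycle hanti hcocycle p
  refine ⟨c, fun w x y hxy => ?_⟩
  rw [hb.swapDiff_eq_of_eq_at hG hB h3 hp hE w hxy]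
  exact hc _ _ (w.injective.ne (ne_of_apply_ne _ hxy))

theorem eq_add_sum (hG : G.Connected) (hB : IsBlock B) (hb : IsBlockTuple B b) {c : α → A}
    (hc : ∀ w x y, blockProj B x ≠ blockProj B y →
      swapDiff (b (blockProj B x)) w x y = c (w x) - c (w y)) (p : α) (w : Perm α) :
    b p w = (b p 1 - ∑ z ∈ branch B p, c z) + ∑ z ∈ branch B p, c (w z) := by
  set g : Perm α → A := fun w => b p w - ∑ z ∈ branch B p, c (w z) with hg
  have hmixed {x y : α} (hx : blockProj B x = p) (hy : blockProj B y ≠ p) :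
      swap x y ∈ rightStab g := fun w => by
    have hdiff := hc w x y (hx ▸ hy.symm)
    rw [hx, ← swapDiff_sum_apply (mem_branch.2 hx) (mt mem_branch.1 hy) c w, swapDiff,
      swapDiff] at hdiff
    simp only [hg, sub_eq_sub_iff_sub_eq_sub.1 hdiff]
  have hsame {x y : α} (h : blockProj B x = p ↔ blockProj B y = p) :
      swap x y ∈ rightStab g := fun w => by
    have hsum := swap_mem_rightStab_sum_apply (mem_branch.trans (h.trans mem_branch.symm)) c w
    simp only at hsum
    simp only [hg, hb.swap_mem hG hB h w, hsum]
  have hconst : g w = g 1 := by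
    refine eq_const_of_connected hG (fun x y _ => ?_) w
    by_cases hx : blockProj B x = p <;> by_cases hy : blockProj B y = p
    · exact hsame (iff_of_true hx hy)
    · exact hmixed hx hy
    · exact swap_comm x y ▸ hmixed hy hx
    · exact hsame (iff_of_false hx hy)
  exact sub_eq_iff_eq_add.1 hconst

end IsBlockTuple

end BlockTuples

/-! ### Models of the block tuples -/

section BlockModels

open scoped Pointwise

variable {α 𝕜 : Type*} [DecidableEq α] [Fintype α] [CommRing 𝕜] {G : SimpleGraph α}
  {B : G.Subgraph} {b : α → Perm α → 𝕜} {i j : α}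

/-- `Φ` identifies the functions on `a`-element subsets, up to constants, with the coefficient
families attached to the block `B`, up to constant families. -/
structure BlockModel (B : G.Subgraph) (a : ℕ)
    (Φ : (Set.powersetCard α a → 𝕜) →ₗ[𝕜] (α → Perm α → 𝕜)) : Prop where
  isBlockTuple : ∀ F, IsBlockTuple B (Φ F)
  equivariant : ∀ F (u : Perm α) p w, Φ (fun s => F (u • s)) p w = Φ F p (u * w)
  map_const : ∀ c p w, Φ (fun _ => c) p w = Φ (fun _ => c) p 1
  eq_const : ∀ F, (∀ p w, Φ F p w = Φ F p 1) → ∃ c, F = fun _ => c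
  exists_eq : ∀ b, IsBlockTuple B b → ∃ (k : α → 𝕜) (F : _), ∀ p w, b p w = k p + Φ F p w

/-- The model of a block with at least three vertices. -/
def pointModel (B : G.Subgraph) : (Set.powersetCard α 1 → 𝕜) →ₗ[𝕜] (α → Perm α → 𝕜) :=
  LinearMap.pi fun p => LinearMap.pi fun w =>
    ∑ z ∈ branch B p, LinearMap.proj (Set.powersetCard.ofSingleton (w z))

theorem pointModel_apply (F : Set.powersetCard α 1 → 𝕜) (p : α) (w : Perm α) :
    pointModel B F p w = ∑ z ∈ branch B p, F (Set.powersetCard.ofSingleton (w z)) := by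
  simp [pointModel]

theorem isBlockTuple_pointModel (hG : G.Connected) (hB : IsBlock B)
    (F : Set.powersetCard α 1 → 𝕜) : IsBlockTuple B (pointModel B F) := by
  have htotal : ∀ w, ∑ p, pointModel B F p w = ∑ z, F (Set.powersetCard.ofSingleton z) := by
    intro w
    simp only [pointModel_apply, branch]
    rw [Finset.sum_fiberwise Finset.univ (blockProj B)]
    exact Equiv.sum_comp w fun z => F (Set.powersetCard.ofSingleton z)
  refine ⟨fun p x y hxy h w => ?_, fun w => by rw [htotal, htotal]⟩
  simp only [pointModel_apply]
  exact swap_mem_rightStab_sum_apply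
    (mem_branch.trans ((hB.blockProj_eq_iff_of_adj hG hxy h).trans mem_branch.symm))
    (fun z => F (Set.powersetCard.ofSingleton z)) w

theorem eq_of_pointModel_eq (hG : G.Connected) (hB : IsBlock B) (h : 1 < B.verts.ncard)
    {F : Set.powersetCard α 1 → 𝕜} (hF : ∀ p w, pointModel B F p w = pointModel B F p 1)
    (k l : α) : F (Set.powersetCard.ofSingleton k) = F (Set.powersetCard.ofSingleton l) := by
  rcases eq_or_ne k l with rfl | hkl
  · rfl
  obtain ⟨p, hp, q, hq, hpq⟩ := (Set.one_lt_ncard (Set.toFinite _)).1 h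
  obtain ⟨w, rfl, rfl⟩ := exists_perm_pair hpq hkl
  have hpmem : p ∈ branch B p := mem_branch.2 (hB.blockProj_eq_self hG hp)
  have hqmem : q ∉ branch B p := by
    rw [mem_branch, hB.blockProj_eq_self hG hq]
    exact hpq.symm
  rw [← sub_eq_zero,
    ← swapDiff_sum_apply hpmem hqmem (fun z => F (Set.powersetCard.ofSingleton z)), swapDiff,
    ← pointModel_apply, ← pointModel_apply, hF, hF p (w * swap p q), sub_self]

theorem exists_eq_add_pointModel (hG : G.Connected) (hB : IsBlock B) (h3 : 2 < B.verts.ncard)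
    (hb : IsBlockTuple B b) :
    ∃ (k : α → 𝕜) (F : _), ∀ p w, b p w = k p + pointModel B F p w := by
  obtain ⟨c, hc⟩ := hb.exists_potential hG hB h3
  refine ⟨fun p => b p 1 - ∑ z ∈ branch B p, c z,
    fun s => c (Set.powersetCard.ofSingleton.symm s), fun p w => ?_⟩
  simpa only [pointModel_apply, Equiv.symm_apply_apply] using hb.eq_add_sum hG hB hc p w

theorem blockModel_pointModel (hG : G.Connected) (hB : IsBlock B) (h3 : 2 < B.verts.ncard) :
    BlockModel B 1 (pointModel B : _ →ₗ[𝕜] _) where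
  isBlockTuple := isBlockTuple_pointModel hG hB
  equivariant F u p w := by
    simp only [pointModel_apply]
    rfl
  map_const c p w := by simp only [pointModel_apply]
  eq_const F hF := by
    obtain ⟨l, -⟩ := Set.nonempty_of_ncard_ne_zero (zero_lt_two.trans h3).ne'
    refine ⟨F (Set.powersetCard.ofSingleton l), funext fun s => ?_⟩
    obtain ⟨k, rfl⟩ := Set.powersetCard.ofSingleton.surjective s
    exact eq_of_pointModel_eq hG hB (one_lt_two.trans h3) hF k l
  exists_eq _ := exists_eq_add_pointModel hG hB h3

/-- The model of a block with vertices `i` and `j`. -/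
def pairModel (B : G.Subgraph) (i j : α) :
    (Set.powersetCard α (branch B i).card → 𝕜) →ₗ[𝕜] (α → Perm α → 𝕜) :=
  LinearMap.pi fun p => LinearMap.pi fun w => (Pi.single i 1 - Pi.single j 1 : α → 𝕜) p •
    LinearMap.proj (w • Set.powersetCard.ofCard (s := branch B i) rfl)

theorem pairModel_apply (F : Set.powersetCard α (branch B i).card → 𝕜) (p : α) (w : Perm α) :
    pairModel B i j F p w = (Pi.single i 1 - Pi.single j 1 : α → 𝕜) p *
      F (w • Set.powersetCard.ofCard (s := branch B i) rfl) := rfl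

theorem pairModel_left (hij : i ≠ j) (F : Set.powersetCard α (branch B i).card → 𝕜)
    (w : Perm α) :
    pairModel B i j F i w = F (w • Set.powersetCard.ofCard (s := branch B i) rfl) := by
  simp [pairModel_apply, hij]

theorem isBlockTuple_pairModel (hG : G.Connected) (hB : IsBlock B) (hverts : B.verts = {i, j})
    (F : Set.powersetCard α (branch B i).card → 𝕜) : IsBlockTuple B (pairModel B i j F) := by
  have htotal : ∀ w, ∑ p, pairModel B i j F p w = 0 := fun w => by
    simp [pairModel_apply, ← Finset.sum_mul]
  refine ⟨fun p x y hxy h w => ?_, fun w => by rw [htotal, htotal]⟩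
  by_cases hp : p ∈ B.verts
  · have hadj : ¬ B.Adj x y := fun hB' => by
      have hx := B.edge_vert hB'
      have hy := B.edge_vert hB'.symm
      have hne := hxy.ne
      simp only [hverts, Set.mem_insert_iff, Set.mem_singleton_iff] at hp hx hy
      grind
    have hswap := swap_mem_rightStab_smul (s := branch B i) (x := x) (y := y)
      (by rw [mem_branch, mem_branch, hB.blockProj_eq_of_adj hG hxy hadj]) w
    rw [pairModel_apply, pairModel_apply]
    congr 2
    exact Subtype.ext hswap
  · have hi : p ≠ i := by rintro rfl; simp [hverts] at hp
    have hj : p ≠ j := by rintro rfl; simp [hverts] at hp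
    simp [pairModel_apply, hi, hj]

theorem exists_eq_add_pairModel (hG : G.Connected) (hB : IsBlock B) (hij : i ≠ j)
    (hverts : B.verts = {i, j}) (hb : IsBlockTuple B b) :
    ∃ (k : α → 𝕜) (F : _), ∀ p w, b p w = k p + pairModel B i j F p w := by
  have hother : ∀ p, p ≠ i → p ≠ j → ∀ w, b p w = b p 1 := fun p hi hj =>
    hb.eq_const_of_notMem hG hB (by simp [hverts, hi, hj])
  have hsum : ∀ w, b i w + b j w = b i 1 + b j 1 := fun w => by
    have hzero : ∑ p, (b p w - b p 1) = 0 := by rw [Finset.sum_sub_distrib, hb.2 w, sub_self]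
    rw [Fintype.sum_eq_add i j hij fun p hp => sub_eq_zero.2 (hother p hp.1 hp.2 w)] at hzero
    linear_combination hzero
  have := Set.powersetCard.isPretransitive (α := α) (n := (branch B i).card)
  choose g hg using fun s => MulAction.exists_smul_eq (Perm α)
    (Set.powersetCard.ofCard (s := branch B i) rfl) s
  have hF : ∀ w, b i (g (w • Set.powersetCard.ofCard rfl)) = b i w := fun w =>
    hb.eq_of_smul_branch_eq hG hB (congrArg Subtype.val (hg _))
  refine ⟨fun p => if p = i then 0 else if p = j then b i 1 + b j 1 else b p 1,
    fun s => b i (g s), fun p w => ?_⟩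
  rw [pairModel_apply, hF]
  rcases eq_or_ne p i with rfl | hi
  · simp [hij]
  rcases eq_or_ne p j with rfl | hj
  · simp [hi, ← hsum w]
  · simp [hi, hj, hother p hi hj w]

theorem blockModel_pairModel (hG : G.Connected) (hB : IsBlock B) (hij : i ≠ j)
    (hverts : B.verts = {i, j}) :
    BlockModel B (branch B i).card (pairModel B i j : _ →ₗ[𝕜] _) where
  isBlockTuple := isBlockTuple_pairModel hG hB hverts
  equivariant F u p w := by simp only [pairModel_apply, mul_smul]
  map_const c p w := rfl
  eq_const F hF := by
    have := Set.powersetCard.isPretransitive (α := α) (n := (branch B i).card)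
    refine ⟨F (Set.powersetCard.ofCard rfl), funext fun s => ?_⟩
    obtain ⟨w, rfl⟩ := MulAction.exists_smul_eq (Perm α)
      (Set.powersetCard.ofCard (s := branch B i) rfl) s
    simpa only [pairModel_left hij, one_smul] using hF i w
  exists_eq _ := exists_eq_add_pairModel hG hB hij hverts

end BlockModels

/-! ### Traces -/

section Trace

variable {𝕜 A M N X : Type*} [AddCommGroup A] [AddCommGroup M] [AddCommGroup N]

theorem trace_eq_add_of_exact [Field 𝕜] [Module 𝕜 A] [Module 𝕜 M] [Module 𝕜 N]
    [Module.Finite 𝕜 A] [Module.Finite 𝕜 M] [Module.Finite 𝕜 N] {i : A →ₗ[𝕜] M} {π : M →ₗ[𝕜] N}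
    (hi : Function.Injective i) (hπ : Function.Surjective π) (hiπ : Function.Exact i π)
    {f : A →ₗ[𝕜] A} {g : M →ₗ[𝕜] M} {h : N →ₗ[𝕜] N} (hf : ∀ x, g (i x) = i (f x))
    (hh : ∀ x, π (g x) = h (π x)) :
    LinearMap.trace 𝕜 M g = LinearMap.trace 𝕜 A f + LinearMap.trace 𝕜 N h := by
  obtain ⟨s, hs⟩ := π.exists_rightInverse_of_surjective (LinearMap.range_eq_top.2 hπ)
  obtain ⟨e, rfl, rfl⟩ := hiπ.splitSurjectiveEquiv hi ⟨s, hs⟩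
  set i' := e.symm.toLinearMap ∘ₗ LinearMap.inr 𝕜 A N
  set r := LinearMap.fst 𝕜 A N ∘ₗ e.toLinearMap
  have hdec : g = (e.symm.toLinearMap ∘ₗ LinearMap.inl 𝕜 A N) ∘ₗ (r ∘ₗ g) +
      i' ∘ₗ ((LinearMap.snd 𝕜 A N ∘ₗ e.toLinearMap) ∘ₗ g) := by
    ext x
    simp [i', r, ← map_add]
  rw [hdec, map_add, LinearMap.trace_comp_comm', LinearMap.trace_comp_comm' _ i']
  congr 2
  · ext x
    simpa [r] using congrArg r (hf x)
  · ext x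
    simpa [i'] using hh (i' x)

theorem trace_eq_of_bijective [CommRing 𝕜] [Module 𝕜 M] [Module 𝕜 N] {e : M →ₗ[𝕜] N}
    (he : Function.Bijective e) {f : M →ₗ[𝕜] M} {g : N →ₗ[𝕜] N} (h : ∀ x, e (f x) = g (e x)) :
    LinearMap.trace 𝕜 M f = LinearMap.trace 𝕜 N g := by
  rw [← LinearMap.trace_conj' f (LinearEquiv.ofBijective e he)]
  congr 1
  ext x
  obtain ⟨y, rfl⟩ := (LinearEquiv.ofBijective e he).surjective x
  simpa [LinearEquiv.conj_apply_apply] using h y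

theorem trace_funLeft [CommRing 𝕜] [Fintype X] [DecidableEq X] (σ : X → X) :
    LinearMap.trace 𝕜 (X → 𝕜) (LinearMap.funLeft 𝕜 𝕜 σ) = ∑ x, if σ x = x then 1 else 0 := by
  rw [LinearMap.trace_eq_matrix_trace 𝕜 (Pi.basisFun 𝕜 X), Matrix.trace]
  refine Finset.sum_congr rfl fun x _ => ?_
  simp [LinearMap.funLeft_apply, Pi.single_apply]

end Trace

section FixCount

variable {R α : Type*}

theorem sum_ite_smul_eq {M X : Type*} [AddCommMonoidWithOne R] [Monoid M] [MulAction M X]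
    [Fintype X] [DecidableEq X] (g : M) :
    ∑ x : X, (if g • x = x then 1 else 0 : R) = Nat.card (MulAction.fixedBy X g) := by
  rw [← Finset.natCast_card_filter, ← Fintype.card_subtype, ← Nat.card_eq_fintype_card]
  rfl

variable [DecidableEq α]

/-- The number of `a`-element subsets mapped to themselves by a permutation. -/
def fixCount (a : ℕ) (u : Perm α) : ℕ := Nat.card (MulAction.fixedBy (Set.powersetCard α a) u)

theorem fixCount_inv (a : ℕ) (u : Perm α) : fixCount a u⁻¹ = fixCount a u := by
  rw [fixCount, MulAction.fixedBy_inv, fixCount]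

theorem fixCount_one (u : Perm α) : fixCount 1 u = Nat.card (MulAction.fixedBy α u) := by
  refine (Nat.card_congr (Set.powersetCard.ofSingleton.subtypeEquiv fun i => ?_)).symm
  exact (Set.powersetCard.ofSingleton.injective.eq_iff' rfl).symm

end FixCount

/-! ### The trace on the coefficient tuples -/

section TupleTrace

section ModelSum

variable {α 𝕜 : Type*} {G : SimpleGraph α} [CommRing 𝕜] [Fintype (Block G)] {a : Block G → ℕ}

/-- The coefficient family with constant part given by the coordinates in `α` and with part in
the direction of `B` given by `Φ B`. -/
def modelSum (Φ : ∀ B, (Set.powersetCard α (a B) → 𝕜) →ₗ[𝕜] (α → Perm α → 𝕜)) :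
    (α ⊕ (Σ B, Set.powersetCard α (a B)) → 𝕜) →ₗ[𝕜] (α → Perm α → 𝕜) :=
  (LinearMap.pi fun p => LinearMap.pi fun _ => LinearMap.proj (.inl p)) +
    ∑ B, Φ B ∘ₗ LinearMap.funLeft 𝕜 𝕜 fun s => .inr ⟨B, s⟩

/-- The relations between the coordinates of `modelSum Φ`: a constant function on the subsets
attached to a block yields a constant coefficient family. -/
def modelRelation (Φ : ∀ B, (Set.powersetCard α (a B) → 𝕜) →ₗ[𝕜] (α → Perm α → 𝕜)) :
    (Block G → 𝕜) →ₗ[𝕜] (α ⊕ (Σ B, Set.powersetCard α (a B)) → 𝕜) :=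
  LinearMap.pi <| Sum.elim
    (fun p => -∑ B, LinearMap.proj (1 : Perm α) ∘ₗ LinearMap.proj p ∘ₗ Φ B ∘ₗ
      LinearMap.pi fun _ => LinearMap.proj B)
    fun x => LinearMap.proj x.1

variable (Φ : ∀ B, (Set.powersetCard α (a B) → 𝕜) →ₗ[𝕜] (α → Perm α → 𝕜))

theorem modelSum_apply (F : α ⊕ (Σ B, Set.powersetCard α (a B)) → 𝕜) (p : α) (w : Perm α) :
    modelSum Φ F p w = F (.inl p) + ∑ B, Φ B (fun s => F (.inr ⟨B, s⟩)) p w := by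
  simp [modelSum, LinearMap.funLeft, Function.comp_def]

theorem modelRelation_apply_inl (c : Block G → 𝕜) (p : α) :
    modelRelation Φ c (.inl p) = -∑ B, Φ B (fun _ => c B) p 1 := by
  simp [modelRelation]
  rfl

theorem modelRelation_injective [Fintype α] (h : ∀ B, a B ≤ Fintype.card α) :
    Function.Injective (modelRelation Φ) := by
  intro c c' hc
  funext B
  obtain ⟨s, -, hs⟩ := Finset.exists_subset_card_eq (s := (Finset.univ : Finset α)) (h B)
  exact congrFun hc (.inr ⟨B, s, hs⟩)

end ModelSum

variable {α : Type*} [DecidableEq α] [Fintype α]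

section Tuples

variable (𝕜 : Type*) [CommRing 𝕜] (G : SimpleGraph α)

/-- The space of coefficient families of linear splines. -/
def tuples : Submodule 𝕜 (α → Perm α → 𝕜) where
  carrier := {b | IsTuple G b}
  add_mem' {a b} ha hb := by
    refine ⟨fun p x y hxy hx hy w => ?_, fun w => ?_⟩
    · simp only [Pi.add_apply, ha.1 p x y hxy hx hy w, hb.1 p x y hxy hx hy w]
    · simp only [Pi.add_apply, Finset.sum_add_distrib, ha.2 w, hb.2 w]
  zero_mem' := ⟨fun _ _ _ _ _ _ _ => rfl, fun _ => rfl⟩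
  smul_mem' c a ha := by
    refine ⟨fun p x y hxy hx hy w => ?_, fun w => ?_⟩
    · simp only [Pi.smul_apply, ha.1 p x y hxy hx hy w]
    · simp only [Pi.smul_apply, ← Finset.smul_sum, ha.2 w]

/-- Left translation of coefficient families. -/
def tupleRep : Representation 𝕜 (Perm α) (tuples 𝕜 G) where
  toFun u :=
    { toFun := fun b => ⟨fun p w => b.1 p (u⁻¹ * w), fun p x y hxy hx hy w => by
        simpa only [mul_assoc] using b.2.1 p x y hxy hx hy (u⁻¹ * w), fun w => by
        rw [b.2.2, b.2.2 (u⁻¹ * 1)]⟩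
      map_add' := fun _ _ => rfl
      map_smul' := fun _ _ => rfl }
  map_one' := by
    ext b p w
    simp
  map_mul' u v := by
    ext b p w
    simp [mul_assoc]

end Tuples

variable {𝕜 : Type*} {G : SimpleGraph α}

theorem const_mem_tuples [CommRing 𝕜] (k : α → 𝕜) : (fun p _ => k p) ∈ tuples 𝕜 G :=
  ⟨fun _ _ _ _ _ _ _ => rfl, fun _ => rfl⟩

section ModelSum

variable [CommRing 𝕜] [Fintype (Block G)] {a : Block G → ℕ}
  {Φ : ∀ B, (Set.powersetCard α (a B) → 𝕜) →ₗ[𝕜] (α → Perm α → 𝕜)}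
  (hΦ : ∀ B, BlockModel B.1 (a B) (Φ B))
include hΦ

theorem modelSum_mem (F : α ⊕ (Σ B, Set.powersetCard α (a B)) → 𝕜) :
    modelSum Φ F ∈ tuples 𝕜 G := by
  rw [modelSum, LinearMap.add_apply, LinearMap.sum_apply]
  exact add_mem (const_mem_tuples _) (sum_mem fun B _ => ((hΦ B).isBlockTuple _).isTuple)

theorem exists_modelSum_eq [Nontrivial α] (hG : G.Connected) {b : α → Perm α → 𝕜}
    (hb : IsTuple G b) : ∃ F, modelSum Φ F = b := by
  choose k F hkF using fun B => (hΦ B).exists_eq _ (isBlockTuple_blockPart hG B.2 hb)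
  refine ⟨Sum.elim (fun p => ∑ q, b q 1 + ∑ B, k B p) fun x => F x.1 x.2, ?_⟩
  funext p w
  have hsum := sum_blockPart hG hb p w
  simp only [hkF, Finset.sum_add_distrib] at hsum
  rw [modelSum_apply, Sum.elim_inl]
  simp only [Sum.elim_inr]
  linear_combination hsum

theorem exact_modelRelation_modelSum (hG : G.Connected) :
    Function.Exact (modelRelation Φ) (modelSum Φ) := by
  refine fun F => ⟨fun hF => ?_, ?_⟩
  · have hsum : ∀ p w, F (.inl p) + ∑ B, Φ B (fun s => F (.inr ⟨B, s⟩)) p w = 0 := fun p w => by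
      rw [← modelSum_apply, hF, Pi.zero_apply, Pi.zero_apply]
    have hconst := IsBlockTuple.eq_const_of_sum_eq_const hG
      (β := fun B => Φ B fun s => F (.inr ⟨B, s⟩)) (fun B => (hΦ B).isBlockTuple _)
      (k := fun p => -F (.inl p)) (fun p w => eq_neg_of_add_eq_zero_right (hsum p w))
    choose c hc using fun B => (hΦ B).eq_const _ (hconst B)
    refine ⟨c, funext ?_⟩
    rintro (p | ⟨B, s⟩)
    · rw [modelRelation_apply_inl, eq_comm, eq_neg_iff_add_eq_zero, ← hsum p 1]
      simp only [hc]
    · exact (congrFun (hc B) s).symm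
  · rintro ⟨c, rfl⟩
    funext p w
    rw [modelSum_apply, modelRelation_apply_inl, Pi.zero_apply, Pi.zero_apply,
      neg_add_eq_zero]
    exact Finset.sum_congr rfl fun B _ => ((hΦ B).map_const (c B) p w).symm

theorem modelSum_smul (u : Perm α) (F : α ⊕ (Σ B, Set.powersetCard α (a B)) → 𝕜) (p : α)
    (w : Perm α) :
    modelSum Φ (fun x => F (Sum.map id (Sigma.map id fun _ s => u • s) x)) p w =
      modelSum Φ (fun x => F x) p (u * w) := by
  rw [modelSum_apply, modelSum_apply]
  congr 1
  exact Finset.sum_congr rfl fun B _ => (hΦ B).equivariant (fun s => F (.inr ⟨B, s⟩)) u p w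

end ModelSum

variable [Field 𝕜] [Fintype (Block G)] {a : Block G → ℕ}
  {Φ : ∀ B, (Set.powersetCard α (a B) → 𝕜) →ₗ[𝕜] (α → Perm α → 𝕜)}

theorem character_tupleRep_add [Nontrivial α] (hG : G.Connected)
    (ha : ∀ B, a B ≤ Fintype.card α)
    (hΦ : ∀ B, BlockModel B.1 (a B) (Φ B)) (u : Perm α) :
    (tupleRep 𝕜 G).character u + Nat.card (Block G) =
      Fintype.card α + ∑ B, (fixCount (a B) u : 𝕜) := by
  classical
  have htrace := trace_eq_add_of_exact (f := LinearMap.id)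
    (g := LinearMap.funLeft 𝕜 𝕜 (Sum.map id (Sigma.map id fun _ s => u⁻¹ • s)))
    (π := (modelSum Φ).codRestrict (tuples 𝕜 G) (modelSum_mem hΦ)) (h := tupleRep 𝕜 G u)
    (modelRelation_injective Φ ha)
    (fun b => (exists_modelSum_eq hΦ hG b.2).imp fun F hF => Subtype.ext hF)
    (fun F => Subtype.ext_iff.trans (exact_modelRelation_modelSum hΦ hG F))
    (fun c => funext fun x => by rcases x with p | x <;> rfl)
    (fun F => by ext p w; exact modelSum_smul hΦ u⁻¹ F p w)
  rw [trace_funLeft, LinearMap.trace_id, Module.finrank_fintype_fun_eq_card,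
    Fintype.sum_sum_type, Fintype.sum_sigma] at htrace
  rw [Representation.character, add_comm, Nat.card_eq_fintype_card, ← htrace]
  have hfix : ∀ B, (fixCount (a B) u : 𝕜) =
      ∑ s : Set.powersetCard α (a B), if u⁻¹ • s = s then 1 else 0 := fun B => by
    rw [← fixCount_inv, fixCount, sum_ite_smul_eq]
  simp [hfix, Sigma.map]

end TupleTrace

/-! ### Splines of degree one -/

section LinearPolynomials

variable {R σ ι : Type*} [CommSemiring R]

theorem coeff_single_one_mul_X [DecidableEq σ] (k i : σ) (g : MvPolynomial σ R) :
    coeff (Finsupp.single k 1) (g * X i) = if k = i then constantCoeff g else 0 := by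
  rw [coeff_mul_X']
  by_cases h : k = i
  · subst h
    simp [constantCoeff_eq]
  · rw [if_neg h, if_neg]
    simpa using Ne.symm h

theorem eq_sum_coeff_smul_X_of_isHomogeneous_one [Fintype σ] {f : MvPolynomial σ R}
    (hf : f.IsHomogeneous 1) : f = ∑ k, coeff (Finsupp.single k 1) f • X k := by
  classical
  ext m
  simp only [coeff_sum, coeff_smul, coeff_X, smul_eq_mul, mul_ite, mul_one, mul_zero]
  by_cases hm : m.degree = 1
  · obtain ⟨i, rfl⟩ := (Finsupp.sum_eq_one_iff m).1 hm
    simp [Finsupp.single_left_inj]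
  · rw [hf.coeff_eq_zero hm, Finset.sum_eq_zero]
    rintro k -
    exact if_neg (by rintro rfl; simp at hm)

theorem eq_sum_constantCoeff_smul_X_of_isHomogeneous_one [Finite σ] [Fintype ι]
    {g : ι → MvPolynomial σ R} {e : ι → σ} (h : (∑ i, g i * X (e i)).IsHomogeneous 1) :
    ∑ i, g i * X (e i) = ∑ i, constantCoeff (g i) • X (e i) := by
  classical
  cases nonempty_fintype σ
  rw [eq_sum_coeff_smul_X_of_isHomogeneous_one h]
  simp_rw [coeff_sum, coeff_single_one_mul_X, Finset.sum_smul, ite_smul, zero_smul]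
  rw [Finset.sum_comm]
  simp

theorem exists_coeff_single_of_mem_span {R : Type*} [CommRing R] [DecidableEq σ]
    {f : MvPolynomial σ R} {a b : σ} (hf : f ∈ Ideal.span {X a - X b}) :
    ∃ c : R, ∀ k, coeff (Finsupp.single k 1) f =
      (if k = a then c else 0) - if k = b then c else 0 := by
  obtain ⟨g, rfl⟩ := Ideal.mem_span_singleton'.1 hf
  refine ⟨constantCoeff g, fun k => ?_⟩
  rw [mul_sub, coeff_sub, coeff_single_one_mul_X, coeff_single_one_mul_X]

end LinearPolynomials

section LinearSplines

variable {n : ℕ} {Γ : SimpleGraph (Fin n)}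

/-- The dot action on the homogeneous splines of degree `d`. -/
def homogeneousRep (Γ : SimpleGraph (Fin n)) (d : ℕ) :
    Representation ℂ (Perm (Fin n)) (homogeneousSplines Γ d) :=
  (dotAction Γ).subrepresentation _ (homogeneous_stable Γ d)

section Coefficients

/-- The spline with coefficient family `b`. -/
def ofTuple (b : Fin n → Perm (Fin n) → ℂ) (w : Perm (Fin n)) : MvPolynomial (Fin n) ℂ :=
  ∑ p, b p w • X (w p)

theorem ofTuple_isHomogeneous (b : Fin n → Perm (Fin n) → ℂ) (w : Perm (Fin n)) :
    (ofTuple b w).IsHomogeneous 1 :=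
  IsHomogeneous.sum _ _ _ fun p _ =>
    (homogeneousSubmodule (Fin n) ℂ 1).smul_mem (b p w) (isHomogeneous_X ℂ (w p))

theorem coeff_ofTuple (b : Fin n → Perm (Fin n) → ℂ) (w : Perm (Fin n)) (p : Fin n) :
    coeff (Finsupp.single (w p) 1) (ofTuple b w) = b p w := by
  simp [ofTuple, coeff_sum, coeff_X, Finsupp.single_left_inj]

theorem ofTuple_mem {b : Fin n → Perm (Fin n) → ℂ} (hb : IsTuple Γ b) :
    ofTuple b ∈ splines Γ := by
  intro w i j hij
  have hsum : ∑ p, (b p w - b p (w * swap i j)) = 0 := by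
    rw [Finset.sum_sub_distrib, hb.2 w, hb.2 (w * swap i j), sub_self]
  have hz : ∀ p, p ≠ i ∧ p ≠ j → b p w - b p (w * swap i j) = 0 := fun p hp => by
    rw [hb.1 p i j hij hp.1 hp.2 w, sub_self]
  rw [Fintype.sum_eq_add i j hij.ne hz] at hsum
  rw [ofTuple, ofTuple, ← Finset.sum_sub_distrib, Fintype.sum_eq_add i j hij.ne]
  · rw [Perm.mul_apply, Perm.mul_apply, swap_apply_left, swap_apply_right]
    refine Ideal.mem_span_singleton'.2 ⟨C (b i w - b j (w * swap i j)), ?_⟩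
    have hbj : b j w = b i (w * swap i j) + b j (w * swap i j) - b i w := by
      linear_combination hsum
    simp only [hbj, smul_eq_C_mul, C_sub, C_add]
    ring
  · rintro p hp
    rw [Perm.mul_apply, swap_apply_of_ne_of_ne hp.1 hp.2, ← sub_smul, hz p hp, zero_smul]

theorem isTuple_coeff (hΓ : Γ.Connected) {ρ : Perm (Fin n) → MvPolynomial (Fin n) ℂ}
    (hρ : ρ ∈ splines Γ) : IsTuple Γ fun p w => coeff (Finsupp.single (w p) 1) (ρ w) := by
  refine ⟨fun p x y hxy hx hy w => ?_, eq_const_of_connected hΓ fun x y hxy w => ?_⟩ <;>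
    obtain ⟨c, hc⟩ := exists_coeff_single_of_mem_span (hρ w x y hxy)
  · have hcp := hc (w p)
    rw [if_neg (w.injective.ne hx), if_neg (w.injective.ne hy), coeff_sub, sub_self] at hcp
    beta_reduce
    rw [Perm.mul_apply, swap_apply_of_ne_of_ne hx hy]
    exact (sub_eq_zero.1 hcp).symm
  · beta_reduce
    rw [Equiv.sum_comp (w * swap x y) fun k => coeff (Finsupp.single k 1) (ρ (w * swap x y)),
      Equiv.sum_comp w fun k => coeff (Finsupp.single k 1) (ρ w), eq_comm, ← sub_eq_zero,
      ← Finset.sum_sub_distrib]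
    simp only [← coeff_sub, hc, Finset.sum_sub_distrib]
    simp

/-- The coefficient family of a spline of degree one. -/
def toTuple (hΓ : Γ.Connected) : homogeneousSplines Γ 1 →ₗ[ℂ] tuples ℂ Γ where
  toFun a := ⟨fun p w => coeff (Finsupp.single (w p) 1) (a.1.1 w), isTuple_coeff hΓ a.1.2⟩
  map_add' _ _ := by ext; simp
  map_smul' _ _ := by ext; simp

theorem toTuple_apply (hΓ : Γ.Connected) (a : homogeneousSplines Γ 1) (p : Fin n)
    (w : Perm (Fin n)) :
    (toTuple hΓ a).1 p w = coeff (Finsupp.single (w p) 1) (a.1.1 w) := rfl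

theorem toTuple_bijective (hΓ : Γ.Connected) : Function.Bijective (toTuple hΓ) := by
  refine ⟨fun a a' h => ?_, fun b => ?_⟩
  · ext w : 3
    rw [eq_sum_coeff_smul_X_of_isHomogeneous_one (a.2 w),
      eq_sum_coeff_smul_X_of_isHomogeneous_one (a'.2 w), ← Equiv.sum_comp w,
      ← Equiv.sum_comp w fun k => coeff _ (a'.1.1 w) • X k]
    simp only [← toTuple_apply hΓ, h]
  · refine ⟨⟨⟨ofTuple b.1, ofTuple_mem b.2⟩, ofTuple_isHomogeneous b.1⟩, ?_⟩
    ext p w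
    exact coeff_ofTuple b.1 w p

theorem homogeneousRep_one_character (hΓ : Γ.Connected) (u : Perm (Fin n)) :
    Representation.character (V := homogeneousSplines Γ 1) (homogeneousRep Γ 1) u =
      (tupleRep ℂ Γ).character u := by
  refine trace_eq_of_bijective (M := homogeneousSplines Γ 1) (N := tuples ℂ Γ)
    (toTuple_bijective hΓ) fun a => ?_
  ext p w
  have h := coeff_rename_mapDomain u u.injective (a.1.1 (u⁻¹ * w))
    (Finsupp.single ((u⁻¹ * w) p) 1)
  rwa [Finsupp.mapDomain_single, ← Perm.mul_apply, mul_inv_cancel_left] at h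

end Coefficients

section Quotient

theorem exists_constantCoeff_eq (hΓ : Γ.Connected) (r : splines Γ) :
    ∃ c : ℂ, ∀ w, constantCoeff (r.1 w) = c := by
  refine ⟨constantCoeff (r.1 1), eq_const_of_connected hΓ fun x y hxy w => ?_⟩
  obtain ⟨g, hg⟩ := Ideal.mem_span_singleton'.1 (r.2 w x y hxy)
  have hg0 := congrArg constantCoeff hg
  rw [map_mul, map_sub, constantCoeff_X, constantCoeff_X, sub_self, mul_zero, map_sub] at hg0
  exact (sub_eq_zero.1 hg0.symm).symm

variable {y : Fin n → homogeneousSplines Γ 1} {τ : Perm (Fin n) → Perm (Fin n)}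

theorem linearCombination_apply (hτ : ∀ i w, (y i).1.1 w = X (τ w i)) (c : Fin n → ℂ)
    (w : Perm (Fin n)) :
    (Fintype.linearCombination ℂ y c).1.1 w = ∑ i, c i • X (τ w i) := by
  simp [Fintype.linearCombination_apply, Finset.sum_apply, hτ]

theorem linearCombination_injective (hτ : ∀ i w, (y i).1.1 w = X (τ w i)) :
    Function.Injective (Fintype.linearCombination ℂ y) := by
  refine fun c c' h => funext fun i => ?_
  have h1 := congrArg (fun a : homogeneousSplines Γ 1 =>
    coeff (Finsupp.single (τ 1 i) 1) (a.1.1 1)) h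
  simpa [linearCombination_apply hτ, coeff_sum, coeff_X, Finsupp.single_left_inj] using h1

theorem mem_range_linearCombination (hΓ : Γ.Connected) (hτ : ∀ i w, (y i).1.1 w = X (τ w i))
    {a : homogeneousSplines Γ 1} (ha : a.1 ∈ Ideal.span (Set.range fun i => (y i).1)) :
    a ∈ Set.range (Fintype.linearCombination ℂ y) := by
  obtain ⟨r, hr⟩ := (Submodule.mem_span_range_iff_exists_fun _).1 ha
  choose c hc using fun i => exists_constantCoeff_eq hΓ (r i)
  refine ⟨c, ?_⟩
  ext w : 3
  have hrw : a.1.1 w = ∑ i, (r i).1 w * X (τ w i) := by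
    simp [← hr, ← hτ, Finset.sum_apply]
  rw [linearCombination_apply hτ, hrw,
    eq_sum_constantCoeff_smul_X_of_isHomogeneous_one (hrw ▸ a.2 w)]
  simp only [hc]

theorem exact_linearCombination_submoduleMap (hΓ : Γ.Connected)
    (hτ : ∀ i w, (y i).1.1 w = X (τ w i)) {I : Submodule ℂ (splines Γ)}
    (hI : I = (Ideal.span (Set.range fun i => (y i).1)).restrictScalars ℂ) :
    Function.Exact (Fintype.linearCombination ℂ y)
      (I.mkQ.submoduleMap (homogeneousSplines Γ 1)) := by
  intro a
  have hker : I.mkQ.submoduleMap (homogeneousSplines Γ 1) a = 0 ↔ a.1 ∈ I := by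
    rw [Subtype.ext_iff]
    exact Submodule.Quotient.mk_eq_zero I
  rw [hker, hI]
  refine ⟨mem_range_linearCombination hΓ hτ, ?_⟩
  rintro ⟨c, rfl⟩
  rw [Fintype.linearCombination_apply, AddSubmonoidClass.coe_finsetSum]
  exact sum_mem fun i _ => Submodule.smul_mem _ (c i) (Ideal.subset_span ⟨i, rfl⟩)

theorem homogeneousRep_character_eq_add (hΓ : Γ.Connected)
    (hτ : ∀ i w, (y i).1.1 w = X (τ w i)) {I : Submodule ℂ (splines Γ)}
    (hI : I = (Ideal.span (Set.range fun i => (y i).1)).restrictScalars ℂ)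
    (hstable : ∀ w, I ≤ I.comap (dotAction Γ w)) {u σ : Perm (Fin n)}
    (hσ : ∀ i, homogeneousRep Γ 1 u (y i) = y (σ i)) :
    Representation.character (V := homogeneousSplines Γ 1) (homogeneousRep Γ 1) u =
      Nat.card (MulAction.fixedBy (Fin n) σ) +
        (((dotAction Γ).quotient I hstable).subrepresentation _
          (map_stable Γ 1 I hstable)).character u := by
  have htrace := trace_eq_add_of_exact (M := homogeneousSplines Γ 1)
    (N := (homogeneousSplines Γ 1).map I.mkQ) (f := LinearMap.funLeft ℂ ℂ ⇑σ⁻¹)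
    (g := homogeneousRep Γ 1 u) (h := ((dotAction Γ).quotient I hstable).subrepresentation _
      (map_stable Γ 1 I hstable) u)
    (linearCombination_injective hτ) (I.mkQ.submoduleMap_surjective _)
    (exact_linearCombination_submoduleMap hΓ hτ hI)
    (fun c => by
      simp only [Fintype.linearCombination_apply, map_sum, map_smul, hσ]
      exact Fintype.sum_equiv σ _ _ fun i => by simp [LinearMap.funLeft_apply])
    fun _ => rfl
  rw [trace_funLeft] at htrace
  rw [← MulAction.fixedBy_inv, ← sum_ite_smul_eq]
  exact htrace

theorem tSpline_mem (i : Fin n) : tSpline Γ i ∈ homogeneousSplines Γ 1 :=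
  fun _ => isHomogeneous_X ℂ i

theorem xSpline_mem (i : Fin n) : xSpline Γ i ∈ homogeneousSplines Γ 1 :=
  fun w => isHomogeneous_X ℂ (w i)

theorem leftRep_one_character_add (hΓ : Γ.Connected) (u : Perm (Fin n)) :
    (leftRep Γ 1).character u + fixCount 1 u = (tupleRep ℂ Γ).character u := by
  rw [fixCount_one, add_comm, ← homogeneousRep_one_character hΓ]
  refine (homogeneousRep_character_eq_add hΓ (y := fun i => ⟨tSpline Γ i, tSpline_mem i⟩)
    (τ := fun _ => 1) (fun _ _ => rfl) rfl (leftIdeal_stable Γ) fun i => ?_).symm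
  ext : 3
  exact rename_X _ _

theorem rightRep_one_character_add (hΓ : Γ.Connected) (u : Perm (Fin n)) :
    (rightRep Γ 1).character u + n = (tupleRep ℂ Γ).character u := by
  rw [add_comm, ← homogeneousRep_one_character hΓ]
  have h := homogeneousRep_character_eq_add hΓ (u := u) (σ := 1)
    (y := fun i => ⟨xSpline Γ i, xSpline_mem i⟩) (τ := id) (fun _ _ => rfl) rfl
    (rightIdeal_stable Γ) fun i => ?_
  · rw [MulAction.fixedBy_one_eq_univ, Nat.card_univ, Nat.card_fin] at h
    exact h.symm
  · ext w : 3
    refine (rename_X _ _).trans (congrArg X ?_)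
    rw [← Perm.mul_apply, mul_inv_cancel_left, Perm.one_apply]

end Quotient

end LinearSplines

/-! ### Power sums and invariant words -/

section PowerSums

variable {α β : Type*}

/-- The content of the word `φ` on the set `s` of positions: the multiplicity of each letter. -/
def content (s : Finset α) (φ : α → ℕ) : ℕ →₀ ℕ := ∑ x ∈ s, Finsupp.single (φ x) 1

theorem content_apply (s : Finset α) (φ : α → ℕ) (i : ℕ) :
    content s φ i = Finset.card {x ∈ s | φ x = i} := by
  rw [content, Finsupp.finsetSum_apply]
  simp [Finsupp.single_apply]

theorem degree_content (s : Finset α) (φ : α → ℕ) : (content s φ).degree = s.card := by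
  simp [content]

theorem content_map (e : β ↪ α) (s : Finset β) (φ : α → ℕ) :
    content (s.map e) φ = content s (φ ∘ e) :=
  Finset.sum_map s e _

theorem content_comp [DecidableEq β] [Fintype β] (s : Finset α) (f : α → β) (ψ : β → ℕ) :
    content s (ψ ∘ f) = ∑ b, Finsupp.single (ψ b) (Finset.card {x ∈ s | f x = b}) := by
  rw [content, ← Finset.sum_fiberwise s f]
  refine Finset.sum_congr rfl fun b _ => ?_
  have hconst : ∀ x ∈ s.filter (f · = b),
      Finsupp.single ((ψ ∘ f) x) 1 = Finsupp.single (ψ b) 1 := fun x hx => by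
    rw [Function.comp_apply, (Finset.mem_filter.1 hx).2]
  rw [Finset.sum_congr rfl hconst, Finset.sum_const, Finsupp.smul_single_one]

theorem content_add_content_compl [Fintype α] [DecidableEq α] (s : Finset α) (φ : α → ℕ) :
    content s φ + content sᶜ φ = content Finset.univ φ :=
  Finset.sum_add_sum_compl s _

theorem exists_subset_content_eq {s : Finset α} {φ : α → ℕ} {m : ℕ →₀ ℕ} (hm : m ≤ content s φ) :
    ∃ t ⊆ s, content t φ = m := by
  classical
  have hfiber : ∀ i, ∃ t ⊆ s.filter (φ · = i), t.card = m i := fun i =>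
    Finset.exists_subset_card_eq (content_apply s φ i ▸ hm i)
  choose t hts htm using hfiber
  refine ⟨s.filter fun x => x ∈ t (φ x), Finset.filter_subset _ _, Finsupp.ext fun i => ?_⟩
  rw [content_apply, ← htm i]
  congr 1
  ext x
  rw [Finset.mem_filter, Finset.mem_filter]
  constructor
  · rintro ⟨⟨-, hx⟩, rfl⟩
    exact hx
  · intro hx
    obtain ⟨hxs, rfl⟩ := Finset.mem_filter.1 (hts i hx)
    exact ⟨⟨hxs, hx⟩, rfl⟩

section Cycles

variable [Fintype α] [DecidableEq α]

/-- The index set of the cycles of `w`, each fixed point counting as a cycle of its own. -/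
abbrev Cycles (w : Perm α) : Type _ := w.cycleFactorsFinset ⊕ {x // x ∉ w.support}

/-- The cycle of `w` through `x`. -/
def cycleThrough (w : Perm α) (x : α) : Cycles w :=
  if hx : x ∈ w.support then
    Sum.inl ⟨w.cycleOf x, Perm.cycleOf_mem_cycleFactorsFinset_iff.2 hx⟩
  else Sum.inr ⟨x, hx⟩

/-- The length of a cycle of `w`. -/
def cycleSize (w : Perm α) : Cycles w → ℕ :=
  Sum.elim (fun c => c.1.support.card) fun _ => 1

theorem cycleThrough_eq_inl_iff {w : Perm α} {x : α} {c : w.cycleFactorsFinset} :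
    cycleThrough w x = Sum.inl c ↔ x ∈ c.1.support := by
  rw [← Perm.eq_cycleOf_of_mem_cycleFactorsFinset_iff w c.1 c.2 x, cycleThrough]
  split_ifs with hx
  · rw [Sum.inl.injEq, Subtype.ext_iff, eq_comm]
  · simp only [false_iff]
    intro h
    exact hx (Perm.cycleOf_mem_cycleFactorsFinset_iff.1 (h ▸ c.2))

theorem cycleThrough_eq_inr_iff {w : Perm α} {x : α} {y : {x // x ∉ w.support}} :
    cycleThrough w x = Sum.inr y ↔ x = y := by
  rw [cycleThrough]
  split_ifs with hx
  · simp only [false_iff]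
    rintro rfl
    exact y.2 hx
  · rw [Sum.inr.injEq, Subtype.ext_iff]

theorem card_cycleThrough_eq (w : Perm α) (q : Cycles w) :
    Finset.card {x | cycleThrough w x = q} = cycleSize w q := by
  rcases q with c | y
  · simp only [cycleThrough_eq_inl_iff, Finset.filter_univ_mem, cycleSize, Sum.elim_inl]
  · simp only [cycleThrough_eq_inr_iff, cycleSize, Sum.elim_inr, Finset.card_eq_one]
    exact ⟨y, by ext; simp⟩

theorem cycleSize_pos (w : Perm α) (q : Cycles w) :
    0 < cycleSize w q := by
  rcases q with c | _
  · exact Finset.card_pos.2 (Perm.mem_cycleFactorsFinset_iff.1 c.2).1.nonempty_support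
  · exact Nat.one_pos

theorem cycleThrough_surjective (w : Perm α) : Function.Surjective (cycleThrough w) := fun q => by
  obtain ⟨x, hx⟩ := Finset.card_pos.1 (card_cycleThrough_eq w q ▸ cycleSize_pos w q)
  exact ⟨x, (Finset.mem_filter.1 hx).2⟩

theorem cycleThrough_eq_iff {w : Perm α} {x y : α} :
    cycleThrough w x = cycleThrough w y ↔ w.SameCycle x y := by
  by_cases hy : y ∈ w.support
  · rw [cycleThrough.eq_def w y, dif_pos hy, cycleThrough_eq_inl_iff,
      Perm.mem_support_cycleOf_iff' (Perm.mem_support.1 hy), Perm.sameCycle_comm]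
  · rw [cycleThrough.eq_def w y, dif_neg hy, cycleThrough_eq_inr_iff]
    exact ⟨fun h => h ▸ .refl w x, fun h => h.eq_of_right (Perm.notMem_support.1 hy)⟩

theorem prod_map_parts_partition {M : Type*} [CommMonoid M] (w : Perm α) (f : ℕ → M) :
    (w.partition.parts.map f).prod = ∏ q, f (cycleSize w q) := by
  have hfixed : Fintype.card α - w.support.card = Fintype.card {x // x ∉ w.support} := by
    rw [Fintype.card_subtype_compl, Fintype.card_coe]
  rw [Perm.parts_partition, Multiset.map_add, Multiset.prod_add, Multiset.map_replicate,
    Multiset.prod_replicate, hfixed, Perm.cycleType_def, Multiset.map_map, Fintype.prod_sum_type]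
  simp only [cycleSize, Sum.elim_inl, Sum.elim_inr, Finset.prod_const, Finset.card_univ]
  congr 1
  exact (Finset.prod_coe_sort w.cycleFactorsFinset fun c => f c.support.card).symm

theorem card_invariant_words (w : Perm α) (m : ℕ →₀ ℕ) :
    Nat.card {φ : α → ℕ // φ ∘ w = φ ∧ content Finset.univ φ = m} =
      Nat.card {ψ : Cycles w → ℕ // ∑ q, Finsupp.single (ψ q) (cycleSize w q) = m} := by
  have hcontent (ψ : Cycles w → ℕ) : content Finset.univ (ψ ∘ cycleThrough w) =
      ∑ q, Finsupp.single (ψ q) (cycleSize w q) := by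
    simp only [content_comp, card_cycleThrough_eq]
  have hinv (ψ : Cycles w → ℕ) : (ψ ∘ cycleThrough w) ∘ w = ψ ∘ cycleThrough w := by
    funext x
    exact congrArg ψ (cycleThrough_eq_iff.2 (Perm.sameCycle_apply_left.2 (.refl w x)))
  symm
  refine Nat.card_eq_of_bijective
    (fun ψ => ⟨ψ.1 ∘ cycleThrough w, hinv ψ.1, (hcontent ψ.1).trans ψ.2⟩) ⟨fun ψ ψ' h => ?_, ?_⟩
  · exact Subtype.ext ((cycleThrough_surjective w).injective_comp_right (congrArg Subtype.val h))
  · rintro ⟨φ, hφ, hm⟩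
    have hfactors : φ.FactorsThrough (cycleThrough w) := fun x y hxy => by
      obtain ⟨i, rfl⟩ := (cycleThrough_eq_iff.1 hxy).exists_nat_pow_eq
      have hsemi : Function.Semiconj φ w id := congrFun hφ
      rw [← Perm.iterate_eq_pow, (hsemi.iterate_right i).eq, Function.iterate_id, id]
    obtain ⟨ψ, rfl⟩ := (Function.factorsThrough_iff φ).1 hfactors
    exact ⟨⟨ψ, (hcontent ψ).symm.trans hm⟩, rfl⟩

end Cycles

theorem card_filter_finsuppAntidiag_single {ι : Type*} [Fintype ι] [DecidableEq ι] {k : ι → ℕ}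
    (hk : ∀ q, 0 < k q) (m : ℕ →₀ ℕ)
    [DecidablePred fun l : ι →₀ ℕ →₀ ℕ => ∀ q, ∃ i, l q = Finsupp.single i (k q)] :
    Finset.card {l ∈ Finset.univ.finsuppAntidiag m | ∀ q, ∃ i, l q = Finsupp.single i (k q)} =
      Nat.card {ψ : ι → ℕ // ∑ q, Finsupp.single (ψ q) (k q) = m} := by
  let F (ψ : ι → ℕ) : ι →₀ ℕ →₀ ℕ :=
    Finsupp.equivFunOnFinite.symm fun q => Finsupp.single (ψ q) (k q)
  have hF : F.Injective := fun ψ ψ' h => funext fun q =>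
    Finsupp.single_left_injective (hk q).ne' (DFunLike.congr_fun h q)
  rw [← Set.ncard_coe_finset, ← Set.coe_ofPred, Nat.card_coe_set_eq,
    ← Set.ncard_image_of_injective _ hF]
  congr 1
  ext l
  rw [Finset.mem_coe, Finset.mem_filter, Finset.mem_finsuppAntidiag]
  constructor
  · rintro ⟨⟨hsum, -⟩, hl⟩
    choose ψ hψ using hl
    refine ⟨ψ, ?_, Finsupp.ext fun q => (hψ q).symm⟩
    rw [Set.mem_ofPred_eq, ← hsum]
    exact Finset.sum_congr rfl fun q _ => (hψ q).symm
  · rintro ⟨ψ, hψ, rfl⟩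
    exact ⟨⟨hψ, Finset.subset_univ _⟩, fun q => ⟨ψ q, rfl⟩⟩

theorem coeff_prod_powerSum {ι : Type*} [Fintype ι] {k : ι → ℕ} (hk : ∀ q, 0 < k q)
    (m : ℕ →₀ ℕ) : MvPowerSeries.coeff m (∏ q, powerSum (k q)) =
      (Nat.card {ψ : ι → ℕ // ∑ q, Finsupp.single (ψ q) (k q) = m} : ℂ) := by
  classical
  have hprod (l : ι →₀ ℕ →₀ ℕ) : ∏ q, MvPowerSeries.coeff (l q) (powerSum (k q)) =
      if ∀ q, ∃ i, l q = Finsupp.single i (k q) then 1 else 0 := by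
    change ∏ q, (if ∃ i, l q = Finsupp.single i (k q) then (1 : ℂ) else 0) = _
    simp only [Finset.prod_ite_zero, Finset.mem_univ, true_imp_iff, Finset.prod_const_one]
  rw [MvPowerSeries.coeff_prod, ← card_filter_finsuppAntidiag_single hk]
  simp only [hprod, Finset.sum_boole]

theorem coeff_prod_parts_partition [Fintype α] [DecidableEq α] (w : Perm α) (m : ℕ →₀ ℕ) :
    MvPowerSeries.coeff m (w.partition.parts.map powerSum).prod =
      (Nat.card {φ : α → ℕ // φ ∘ w = φ ∧ content Finset.univ φ = m} : ℂ) := by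
  rw [prod_map_parts_partition, coeff_prod_powerSum (cycleSize_pos w), card_invariant_words]

end PowerSums

/-! ### Weakly increasing words -/

section SortedWords

/-- The `j`-th letter of the weakly increasing word of content `m`; it is `0` for `j` beyond the
length `m.degree` of that word. -/
def sortedEntry (m : ℕ →₀ ℕ) (j : ℕ) : ℕ :=
  ((Finsupp.toMultiset m).sort (· ≤ ·)).getD j 0

theorem toMultiset_content {α : Type*} (s : Finset α) (φ : α → ℕ) :
    Finsupp.toMultiset (content s φ) = s.val.map φ := by
  rw [← Multiset.sum_map_singleton (s.val.map φ), Multiset.map_map, content, map_sum]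
  simp only [Finsupp.toMultiset_single, one_smul]
  rfl

theorem map_sortedEntry_range (m : ℕ →₀ ℕ) :
    (List.range m.degree).map (sortedEntry m) = (Finsupp.toMultiset m).sort (· ≤ ·) := by
  have hlength : ((Finsupp.toMultiset m).sort (· ≤ ·)).length = m.degree := by
    rw [Multiset.length_sort, Finsupp.card_toMultiset]
    rfl
  refine List.ext_getElem (by rw [List.length_map, List.length_range, hlength]) fun j _ hj => ?_
  rw [List.getElem_map, List.getElem_range, sortedEntry, List.getD_eq_getElem _ _ hj]

theorem content_sortedEntry (m : ℕ →₀ ℕ) :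
    content (Finset.range m.degree) (sortedEntry m) = m := by
  apply Multiset.toFinsupp.symm.injective
  change Finsupp.toMultiset _ = Finsupp.toMultiset m
  rw [toMultiset_content, ← Multiset.sort_eq (Finsupp.toMultiset m) (· ≤ ·),
    ← map_sortedEntry_range]
  rfl

theorem sortedEntry_monotoneOn (m : ℕ →₀ ℕ) :
    MonotoneOn (sortedEntry m) (Set.Iio m.degree) := by
  have hsorted := Multiset.pairwise_sort (Finsupp.toMultiset m) (· ≤ ·)
  rw [← map_sortedEntry_range, List.pairwise_map] at hsorted
  refine monotoneOn_iff_forall_lt.2 fun i _ j hj hij => ?_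
  simpa only [List.getElem_range] using List.pairwise_iff_getElem.1 hsorted i j
    (List.length_range ▸ hij.trans hj) (List.length_range ▸ hj) hij

theorem eq_sortedEntry {k : ℕ} {f : ℕ → ℕ} (hf : MonotoneOn f (Set.Iio k)) {j : ℕ} (hj : j < k) :
    f j = sortedEntry (content (Finset.range k) f) j := by
  have hsort : (List.range k).map f =
      (Finsupp.toMultiset (content (Finset.range k) f)).sort (· ≤ ·) := by
    rw [toMultiset_content]
    refine List.Perm.eq_of_pairwise' (r := (· ≤ ·)) ?_ (Multiset.pairwise_sort _ _) ?_
    · rw [List.pairwise_map]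
      refine List.pairwise_lt_range.imp_of_mem fun ha hb hab => ?_
      exact hf (List.mem_range.1 ha) (List.mem_range.1 hb) hab.le
    · rw [← Multiset.coe_eq_coe, Multiset.sort_eq]
      rfl
  rw [sortedEntry, ← hsort, List.getD_eq_getElem _ _ (by simpa using hj), List.getElem_map,
    List.getElem_range]

theorem exists_sortedEntry_eq {m : ℕ →₀ ℕ} {l : ℕ} (hl : m l ≠ 0) :
    ∃ j < m.degree, sortedEntry m j = l := by
  rw [← content_sortedEntry m, content_apply] at hl
  obtain ⟨j, hj⟩ := Finset.card_pos.1 (Nat.pos_of_ne_zero hl)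
  rw [Finset.mem_filter, Finset.mem_range] at hj
  exact ⟨j, hj⟩

theorem exists_content_eq {α : Type*} [Fintype α] {m : ℕ →₀ ℕ} (hm : m.degree = Fintype.card α) :
    ∃ φ : α → ℕ, content Finset.univ φ = m := by
  let e : α ↪ ℕ := (Fintype.equivFin α).toEmbedding.trans Fin.valEmbedding
  have he : Finset.univ.map e = Finset.range m.degree := by
    rw [← Finset.map_map, Finset.map_univ_equiv, hm, Fin.map_valEmbedding_univ,
      Nat.Iio_eq_range]
  exact ⟨sortedEntry m ∘ e, by rw [← content_map, he, content_sortedEntry]⟩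

end SortedWords

/-! ### Counting orbits of marked words -/

section Burnside

open scoped Pointwise

theorem exists_perm_of_card_fiber_eq {α β : Type*} [Fintype α] [DecidableEq β] {f g : α → β}
    (h : ∀ b, Finset.card {x | f x = b} = Finset.card {x | g x = b}) :
    ∃ u : Perm α, g ∘ u = f := by
  have hfiber (b : β) : Nonempty ({x // f x = b} ≃ {x // g x = b}) := by
    rw [← Fintype.card_eq, Fintype.card_subtype, Fintype.card_subtype]
    exact h b
  let e (b : β) : {x // f x = b} ≃ {x // g x = b} := (hfiber b).some
  refine ⟨(Equiv.sigmaFiberEquiv f).symm.trans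
    ((Equiv.sigmaCongrRight e).trans (Equiv.sigmaFiberEquiv g)), funext fun x => ?_⟩
  exact (e (f x) ⟨x, rfl⟩).2

variable {α : Type*} [Fintype α]

variable (α) in
/-- The words on the positions `α` of content `m`. -/
@[ext]
structure Word (m : ℕ →₀ ℕ) where
  /-- The letter at a given position. -/
  letter : α → ℕ
  content_letter : content Finset.univ letter = m

instance (m : ℕ →₀ ℕ) : MulAction (Perm α) (Word α m) where
  smul u φ := ⟨φ.letter ∘ ⇑u⁻¹, by
    have h := content_map (u⁻¹ : Perm α).toEmbedding Finset.univ φ.letter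
    rw [Finset.map_univ_equiv] at h
    exact h.symm.trans φ.content_letter⟩
  one_smul _ := rfl
  mul_smul u v φ := Word.ext (congrArg (fun w : Perm α => φ.letter ∘ w) (mul_inv_rev u v))

theorem Word.smul_eq_iff {m : ℕ →₀ ℕ} {u : Perm α} {φ ψ : Word α m} :
    u • φ = ψ ↔ ψ.letter ∘ u = φ.letter := by
  rw [Word.ext_iff, eq_comm]
  exact Equiv.eq_comp_symm u _ _

instance (m : ℕ →₀ ℕ) : Finite (Word α m) := by
  have hfinite : {φ : α → ℕ | content Finset.univ φ = m}.Finite := by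
    refine (Set.Finite.pi fun _ : α => m.support.finite_toSet).subset ?_
    rintro φ rfl x -
    rw [Finset.mem_coe, Finsupp.mem_support_iff, content_apply]
    exact (Finset.card_pos.2 ⟨x, by simp⟩).ne'
  have := hfinite.to_subtype
  exact Finite.of_injective (β := {φ : α → ℕ | content Finset.univ φ = m})
    (fun φ => ⟨φ.letter, φ.content_letter⟩) fun _ _ h => Word.ext (congrArg Subtype.val h)

variable [DecidableEq α]

variable (α) in
/-- Pairs of an `a`-element subset and a word of content `m`. -/
abbrev MarkedWord (a : ℕ) (m : ℕ →₀ ℕ) : Type _ := Set.powersetCard α a × Word α m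

/-- The contents of a word on the marked subset and on its complement. -/
def splitContent {a : ℕ} {m : ℕ →₀ ℕ} (y : MarkedWord α a m) : (ℕ →₀ ℕ) × (ℕ →₀ ℕ) :=
  (content y.1.1 y.2.letter, content y.1.1ᶜ y.2.letter)

theorem splitContent_smul {a : ℕ} {m : ℕ →₀ ℕ} (u : Perm α) (y : MarkedWord α a m) :
    splitContent (u • y) = splitContent y := by
  have hcontent (s : Finset α) : content (u • s) (u • y.2).letter = content s y.2.letter := by
    have hletter : (u • y.2).letter ∘ u = y.2.letter := Word.smul_eq_iff.1 rfl
    have hsmul : u • s = s.map u.toEmbedding := Finset.map_eq_image u.toEmbedding s |>.symm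
    rw [hsmul, content_map, ← hletter]
    rfl
  rw [splitContent, Prod.smul_fst, Prod.smul_snd, Set.powersetCard.coe_smul, hcontent,
    Finset.compl_eq_univ_sdiff,
    ← Finset.smul_finset_univ (a := u), ← Finset.smul_finset_sdiff, hcontent,
    ← Finset.compl_eq_univ_sdiff, splitContent]

theorem exists_smul_eq_of_splitContent_eq {a : ℕ} {m : ℕ →₀ ℕ} {y z : MarkedWord α a m}
    (h : splitContent y = splitContent z) : ∃ u : Perm α, u • y = z := by
  have hfiber (v : MarkedWord α a m) (b : Bool × ℕ) :
      Finset.card {x | (decide (x ∈ v.1.1), v.2.letter x) = b} =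
        if b.1 then (splitContent v).1 b.2 else (splitContent v).2 b.2 := by
    obtain ⟨b, i⟩ := b
    rw [splitContent, content_apply, content_apply]
    cases b
    all_goals
      congr 1
      ext x
      simp
  obtain ⟨u, hu⟩ := exists_perm_of_card_fiber_eq (f := fun x => (decide (x ∈ y.1.1), y.2.letter x))
    (g := fun x => (decide (x ∈ z.1.1), z.2.letter x)) fun b => by rw [hfiber, hfiber, h]
  have hu₁ (x : α) : u x ∈ z.1.1 ↔ x ∈ y.1.1 := by
    simpa using congrArg Prod.fst (congrFun hu x)
  refine ⟨u, Prod.ext (Subtype.ext (Finset.ext fun x => ?_)) (Word.smul_eq_iff.2 ?_)⟩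
  · obtain ⟨x, rfl⟩ := u.surjective x
    rw [hu₁]
    exact Finset.smul_mem_smul_finset_iff u
  · exact funext fun x => congrArg Prod.snd (congrFun hu x)

theorem exists_splitContent_eq {a : ℕ} {m m₁ m₂ : ℕ →₀ ℕ} (hm : m₁ + m₂ = m)
    (h₁ : m₁.degree = a) (h : m.degree = Fintype.card α) :
    ∃ y : MarkedWord α a m, splitContent y = (m₁, m₂) := by
  obtain ⟨φ, hφ⟩ := exists_content_eq h
  obtain ⟨s, -, hs⟩ := exists_subset_content_eq (hφ ▸ hm ▸ le_self_add : m₁ ≤ content _ φ)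
  have hcompl : content sᶜ φ = m₂ := by
    apply add_left_cancel (a := m₁)
    rw [hm, ← hφ, ← hs, content_add_content_compl]
  refine ⟨⟨⟨s, ?_⟩, ⟨φ, hφ⟩⟩, Prod.ext hs hcompl⟩
  rw [Set.powersetCard.mem_iff, ← degree_content s φ, hs, h₁]

theorem coeff_completeHomogeneous_mul (a b : ℕ) (m : ℕ →₀ ℕ) :
    MvPowerSeries.coeff m (completeHomogeneous a * completeHomogeneous b) =
      ({x ∈ Finset.HasAntidiagonal.antidiagonal m | x.1.degree = a ∧ x.2.degree = b}.card : ℂ) := by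
  have hcoeff (k : ℕ) (m : ℕ →₀ ℕ) : MvPowerSeries.coeff m (completeHomogeneous k) =
      if m.degree = k then 1 else 0 := rfl
  rw [MvPowerSeries.coeff_mul, ← Finset.sum_boole]
  simp only [hcoeff, ite_and, ite_mul, one_mul, zero_mul]

theorem card_orbits_markedWord {a : ℕ} (ha : a ≤ Fintype.card α) (m : ℕ →₀ ℕ) :
    (Nat.card (MulAction.orbitRel.Quotient (Perm α) (MarkedWord α a m)) : ℂ) =
      MvPowerSeries.coeff m (completeHomogeneous a * completeHomogeneous (Fintype.card α - a)) := by
  rw [coeff_completeHomogeneous_mul, ← Nat.card_eq_finsetCard]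
  congr 1
  have hmem (y : MarkedWord α a m) : splitContent y ∈
      (Finset.HasAntidiagonal.antidiagonal m).filter fun x =>
        x.1.degree = a ∧ x.2.degree = Fintype.card α - a := by
    rw [Finset.mem_filter, Finset.HasAntidiagonal.mem_antidiagonal, splitContent,
      content_add_content_compl, degree_content, degree_content, Finset.card_compl,
      Set.powersetCard.mem_iff.1 y.1.2]
    exact ⟨y.2.content_letter, rfl, rfl⟩
  refine card_eq_of_ker_eq (α := MarkedWord α a m) (f := Quotient.mk _)
    (g := fun y => ⟨splitContent y, hmem y⟩) Quotient.mk_surjective ?_ fun y z => ?_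
  · rintro ⟨⟨m₁, m₂⟩, hx⟩
    rw [Finset.mem_filter, Finset.HasAntidiagonal.mem_antidiagonal] at hx
    obtain ⟨hm, h₁, h₂⟩ := hx
    have hdegree : m.degree = Fintype.card α := by rw [← hm, map_add, h₁, h₂]; omega
    exact (exists_splitContent_eq hm h₁ hdegree).imp fun y hy => Subtype.ext hy
  · rw [Quotient.eq, Subtype.mk.injEq]
    constructor
    · rintro ⟨u, rfl⟩
      exact splitContent_smul u z
    · exact fun h => exists_smul_eq_of_splitContent_eq h.symm

theorem fixCount_mul_coeff (a : ℕ) (m : ℕ →₀ ℕ) (u : Perm α) :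
    fixCount a u * MvPowerSeries.coeff m (u.partition.parts.map powerSum).prod =
      (Nat.card (MulAction.fixedBy (MarkedWord α a m) u) : ℂ) := by
  have hfixed : MulAction.fixedBy (MarkedWord α a m) u =
      MulAction.fixedBy (Set.powersetCard α a) u ×ˢ MulAction.fixedBy (Word α m) u :=
    Set.ext fun _ => Prod.ext_iff
  rw [coeff_prod_parts_partition, fixCount, ← Nat.cast_mul, hfixed,
    Nat.card_congr (Equiv.Set.prod _ _), Nat.card_prod]
  congr 2
  refine Nat.card_congr
    { toFun := fun φ => ⟨⟨φ.1, φ.2.2⟩, Word.smul_eq_iff.2 φ.2.1⟩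
      invFun := fun φ => ⟨φ.1.letter, Word.smul_eq_iff.1 φ.2, φ.1.content_letter⟩ }

theorem sum_fixCount_smul {a : ℕ} (ha : a ≤ Fintype.card α) :
    ((Fintype.card α).factorial : ℂ)⁻¹ • ∑ u : Perm α,
      fixCount a u • (u.partition.parts.map powerSum).prod =
        completeHomogeneous a * completeHomogeneous (Fintype.card α - a) := by
  classical
  ext m
  have := Fintype.ofFinite (MulAction.orbitRel.Quotient (Perm α) (MarkedWord α a m))
  have (u : Perm α) : Fintype (MulAction.fixedBy (MarkedWord α a m) u) := Fintype.ofFinite _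
  have hburnside := MulAction.sum_card_fixedBy_eq_card_orbits_mul_card_group (Perm α)
    (MarkedWord α a m)
  rw [Fintype.card_perm] at hburnside
  simp only [← Nat.card_eq_fintype_card (α := MulAction.fixedBy _ _)] at hburnside
  simp only [map_smul, map_sum, map_nsmul, smul_eq_mul]
  simp only [nsmul_eq_mul, fixCount_mul_coeff]
  rw [← card_orbits_markedWord ha m,
    inv_mul_eq_iff_eq_mul₀ (Nat.cast_ne_zero.2 (Nat.factorial_ne_zero _)), mul_comm,
    Nat.card_eq_fintype_card]
  exact_mod_cast hburnside

end Burnside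

/-! ### Schur functions of a row and of a hook -/

section Tableaux

variable {μ : YoungDiagram} {k : ℕ}

theorem row_eq_sortedEntry (T : SemistandardYoungTableau μ) (hrow : ∀ j < k, (0, j) ∈ μ) {j : ℕ}
    (hj : j < k) : T 0 j = sortedEntry (content (Finset.range k) (T 0)) j :=
  eq_sortedEntry (monotoneOn_iff_forall_lt.2 fun _ _ b hb hab => T.row_weak hab (hrow b hb)) hj

theorem mem_map_sectR_range {c : ℕ × ℕ} :
    c ∈ (Finset.range k).map (Function.Embedding.sectR 0 ℕ) ↔ c.1 = 0 ∧ c.2 < k := by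
  obtain ⟨i, j⟩ := c
  simp only [Finset.mem_map, Finset.mem_range, Function.Embedding.sectR_apply, Prod.mk.injEq]
  constructor
  · rintro ⟨_, hj, rfl, rfl⟩
    exact ⟨rfl, hj⟩
  · rintro ⟨rfl, hj⟩
    exact ⟨j, hj, rfl, rfl⟩

theorem content_cells_row (hμ : ∀ c, c ∈ μ ↔ c.1 = 0 ∧ c.2 < k)
    (T : SemistandardYoungTableau μ) :
    content μ.cells (fun c => T c.1 c.2) = content (Finset.range k) (T 0) := by
  have hcells : μ.cells = (Finset.range k).map (Function.Embedding.sectR 0 ℕ) := by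
    ext c
    rw [YoungDiagram.mem_cells, hμ, mem_map_sectR_range]
  rw [hcells, content_map]
  rfl

theorem content_cells_hook (hμ : ∀ c, c ∈ μ ↔ (c.1 = 0 ∧ c.2 < k) ∨ c = (1, 0))
    (T : SemistandardYoungTableau μ) :
    content μ.cells (fun c => T c.1 c.2) =
      Finsupp.single (T 1 0) 1 + content (Finset.range k) (T 0) := by
  have hnotMem : (1, 0) ∉ (Finset.range k).map (Function.Embedding.sectR 0 ℕ) := fun h =>
    one_ne_zero (mem_map_sectR_range.1 h).1
  have hcells : μ.cells = Finset.cons (1, 0) _ hnotMem := by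
    ext c
    rw [YoungDiagram.mem_cells, hμ, Finset.mem_cons, mem_map_sectR_range, or_comm]
  rw [hcells, content, Finset.sum_cons]
  exact congrArg _ (content_map (Function.Embedding.sectR 0 ℕ) _ _)

theorem degree_content_cells_hook (hμ : ∀ c, c ∈ μ ↔ (c.1 = 0 ∧ c.2 < k) ∨ c = (1, 0))
    (T : SemistandardYoungTableau μ) :
    (content μ.cells fun c => T c.1 c.2).degree = k + 1 := by
  rw [content_cells_hook hμ, map_add, degree_content, Finset.card_range, Finsupp.degree_single,
    add_comm]

/-- The filling of a one-row diagram by the weakly increasing word of content `m`. -/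
def rowTableau (hμ : ∀ c, c ∈ μ ↔ c.1 = 0 ∧ c.2 < k) {m : ℕ →₀ ℕ} (hm : m.degree = k) :
    SemistandardYoungTableau μ where
  entry i j := if i = 0 ∧ j < k then sortedEntry m j else 0
  row_weak' {i j₁ j₂} hj hmem := by
    obtain ⟨hi, hj₂⟩ := (hμ _).1 hmem
    rw [if_pos ⟨hi, hj.trans hj₂⟩, if_pos ⟨hi, hj₂⟩]
    exact sortedEntry_monotoneOn m (hm ▸ hj.trans hj₂) (hm ▸ hj₂) hj.le
  col_strict' {i₁ i₂ j} hi hmem := absurd ((hμ _).1 hmem).1 (Nat.ne_of_gt (Nat.zero_lt_of_lt hi))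
  zeros' {i j} hmem := if_neg fun h => hmem ((hμ (i, j)).2 h)

theorem content_rowTableau (hμ : ∀ c, c ∈ μ ↔ c.1 = 0 ∧ c.2 < k) {m : ℕ →₀ ℕ} (hm : m.degree = k) :
    content (Finset.range k) (rowTableau hμ hm 0) = m := by
  conv_rhs => rw [← content_sortedEntry m, hm]
  refine Finset.sum_congr rfl fun j hj => ?_
  exact congrArg (Finsupp.single · 1) (if_pos ⟨rfl, Finset.mem_range.1 hj⟩)

theorem card_tableaux_row (hμ : ∀ c, c ∈ μ ↔ c.1 = 0 ∧ c.2 < k) (m : ℕ →₀ ℕ) :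
    Nat.card {T : SemistandardYoungTableau μ // content μ.cells (fun c => T c.1 c.2) = m} =
      if m.degree = k then 1 else 0 := by
  simp only [content_cells_row hμ]
  split_ifs with hm
  · refine Nat.card_eq_one_iff_unique.2 ⟨⟨?_⟩, ⟨⟨rowTableau hμ hm, content_rowTableau hμ hm⟩⟩⟩
    rintro ⟨T, hT⟩ ⟨T', hT'⟩
    refine Subtype.ext (SemistandardYoungTableau.ext fun i j => ?_)
    by_cases hc : (i, j) ∈ μ
    · obtain ⟨rfl : i = 0, hj : j < k⟩ := (hμ _).1 hc
      have hrow : ∀ j < k, (0, j) ∈ μ := fun j hj => (hμ _).2 ⟨rfl, hj⟩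
      rw [row_eq_sortedEntry T hrow hj, row_eq_sortedEntry T' hrow hj, hT, hT']
    · rw [T.zeros hc, T'.zeros hc]
  · refine Nat.card_eq_zero.2 (.inl ⟨fun ⟨T, hT⟩ => hm ?_⟩)
    rw [← hT, degree_content, Finset.card_range]

/-- The filling of the diagram of shape `(k, 1)` by the weakly increasing word of content `m` in
the first row and by `i` below it. -/
def hookTableau (hμ : ∀ c, c ∈ μ ↔ (c.1 = 0 ∧ c.2 < k) ∨ c = (1, 0)) {m : ℕ →₀ ℕ}
    (hm : m.degree = k) (hk : 0 < k) {i : ℕ} (hi : sortedEntry m 0 < i) :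
    SemistandardYoungTableau μ where
  entry a b := if a = 0 ∧ b < k then sortedEntry m b else if (a, b) = (1, 0) then i else 0
  row_weak' {a b₁ b₂} hb hmem := by
    rcases (hμ _).1 hmem with ⟨ha, hb₂⟩ | hab
    · rw [if_pos ⟨ha, hb.trans hb₂⟩, if_pos ⟨ha, hb₂⟩]
      exact sortedEntry_monotoneOn m (hm ▸ hb.trans hb₂) (hm ▸ hb₂) hb.le
    · exact absurd (congrArg Prod.snd hab) (Nat.ne_of_gt (Nat.zero_lt_of_lt hb))
  col_strict' {a₁ a₂ b} ha hmem := by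
    rcases (hμ _).1 hmem with ⟨h, -⟩ | h
    · exact absurd h (Nat.ne_of_gt (Nat.zero_lt_of_lt ha))
    · obtain ⟨rfl, rfl⟩ := Prod.mk.inj h
      obtain rfl := Nat.lt_one_iff.1 ha
      rwa [if_pos ⟨rfl, hk⟩, if_neg (by simp), if_pos rfl]
  zeros' {a b} hmem := by
    rw [if_neg fun h => hmem ((hμ (a, b)).2 (.inl h)),
      if_neg fun h => hmem ((hμ (a, b)).2 (.inr h))]

theorem content_hookTableau (hμ : ∀ c, c ∈ μ ↔ (c.1 = 0 ∧ c.2 < k) ∨ c = (1, 0)) {m : ℕ →₀ ℕ}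
    (hm : m.degree = k) (hk : 0 < k) {i : ℕ} (hi : sortedEntry m 0 < i) :
    content (Finset.range k) (hookTableau hμ hm hk hi 0) = m := by
  conv_rhs => rw [← content_sortedEntry m, hm]
  refine Finset.sum_congr rfl fun j hj => ?_
  exact congrArg (Finsupp.single · 1) (if_pos ⟨rfl, Finset.mem_range.1 hj⟩)

theorem hookTableau_one_zero (hμ : ∀ c, c ∈ μ ↔ (c.1 = 0 ∧ c.2 < k) ∨ c = (1, 0)) {m : ℕ →₀ ℕ}
    (hm : m.degree = k) (hk : 0 < k) {i : ℕ} (hi : sortedEntry m 0 < i) :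
    hookTableau hμ hm hk hi 1 0 = i := rfl

theorem tableau_ext_of_hook (hμ : ∀ c, c ∈ μ ↔ (c.1 = 0 ∧ c.2 < k) ∨ c = (1, 0))
    {T T' : SemistandardYoungTableau μ} (h10 : T 1 0 = T' 1 0)
    (hrow : content (Finset.range k) (T 0) = content (Finset.range k) (T' 0)) : T = T' := by
  have hmem : ∀ j < k, (0, j) ∈ μ := fun j hj => (hμ _).2 (.inl ⟨rfl, hj⟩)
  ext i j
  by_cases hc : (i, j) ∈ μ
  · rcases (hμ _).1 hc with ⟨rfl : i = 0, hj : j < k⟩ | hij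
    · rw [row_eq_sortedEntry T hmem hj, row_eq_sortedEntry T' hmem hj, hrow]
    · obtain ⟨rfl, rfl⟩ := Prod.mk.inj hij
      exact h10
  · rw [T.zeros hc, T'.zeros hc]

theorem sortedEntry_zero_lt_of_lt {m : ℕ →₀ ℕ} {l i : ℕ} (hl : m l ≠ 0) (hli : l < i) :
    sortedEntry m 0 < i := by
  obtain ⟨j, hj, rfl⟩ := exists_sortedEntry_eq hl
  exact (sortedEntry_monotoneOn m (Nat.zero_lt_of_lt hj) hj j.zero_le).trans_lt hli

theorem card_filter_exists_lt {s : Finset ℕ} (hs : s.Nonempty) :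
    Finset.card {i ∈ s | ∃ l ∈ s, l < i} + 1 = s.card := by
  have herase : s.filter (fun i => ∃ l ∈ s, l < i) = s.erase (s.min' hs) := by
    ext i
    rw [Finset.mem_filter, Finset.mem_erase, and_comm]
    refine and_congr_left fun hi => ⟨?_, fun hne => ?_⟩
    · rintro ⟨l, hl, hli⟩ rfl
      exact hli.not_ge (s.min'_le l hl)
    · exact ⟨s.min' hs, s.min'_mem hs, (s.min'_le i hi).lt_of_ne hne.symm⟩
  rw [herase, Finset.card_erase_add_one (s.min'_mem hs)]

theorem card_tableaux_hook (hμ : ∀ c, c ∈ μ ↔ (c.1 = 0 ∧ c.2 < k) ∨ c = (1, 0)) (hk : 0 < k)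
    {m : ℕ →₀ ℕ} (hm : m.degree = k + 1) :
    Nat.card {T : SemistandardYoungTableau μ // content μ.cells (fun c => T c.1 c.2) = m} =
      Finset.card {i ∈ m.support | ∃ l ∈ m.support, l < i} := by
  simp only [content_cells_hook hμ]
  rw [← Nat.card_eq_finsetCard]
  have hval (T : {T : SemistandardYoungTableau μ //
      Finsupp.single (T 1 0) 1 + content (Finset.range k) (T 0) = m}) :
      T.1 1 0 ∈ m.support.filter fun i => ∃ l ∈ m.support, l < i := by
    obtain ⟨T, rfl⟩ := T
    have hpos : 0 < content (Finset.range k) (T 0) (T 0 0) := by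
      rw [content_apply]
      exact Finset.card_pos.2 ⟨0, by simpa using hk⟩
    simp only [Finset.mem_filter, Finsupp.mem_support_iff, Finsupp.add_apply]
    refine ⟨by simp, T 0 0, by omega, T.col_strict zero_lt_one ((hμ _).2 (.inr rfl))⟩
  refine Nat.card_eq_of_bijective (fun T => ⟨T.1 1 0, hval T⟩) ⟨?_, ?_⟩
  · rintro ⟨T, hT⟩ ⟨T', hT'⟩ h
    have h10 : T 1 0 = T' 1 0 := congrArg Subtype.val h
    rw [← hT', h10] at hT
    exact Subtype.ext (tableau_ext_of_hook hμ h10 (add_left_cancel hT))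
  · rintro ⟨i, hi⟩
    obtain ⟨him, l, hl, hli⟩ := Finset.mem_filter.1 hi
    rw [Finsupp.mem_support_iff] at him hl
    obtain ⟨m, rfl⟩ := exists_add_of_le (Finsupp.single_le_iff.2 (Nat.one_le_iff_ne_zero.2 him))
    rw [map_add, Finsupp.degree_single, add_comm, add_left_inj] at hm
    rw [Finsupp.add_apply, Finsupp.single_eq_of_ne hli.ne, zero_add] at hl
    have hfirst := sortedEntry_zero_lt_of_lt hl hli
    refine ⟨⟨hookTableau hμ hm hk hfirst, ?_⟩, Subtype.ext (hookTableau_one_zero hμ hm hk hfirst)⟩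
    rw [hookTableau_one_zero, content_hookTableau]

end Tableaux

section Schur

variable {n : ℕ}

theorem sort_parts_indiscrete (hn : n ≠ 0) :
    (Nat.Partition.indiscrete n).parts.sort (· ≥ ·) = [n] := by
  rw [Nat.Partition.indiscrete_parts hn, Multiset.sort_singleton]

theorem parts_twoPart {a : ℕ} (ha : a ≤ n) :
    (twoPart n a ha).parts = ({n - a, a} : Multiset ℕ).filter (· ≠ 0) := rfl

theorem sort_parts_twoPart_one (hn : 2 ≤ n) :
    (twoPart n 1 (one_le_two.trans hn)).parts.sort (· ≥ ·) = [n - 1, 1] := by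
  have hparts : ({n - 1, 1} : Multiset ℕ).filter (· ≠ 0) = (n - 1) ::ₘ {1} := by
    rw [Multiset.filter_eq_self.2, Multiset.insert_eq_cons]
    simp
    omega
  rw [parts_twoPart, hparts, Multiset.sort_cons, Multiset.sort_singleton]
  simp
  omega

theorem mem_diagram_indiscrete (hn : n ≠ 0) (c : ℕ × ℕ) :
    c ∈ diagram (Nat.Partition.indiscrete n) ↔ c.1 = 0 ∧ c.2 < n := by
  rw [diagram, YoungDiagram.mem_ofRowLens]
  simp [sort_parts_indiscrete hn]

theorem mem_diagram_twoPart_one (hn : 2 ≤ n) (c : ℕ × ℕ) :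
    c ∈ diagram (twoPart n 1 (one_le_two.trans hn)) ↔
      (c.1 = 0 ∧ c.2 < n - 1) ∨ c = (1, 0) := by
  rw [diagram, YoungDiagram.mem_ofRowLens]
  simp only [sort_parts_twoPart_one hn]
  obtain ⟨_ | _ | i, j⟩ := c <;> simp

theorem completeHomogeneous_zero : completeHomogeneous 0 = 1 := by
  classical
  ext m
  rw [MvPowerSeries.coeff_one]
  change (if m.degree = 0 then (1 : ℂ) else 0) = _
  simp only [Finsupp.degree_eq_zero_iff]

theorem hSym_twoPart {a : ℕ} (ha : a ≤ n) :
    hSym (twoPart n a ha) = completeHomogeneous a * completeHomogeneous (n - a) := by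
  rw [hSym, parts_twoPart, Multiset.insert_eq_cons, Multiset.filter_cons,
    Multiset.filter_singleton, mul_comm]
  split_ifs with h₁ h₂ h₂ <;> simp_all [completeHomogeneous_zero]

theorem hSym_indiscrete (hn : n ≠ 0) :
    hSym (Nat.Partition.indiscrete n) = completeHomogeneous n := by
  rw [hSym, Nat.Partition.indiscrete_parts hn, Multiset.map_singleton, Multiset.prod_singleton]

theorem coeff_schur (μ : n.Partition) (m : ℕ →₀ ℕ) :
    MvPowerSeries.coeff m (schur μ) =
      (Nat.card {T : SemistandardYoungTableau (diagram μ) //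
        content (diagram μ).cells (fun c => T c.1 c.2) = m} : ℂ) := by
  simp only [DFunLike.ext_iff, content_apply]
  rfl

theorem schur_indiscrete (hn : n ≠ 0) :
    schur (Nat.Partition.indiscrete n) = completeHomogeneous n := by
  ext m
  rw [coeff_schur, card_tableaux_row (mem_diagram_indiscrete hn), Nat.cast_ite, Nat.cast_one,
    Nat.cast_zero]
  rfl

theorem card_antidiagonal_degree_one (k : ℕ) (m : ℕ →₀ ℕ) (hm : m.degree = k + 1) :
    Finset.card {x ∈ Finset.HasAntidiagonal.antidiagonal m | x.1.degree = 1 ∧ x.2.degree = k} =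
      m.support.card := by
  symm
  refine Finset.card_bij (fun i _ => (Finsupp.single i 1, m - Finsupp.single i 1)) ?_ ?_ ?_
  · intro i hi
    obtain ⟨m', rfl⟩ := exists_add_of_le
      (Finsupp.single_le_iff.2 (Nat.one_le_iff_ne_zero.2 (Finsupp.mem_support_iff.1 hi)))
    rw [map_add, Finsupp.degree_single, add_comm, add_left_inj] at hm
    rw [Finset.mem_filter, Finset.HasAntidiagonal.mem_antidiagonal, add_tsub_cancel_left]
    exact ⟨rfl, Finsupp.degree_single .., hm⟩
  · exact fun i _ j _ h => Finsupp.single_left_injective one_ne_zero (congrArg Prod.fst h)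
  · rintro ⟨m₁, m₂⟩ hx
    rw [Finset.mem_filter, Finset.HasAntidiagonal.mem_antidiagonal] at hx
    obtain ⟨rfl, h₁, -⟩ := hx
    obtain ⟨i, rfl⟩ := (Finsupp.sum_eq_one_iff m₁).1 h₁
    exact ⟨i, by simp, by simp⟩

theorem schur_twoPart_one (hn : 2 ≤ n) :
    schur (twoPart n 1 (one_le_two.trans hn)) =
      completeHomogeneous 1 * completeHomogeneous (n - 1) - completeHomogeneous n := by
  ext m
  have hμ := mem_diagram_twoPart_one hn
  have hcoeff : MvPowerSeries.coeff m (completeHomogeneous n) = if m.degree = n then 1 else 0 := rfl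
  rw [map_sub, coeff_schur, coeff_completeHomogeneous_mul, hcoeff, eq_sub_iff_add_eq]
  split_ifs with hm
  · have hm' : m.degree = n - 1 + 1 := by omega
    have hne : m.support.Nonempty := by
      rw [Finsupp.support_nonempty_iff]
      rintro rfl
      rw [map_zero] at hm
      omega
    rw [card_tableaux_hook hμ (by omega) hm', card_antidiagonal_degree_one _ _ hm']
    exact_mod_cast card_filter_exists_lt hne
  · have hcard : m.degree ≠ n - 1 + 1 := by omega
    rw [Nat.card_eq_zero.2 (.inl ⟨fun ⟨T, hT⟩ => hcard (hT ▸ degree_content_cells_hook hμ T)⟩),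
      Finset.filter_eq_empty_iff.2]
    · simp
    · rintro ⟨m₁, m₂⟩ hx ⟨h₁, h₂⟩
      rw [Finset.HasAntidiagonal.mem_antidiagonal] at hx
      apply hm
      rw [← hx, map_add, h₁, h₂]
      omega

end Schur

/-! ### Blocks with two vertices and larger blocks -/

section BlockShapes

variable {V : Type*} {G : SimpleGraph V} {B B' : G.Subgraph} {i j : V}

theorem not_isCutVertex_or_not_isCutVertex_of_mem_leafBlocks (hB : B ∈ leafBlocks G) (hij : i ≠ j)
    (hi : i ∈ B.verts) (hj : j ∈ B.verts) : ¬ IsCutVertex G i ∨ ¬ IsCutVertex G j := by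
  obtain ⟨hblock, hleaf⟩ := hB
  by_contra! hcut
  have hone : ((blockCutTree G).neighborSet (.inr ⟨B, hblock⟩)).Subsingleton :=
    Set.encard_le_one_iff_subsingleton.1 hleaf.le
  have heq := hone (x := .inl ⟨i, hcut.1⟩) hi (y := .inl ⟨j, hcut.2⟩) hj
  exact hij (congrArg Subtype.val (Sum.inl.inj heq))

namespace IsBlock

section Nontrivial

variable [Nontrivial V]

theorem exists_verts_eq_pair_or_two_lt_ncard [Finite V] (hB : IsBlock B) (hG : G.Connected) :
    (∃ i j, G.Adj i j ∧ B.verts = {i, j}) ∨ 2 < B.verts.ncard := by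
  obtain ⟨i, hi⟩ := (hB.nontrivial_verts hG).nonempty
  obtain ⟨j, hj, hij⟩ := hB.exists_adj hG hi
  refine or_iff_not_imp_right.2 fun hcard => ⟨i, j, hij, ?_⟩
  refine (Set.eq_of_subset_of_ncard_le (Set.pair_subset hi hj) ?_).symm
  rw [Set.ncard_pair hij.ne]
  exact not_lt.1 hcard

theorem eq_of_verts_eq (hB : IsBlock B) (hB' : IsBlock B') (hG : G.Connected)
    (h : B.verts = B'.verts) : B = B' := by
  obtain ⟨i, hi, j, hj, hij⟩ := hB.nontrivial_verts hG
  rw [hB.eq_edgeBlock hij hi hj, hB'.eq_edgeBlock hij (h ▸ hi) (h ▸ hj)]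

end Nontrivial

theorem deleteEdges_eq_sdiff_spanningCoe (hB : IsBlock B) (hverts : B.verts = {i, j}) :
    G.deleteEdges {s(i, j)} = G \ B.spanningCoe := by
  ext x y
  rw [SimpleGraph.deleteEdges_adj, SimpleGraph.sdiff_adj, SimpleGraph.Subgraph.spanningCoe_adj,
    hB.adj_iff, hverts]
  refine and_congr_right fun hxy => not_congr ?_
  have hne := hxy.ne
  simp only [Set.mem_singleton_iff, Sym2.eq_iff, Set.mem_insert_iff]
  grind

theorem reachable_deleteEdges_iff (hB : IsBlock B) (hG : G.Connected) (hverts : B.verts = {i, j})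
    {x y : V} :
    (G.deleteEdges {s(i, j)}).Reachable x y ↔ blockProj B x = blockProj B y := by
  rw [hB.deleteEdges_eq_sdiff_spanningCoe hverts, hB.blockProj_eq_iff hG]

theorem blockProj_eq_or_eq (hB : IsBlock B) (hG : G.Connected) (hverts : B.verts = {i, j}) (x : V) :
    blockProj B x = i ∨ blockProj B x = j := by
  have hx := hB.blockProj_mem hG x
  rwa [hverts] at hx

section Fintype

variable [Fintype V] [DecidableEq V]

theorem card_branch_add_card_branch (hB : IsBlock B) (hG : G.Connected) (hij : i ≠ j)
    (hverts : B.verts = {i, j}) : (branch B i).card + (branch B j).card = Fintype.card V := by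
  have hcompl : (branch B i)ᶜ = branch B j := by
    ext x
    rw [Finset.mem_compl, mem_branch, mem_branch]
    exact ⟨(hB.blockProj_eq_or_eq hG hverts x).resolve_left, fun h h' => hij (h' ▸ h)⟩
  rw [← hcompl, Finset.card_add_card_compl]

theorem card_branch_eq_one [Nontrivial V] (hB : IsBlock B) (hG : G.Connected) (hi : i ∈ B.verts)
    (hcut : ¬ IsCutVertex G i) : (branch B i).card = 1 := by
  rw [hB.isCutVertex_iff hG hi] at hcut
  push Not at hcut
  refine Finset.card_eq_one.2 ⟨i, Finset.eq_singleton_iff_unique_mem.2 ⟨?_, fun x hx => ?_⟩⟩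
  · exact mem_branch.2 (hB.blockProj_eq_self hG hi)
  · exact not_not.1 fun hne => hcut x hne (mem_branch.1 hx)

theorem ncard_supp_eq_card_branch (hB : IsBlock B) (hG : G.Connected) (hverts : B.verts = {i, j})
    (c : (G.deleteEdges {s(i, j)}).ConnectedComponent) :
    c.supp.ncard = (branch B i).card ∨ c.supp.ncard = (branch B j).card := by
  induction c using SimpleGraph.ConnectedComponent.ind with | _ v =>
  have hsupp : ((G.deleteEdges {s(i, j)}).connectedComponentMk v).supp =
      branch B (blockProj B v) := by
    ext x
    rw [SimpleGraph.ConnectedComponent.mem_supp_iff, SimpleGraph.ConnectedComponent.eq,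
      hB.reachable_deleteEdges_iff hG hverts, Finset.mem_coe, mem_branch]
  rw [hsupp, Set.ncard_coe_finset]
  exact (hB.blockProj_eq_or_eq hG hverts v).imp (congrArg fun k => (branch B k).card)
    (congrArg fun k => (branch B k).card)

theorem exists_card_branch_lt [Nontrivial V] (hB : IsBlock B) (hG : G.Connected) (hi : i ∈ B.verts)
    (hone : (branch B i).card ≠ 1) :
    ∃ B' : Block G, ∃ k ∈ B'.1.verts, (branch B'.1 k).card < (branch B i).card := by
  have hcut := not_not.1 (mt (hB.card_branch_eq_one hG hi) hone)
  obtain ⟨x, hxi, hx⟩ := (hB.isCutVertex_iff hG hi).1 hcut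
  obtain ⟨w⟩ := hx ▸ (hB.blockProj_spec hG x).2.symm
  cases w with
  | nil => exact absurd rfl hxi
  | @cons _ k _ hik _ =>
    have hkB : blockProj B k = i := by
      rw [← hB.blockProj_eq_of_adj hG hik.1 hik.2, hB.blockProj_eq_self hG hi]
    have hik := hik.1
    have hB' := isBlock_edgeBlock hik
    have hiB' := hB'.blockProj_eq_self hG (left_mem_edgeBlockVerts hik)
    have hkB' := hB'.blockProj_eq_self hG (right_mem_edgeBlockVerts hik)
    refine ⟨⟨_, hB'⟩, k, right_mem_edgeBlockVerts hik, Finset.card_lt_card ?_⟩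
    refine (Finset.ssubset_iff_of_subset fun z hz => ?_).2 ⟨i, ?_, ?_⟩
    · rw [mem_branch] at hz ⊢
      refine hB.blockProj_eq_of_reachableAvoiding hG ?_ hkB
      exact hB'.reachableAvoiding_of_blockProj_ne hG (left_mem_edgeBlockVerts hik)
        (hkB'.trans_ne hik.ne') (hz.trans_ne hik.ne')
    · exact mem_branch.2 (hB.blockProj_eq_self hG hi)
    · rw [mem_branch, hiB']
      exact hik.ne

end Fintype

end IsBlock

theorem exists_card_branch_eq_one [Fintype V] [DecidableEq V] [Nontrivial V] (hG : G.Connected) :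
    ∃ B : Block G, ∃ i ∈ B.1.verts, (branch B.1 i).card = 1 := by
  have hex : ∃ c, ∃ B : Block G, ∃ i ∈ B.1.verts, (branch B.1 i).card = c := by
    obtain ⟨v⟩ := hG.nonempty
    obtain ⟨y, hy⟩ := hG.preconnected.exists_adj_of_nontrivial v
    exact ⟨_, ⟨edgeBlock G v y, isBlock_edgeBlock hy⟩, v, left_mem_edgeBlockVerts hy, rfl⟩
  classical
  obtain ⟨B, i, hi, hcard⟩ := Nat.find_spec hex
  refine ⟨B, i, hi, not_not.1 fun hone => ?_⟩
  obtain ⟨B', k, hk, hlt⟩ := B.2.exists_card_branch_lt hG hi hone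
  exact Nat.find_min hex (hcard ▸ hlt) ⟨B', k, hk, rfl⟩

theorem mem_internalCutEdges [Fintype V] {e : Sym2 V} : e ∈ internalCutEdges G ↔
    e ∈ G.edgeSet ∧ ∃ B ∈ internalBlocks G, B.verts = (e : Set V) := by
  simp only [internalCutEdges, Finset.mem_filter_univ]

theorem not_connected_deleteEdges_of_mem_internalCutEdges [Fintype V] (hG : G.Connected)
    {e : Sym2 V} (he : e ∈ internalCutEdges G) : ¬ (G.deleteEdges {e}).Connected := by
  obtain ⟨he, B, ⟨hB, -⟩, hverts⟩ := mem_internalCutEdges.1 he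
  induction e with | _ i j =>
  rw [Sym2.coe_mk] at hverts
  intro hconn
  have heq := (hB.reachable_deleteEdges_iff hG hverts).1 (hconn.preconnected i j)
  rw [hB.blockProj_eq_self hG (hverts ▸ .inl rfl),
    hB.blockProj_eq_self hG (hverts ▸ .inr rfl)] at heq
  exact SimpleGraph.Adj.ne he heq

end BlockShapes

section BlockSums

variable {V : Type*} {G : SimpleGraph V}

open Classical in
theorem card_filter_leaf_or_two_lt_ncard [Finite V] [Fintype (Block G)] :
    Finset.card {B : Block G | B.1 ∈ leafBlocks G ∨ 2 < B.1.verts.ncard} = blockCount G := by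
  have hfinite {S : Set G.Subgraph} (hS : ∀ B ∈ S, IsBlock B) : S.Finite :=
    (Set.toFinite {B : G.Subgraph | IsBlock B}).subset hS
  rw [blockCount, ← Set.ncard_union_eq (Set.disjoint_left.2 fun B hB hB' => hB'.1.2 hB)
      (hfinite fun B hB => hB.1) (hfinite fun B hB => hB.1.1),
    ← Set.ncard_coe_finset, ← Set.ncard_image_of_injective _ Subtype.val_injective]
  congr 1
  ext B
  simp only [Finset.coe_filter_univ, Set.mem_image, Set.mem_ofPred_eq, Subtype.exists,
    exists_and_right, exists_eq_right, Set.mem_union, internalBlocks]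
  constructor
  · rintro ⟨hB, h⟩
    tauto
  · rintro (h | ⟨⟨hB, -⟩, h⟩)
    · exact ⟨h.1, .inl h⟩
    · exact ⟨hB, .inr h⟩

variable [Fintype V] [Nontrivial V] [Fintype (Block G)] {M : Type*} [AddCommMonoid M]
  (f : Block G → M) {g : Sym2 V → M}

open Classical in
theorem sum_filter_not_leaf_or_two_lt_ncard (hG : G.Connected)
    (hg : ∀ B, ∀ e ∈ internalCutEdges G, B.1.verts = (e : Set V) → f B = g e) :
    ∑ B : Block G with ¬ (B.1 ∈ leafBlocks G ∨ 2 < B.1.verts.ncard), f B =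
      ∑ e ∈ internalCutEdges G, g e := by
  have hex (B : Block G)
      (hB : B ∈ Finset.univ.filter fun B : Block G =>
        ¬ (B.1 ∈ leafBlocks G ∨ 2 < B.1.verts.ncard)) :
      ∃ e ∈ internalCutEdges G, B.1.verts = (e : Set V) := by
    obtain ⟨hleaf, hcard⟩ := not_or.1 (Finset.mem_filter.1 hB).2
    obtain ⟨i, j, hij, hverts⟩ :=
      (B.2.exists_verts_eq_pair_or_two_lt_ncard hG).resolve_right hcard
    rw [← Sym2.coe_mk] at hverts
    exact ⟨s(i, j), mem_internalCutEdges.2 ⟨hij, B.1, ⟨B.2, hleaf⟩, hverts⟩, hverts⟩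
  choose edge hedge hverts using hex
  refine Finset.sum_bij edge hedge (fun B hB B' hB' h => ?_) (fun e he => ?_)
    fun B hB => hg B _ (hedge B hB) (hverts B hB)
  · exact Subtype.ext (B.2.eq_of_verts_eq B'.2 hG (by rw [hverts B hB, hverts B' hB', h]))
  · obtain ⟨hadj, B, hB, hBe⟩ := mem_internalCutEdges.1 he
    have hcard : B.verts.ncard = 2 := by
      induction e with | _ i j =>
      rw [hBe, Sym2.coe_mk, Set.ncard_pair (SimpleGraph.Adj.ne hadj)]
    have hmem : ⟨B, hB.1⟩ ∈ Finset.univ.filter fun B : Block G =>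
        ¬ (B.1 ∈ leafBlocks G ∨ 2 < B.1.verts.ncard) :=
      Finset.mem_filter.2 ⟨Finset.mem_univ _, not_or.2 ⟨hB.2, hcard.not_gt⟩⟩
    exact ⟨_, hmem, SetLike.coe_injective (by rw [← hverts _ hmem, hBe])⟩

theorem sum_block_eq (hG : G.Connected) {c : M}
    (hc : ∀ B, B.1 ∈ leafBlocks G ∨ 2 < B.1.verts.ncard → f B = c)
    (hg : ∀ B, ∀ e ∈ internalCutEdges G, B.1.verts = (e : Set V) → f B = g e) :
    ∑ B, f B = blockCount G • c + ∑ e ∈ internalCutEdges G, g e := by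
  classical
  rw [← Finset.sum_filter_add_sum_filter_not _ fun B : Block G =>
      B.1 ∈ leafBlocks G ∨ 2 < B.1.verts.ncard,
    sum_filter_not_leaf_or_two_lt_ncard f hG hg,
    Finset.sum_congr rfl fun B hB => hc B (Finset.mem_filter.1 hB).2, Finset.sum_const,
    card_filter_leaf_or_two_lt_ncard]

end BlockSums

section ModelCard

variable {V : Type*} [Fintype V] [DecidableEq V] {G : SimpleGraph V} {B : G.Subgraph} {i j : V}

open Classical in
/-- The size of the sets indexing the model of a block: the branch at one of its ends if the block
is an edge, and `1` otherwise. -/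
def modelCard (B : G.Subgraph) : ℕ :=
  if h : ∃ i j, G.Adj i j ∧ B.verts = {i, j} then (branch B h.choose).card else 1

theorem modelCard_eq_card_branch (hij : G.Adj i j) (hverts : B.verts = {i, j}) :
    modelCard B = (branch B i).card ∨ modelCard B = (branch B j).card := by
  have h : ∃ i j, G.Adj i j ∧ B.verts = {i, j} := ⟨i, j, hij, hverts⟩
  obtain ⟨l, -, hl⟩ := h.choose_spec
  have hmem : h.choose ∈ ({i, j} : Set V) := hverts.le (hl.ge (Set.mem_insert _ _))
  rw [modelCard, dif_pos h]
  exact hmem.imp (congrArg fun k => (branch B k).card) (congrArg fun k => (branch B k).card)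

theorem modelCard_eq_one (h : 2 < B.verts.ncard) : modelCard B = 1 := by
  refine dif_neg ?_
  rintro ⟨i, j, hij, hverts⟩
  rw [hverts, Set.ncard_pair hij.ne] at h
  exact lt_irrefl 2 h

variable [Nontrivial V]

theorem modelCard_le (B : G.Subgraph) : modelCard B ≤ Fintype.card V := by
  rw [modelCard]
  split_ifs
  · exact Finset.card_le_univ _
  · exact Fintype.card_pos

theorem exists_blockModel {𝕜 : Type*} [Field 𝕜] (hG : G.Connected) (hB : IsBlock B) :
    ∃ Φ : (Set.powersetCard V (modelCard B) → 𝕜) →ₗ[𝕜] (V → Perm V → 𝕜),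
      BlockModel B (modelCard B) Φ := by
  rcases hB.exists_verts_eq_pair_or_two_lt_ncard hG with ⟨i, j, hij, hverts⟩ | hcard
  · rcases modelCard_eq_card_branch hij hverts with h | h <;> rw [h]
    · exact ⟨_, blockModel_pairModel hG hB hij.ne hverts⟩
    · exact ⟨_, blockModel_pairModel hG hB hij.ne' (hverts.trans (Set.pair_comm i j))⟩
  · rw [modelCard_eq_one hcard]
    exact ⟨_, blockModel_pointModel hG hB hcard⟩

end ModelCard

/-! ### The degree one characters -/

section FrobeniusMap

variable {n : ℕ}

/-- The Frobenius characteristic as a linear map on functions on the symmetric group. -/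
def frobeniusMap (n : ℕ) : (Perm (Fin n) → ℂ) →ₗ[ℂ] MvPowerSeries ℕ ℂ :=
  (n.factorial : ℂ)⁻¹ •
    Fintype.linearCombination ℂ fun w => (w.partition.parts.map powerSum).prod

theorem frobenius_eq_frobeniusMap {V : Type*} [AddCommGroup V] [Module ℂ V]
    (ρ : Representation ℂ (Perm (Fin n)) V) : frobenius ρ = frobeniusMap n ρ.character := rfl

/-- The character of the permutation representation of `S_n` on `a`-element subsets. -/
def subsetCharacter (n a : ℕ) : Perm (Fin n) → ℂ := fun u => fixCount a u

theorem frobeniusMap_subsetCharacter {a : ℕ} (ha : a ≤ n) :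
    frobeniusMap n (subsetCharacter n a) = completeHomogeneous a * completeHomogeneous (n - a) := by
  have h := sum_fixCount_smul (α := Fin n) (a := a) (by simpa using ha)
  simp only [Fintype.card_fin, ← Nat.cast_smul_eq_nsmul ℂ] at h
  exact h

theorem subsetCharacter_zero : subsetCharacter n 0 = 1 := by
  funext u
  have hempty (s : Set.powersetCard (Fin n) 0) : s.1 = ∅ :=
    Finset.card_eq_zero.1 (Set.powersetCard.mem_iff.1 s.2)
  have hsub : Subsingleton (Set.powersetCard (Fin n) 0) :=
    ⟨fun s t => Subtype.ext ((hempty s).trans (hempty t).symm)⟩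
  have hfix : fixCount 0 u = 1 := Nat.card_eq_one_iff_unique.2
    ⟨inferInstance, ⟨⟨⟨∅, Set.powersetCard.mem_iff.2 Finset.card_empty⟩,
      Subsingleton.elim _ _⟩⟩⟩
  rw [subsetCharacter, hfix, Nat.cast_one, Pi.one_apply]

theorem frobeniusMap_one : frobeniusMap n 1 = completeHomogeneous n := by
  rw [← subsetCharacter_zero, frobeniusMap_subsetCharacter n.zero_le, completeHomogeneous_zero,
    one_mul, Nat.sub_zero]

end FrobeniusMap

section BlockSym

variable {n : ℕ} {Γ : SimpleGraph (Fin n)} {B : Γ.Subgraph} {i j : Fin n}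

/-- The contribution of a block to the Frobenius characters in degree one. -/
def blockSym (B : Γ.Subgraph) : MvPowerSeries ℕ ℂ :=
  completeHomogeneous (modelCard B) * completeHomogeneous (n - modelCard B)

theorem blockSym_eq_of_modelCard {a : ℕ} (h : modelCard B = a ∨ modelCard B + a = n) :
    blockSym B = completeHomogeneous a * completeHomogeneous (n - a) := by
  rw [blockSym]
  obtain rfl | h := h
  · rfl
  · rw [mul_comm]
    congr <;> omega

namespace IsBlock

theorem blockSym_eq_hSym_componentPartition (hB : IsBlock B) (hΓ : Γ.Connected) (hij : Γ.Adj i j)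
    (hverts : B.verts = {i, j}) (c : (Γ.deleteEdges {s(i, j)}).ConnectedComponent) :
    blockSym B = hSym (componentPartition c) := by
  have hsum := hB.card_branch_add_card_branch hΓ hij.ne hverts
  have hmodel := modelCard_eq_card_branch hij hverts
  have hsupp := hB.ncard_supp_eq_card_branch hΓ hverts c
  rw [Fintype.card_fin] at hsum
  rw [componentPartition, hSym_twoPart]
  exact blockSym_eq_of_modelCard (by omega)

variable [Nontrivial (Fin n)]

theorem blockSym_eq_of_card_branch_eq_one (hB : IsBlock B) (hΓ : Γ.Connected) (hi : i ∈ B.verts)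
    (hone : (branch B i).card = 1) :
    blockSym B = completeHomogeneous 1 * completeHomogeneous (n - 1) := by
  refine blockSym_eq_of_modelCard ?_
  rcases hB.exists_verts_eq_pair_or_two_lt_ncard hΓ with ⟨k, l, hkl, hverts⟩ | hcard
  · have hsum := hB.card_branch_add_card_branch hΓ hkl.ne hverts
    have hmodel := modelCard_eq_card_branch hkl hverts
    rw [Fintype.card_fin] at hsum
    rw [hverts] at hi
    obtain rfl | rfl := hi <;> omega
  · exact .inl (modelCard_eq_one hcard)

theorem blockSym_eq_of_leaf_or_two_lt_ncard (hB : IsBlock B) (hΓ : Γ.Connected)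
    (h : B ∈ leafBlocks Γ ∨ 2 < B.verts.ncard) :
    blockSym B = completeHomogeneous 1 * completeHomogeneous (n - 1) := by
  obtain hleaf | hcard := h
  · obtain ⟨i, hi, j, hj, hij⟩ := hB.nontrivial_verts hΓ
    obtain hcut | hcut :=
      not_isCutVertex_or_not_isCutVertex_of_mem_leafBlocks hleaf hij hi hj
    · exact hB.blockSym_eq_of_card_branch_eq_one hΓ hi (hB.card_branch_eq_one hΓ hi hcut)
    · exact hB.blockSym_eq_of_card_branch_eq_one hΓ hj (hB.card_branch_eq_one hΓ hj hcut)
  · exact blockSym_eq_of_modelCard (.inl (modelCard_eq_one hcard))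

end IsBlock

theorem rightChar_one_add (hΓ : Γ.Connected) :
    rightChar Γ 1 + n • completeHomogeneous n = frobeniusMap n (tupleRep ℂ Γ).character := by
  rw [rightChar, frobenius_eq_frobeniusMap, ← frobeniusMap_one, ← map_nsmul, ← map_add]
  refine congrArg _ (funext fun u => ?_)
  rw [← rightRep_one_character_add hΓ]
  simp

variable [Nontrivial (Fin n)]

theorem modelCard_le_nat (B : Γ.Subgraph) : modelCard B ≤ n := by
  simpa using modelCard_le B

theorem sum_blockSym [Fintype (Block Γ)] (hΓ : Γ.Connected)
    (C : ∀ e : Sym2 (Fin n), (Γ.deleteEdges {e}).ConnectedComponent) :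
    ∑ B : Block Γ, blockSym B.1 =
      blockCount Γ • (completeHomogeneous 1 * completeHomogeneous (n - 1)) +
        ∑ e ∈ internalCutEdges Γ, hSym (componentPartition (C e)) := by
  refine sum_block_eq _ hΓ (fun B => B.2.blockSym_eq_of_leaf_or_two_lt_ncard hΓ)
    fun B e he hverts => ?_
  have hadj := (mem_internalCutEdges.1 he).1
  revert hverts
  generalize C e = c
  induction e with | _ i j =>
  exact fun hverts =>
    B.2.blockSym_eq_hSym_componentPartition hΓ hadj (hverts.trans Sym2.coe_mk) c

theorem card_block_eq (hΓ : Γ.Connected) :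
    Nat.card (Block Γ) = blockCount Γ + (internalCutEdges Γ).card := by
  have := Fintype.ofFinite (Block Γ)
  rw [Nat.card_eq_fintype_card]
  simpa using sum_block_eq (M := ℕ) (fun _ => 1) hΓ (c := 1) (g := fun _ => 1) (fun _ _ => rfl)
    fun _ _ _ _ => rfl

theorem tupleRep_character_eq [Fintype (Block Γ)] (hΓ : Γ.Connected) :
    (tupleRep ℂ Γ).character =
      ((n : ℂ) - Nat.card (Block Γ)) • 1 + ∑ B : Block Γ, subsetCharacter n (modelCard B.1) := by
  choose Φ hΦ using fun B : Block Γ => exists_blockModel (𝕜 := ℂ) hΓ B.2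
  funext u
  have h := character_tupleRep_add hΓ (fun B => modelCard_le B.1) hΦ u
  rw [Fintype.card_fin, ← eq_sub_iff_add_eq] at h
  rw [h, Pi.add_apply, Finset.sum_apply, Pi.smul_apply, Pi.one_apply, smul_eq_mul, mul_one]
  simp only [subsetCharacter]
  ring

theorem frobeniusMap_tupleRep_character [Fintype (Block Γ)] (hΓ : Γ.Connected) :
    frobeniusMap n (tupleRep ℂ Γ).character =
      ((n : ℂ) - Nat.card (Block Γ)) • completeHomogeneous n + ∑ B : Block Γ, blockSym B.1 := by
  rw [tupleRep_character_eq hΓ, map_add, map_smul, map_sum, frobeniusMap_one]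
  simp only [frobeniusMap_subsetCharacter (modelCard_le_nat _), blockSym]

theorem leftChar_one_add (hΓ : Γ.Connected) :
    leftChar Γ 1 + completeHomogeneous 1 * completeHomogeneous (n - 1) =
      frobeniusMap n (tupleRep ℂ Γ).character := by
  have hn : 1 ≤ n := Fin.pos'
  rw [leftChar, frobenius_eq_frobeniusMap, ← frobeniusMap_subsetCharacter hn, ← map_add]
  exact congrArg _ (funext (leftRep_one_character_add hΓ))

theorem leftChar_one_eq (hΓ : Γ.Connected)
    (C : ∀ e : Sym2 (Fin n), (Γ.deleteEdges {e}).ConnectedComponent) :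
    leftChar Γ 1 =
      ∑ e ∈ internalCutEdges Γ, hSym (componentPartition (C e)) +
        ((blockCount Γ : ℤ) - 1) • (completeHomogeneous 1 * completeHomogeneous (n - 1)) +
        ((n : ℤ) - Nat.card (Block Γ)) • completeHomogeneous n := by
  have := Fintype.ofFinite (Block Γ)
  rw [← add_left_inj, leftChar_one_add hΓ, frobeniusMap_tupleRep_character hΓ, sum_blockSym hΓ C]
  module

theorem rightChar_one_eq (hΓ : Γ.Connected)
    (C : ∀ e : Sym2 (Fin n), (Γ.deleteEdges {e}).ConnectedComponent) :
    rightChar Γ 1 =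
      ∑ e ∈ internalCutEdges Γ, (hSym (componentPartition (C e)) - completeHomogeneous n) +
        blockCount Γ •
          (completeHomogeneous 1 * completeHomogeneous (n - 1) - completeHomogeneous n) := by
  have := Fintype.ofFinite (Block Γ)
  rw [← add_left_inj, rightChar_one_add hΓ, frobeniusMap_tupleRep_character hΓ, sum_blockSym hΓ C,
    card_block_eq hΓ, Finset.sum_sub_distrib, Finset.sum_const]
  push_cast
  module

theorem leftChar_one_mem_span (hΓ : Γ.Connected) :
    leftChar Γ 1 ∈ Submodule.span ℕ (Set.range (hSym : n.Partition → _)) := by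
  classical
  have := Fintype.ofFinite (Block Γ)
  obtain ⟨B₀, i, hi, hone⟩ := exists_card_branch_eq_one hΓ
  obtain ⟨d, hd⟩ := exists_add_of_le (card_block_lt hΓ).le
  rw [Fintype.card_fin] at hd
  have hleft : leftChar Γ 1 =
      d • hSym (Nat.Partition.indiscrete n) + ∑ B ∈ Finset.univ.erase B₀, blockSym B.1 := by
    have h := leftChar_one_add hΓ
    rw [frobeniusMap_tupleRep_character hΓ, ← Finset.add_sum_erase _ _ (Finset.mem_univ B₀),
      B₀.2.blockSym_eq_of_card_branch_eq_one hΓ hi hone] at h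
    have hdiff : (n : ℂ) - Nat.card (Block Γ) = d := by rw [sub_eq_iff_eq_add']; exact_mod_cast hd
    rw [hdiff, Nat.cast_smul_eq_nsmul] at h
    rw [hSym_indiscrete (Fin.pos i).ne']
    linear_combination h
  have hblock (B : Γ.Subgraph) : blockSym B ∈ Set.range (hSym : n.Partition → _) :=
    ⟨twoPart n (modelCard B) (modelCard_le_nat B), hSym_twoPart _⟩
  rw [hleft]
  exact add_mem (Submodule.smul_of_tower_mem _ _ (Submodule.subset_span ⟨_, rfl⟩))
    (sum_mem fun B _ => Submodule.subset_span (hblock B.1))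

end BlockSym

end CayleySpline

end

open CayleySpline in
theorem theoremD (n : ℕ) (hn : 2 ≤ n) (Γ : SimpleGraph (Fin n)) (hΓ : Γ.Connected)
    (C : ∀ e : Sym2 (Fin n), (Γ.deleteEdges {e}).ConnectedComponent) :
    (∀ e ∈ internalCutEdges Γ, ¬ (Γ.deleteEdges {e}).Connected) ∧
      leftChar Γ 1 =
        (∑ e ∈ internalCutEdges Γ, hSym (componentPartition (C e)))
          + ((blockCount Γ : ℤ) - 1) • hSym (twoPart n 1 (one_le_two.trans hn))
          + ((n : ℤ) - 1 - ∑ j ∈ cutVertices Γ, (cutNumber Γ j : ℤ)) •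
              hSym (Nat.Partition.indiscrete n) ∧
      rightChar Γ 1 =
        (∑ e ∈ internalCutEdges Γ,
            (hSym (componentPartition (C e)) - schur (Nat.Partition.indiscrete n)))
          + blockCount Γ • schur (twoPart n 1 (one_le_two.trans hn)) ∧
      0 ≤ (n : ℤ) - 1 - ∑ j ∈ cutVertices Γ, (cutNumber Γ j : ℤ) ∧
      ∃ a : n.Partition → ℕ, leftChar Γ 1 = ∑ μ, a μ • hSym μ := by
  have : Nontrivial (Fin n) := Fin.nontrivial_iff_two_le.2 hn
  have hn₀ : n ≠ 0 := by lia
  have hblocks : (n : ℤ) - 1 - ∑ j ∈ cutVertices Γ, (cutNumber Γ j : ℤ) =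
      n - Nat.card (Block Γ) := by
    rw [← sum_cutNumber_add_one hΓ]
    push_cast
    ring
  have hcard : Nat.card (Block Γ) < n := by simpa using card_block_lt hΓ
  obtain ⟨a, ha⟩ :=
    (Submodule.mem_span_range_iff_exists_fun ℕ).1 (leftChar_one_mem_span hΓ)
  refine ⟨fun e he => not_connected_deleteEdges_of_mem_internalCutEdges hΓ he, ?_, ?_, ?_,
    a, ha.symm⟩
  · rw [hblocks, hSym_twoPart, hSym_indiscrete hn₀]
    exact leftChar_one_eq hΓ C
  · rw [schur_indiscrete hn₀, schur_twoPart_one hn]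
    exact rightChar_one_eq hΓ C
  · rw [hblocks]
    lia
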